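/- **Theorem 3.6 (Compactness).** Let $N\ge 1$, $T>0$, $r\in[1,\infty)$, $Q_T=\mathbb R^N\times(0,T)$, and assume: - $(A_\varphi)$ $\varphi:\mathbb R\to\mathbb R$ is nondecreasing and locally Hölder continuous with exponent $a\in(0,1]$. - $(A_g)$ $g$ is measurable on $Q_T$ and $\int_0^T\big(\|g(\cdot,t)\|_{L^1(\mathbb R^N)}+\|g(\cdot,t)\|_{L^\infty(\mathbb R^N)}\big)\,dt<\infty$. - $(A_{u_0})$ $u_0\in L^1(\mathbb R^N)\cap L^\infty(\mathbb R^N)$. - $(A_\sigma)$ $c\in\{0,1\}$ (the local operator is $c\Delta$). - $(A_\mu)$ $\mu$ is a nonnegative symmetric Radon measure on $\mathbb R^N\setminus\{0\}$ with $\int_{0<|z|\le1}|z|^2\,d\mu(z)+\int_{|z|>1}d\mu(z)<\infty$. *Discrete operators.* For each $h\in(0,1)$ let offsets $z_\gamma=z_{\gamma,h}\in h\mathbb Z^N$ with $z_{-\gamma}=-z_\gamma$ and weights $\omega_{\gamma,h}$ with $\sum_{\gamma\ne0}\omega_{\gamma,h}<\infty$ ($0\ne\gamma\in\mathbb Z^N$)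 be given, and put, with $x_\beta=h\beta$ and $\psi_\beta=\psi(x_\beta)$, $$\mathcal L^h[\psi]_\beta=\sum_{\gamma\neq0}\big(\psi(x_\beta+z_\gamma)-\psi(x_\beta)\big)\,\omega_{\gamma,h},\qquad \psi:h\mathbb Z^N\to\mathbb R .$$ Consider the following conditions on the weights, each of which includes $\omega_{\gamma,h}=\omega_{-\gamma,h}\ge0$ for all $h\in(0,1)$, $\gamma\neq0$: - $(A_{\omega_h})$ $\displaystyle\sup_{0<h<1}\Big\{\sum_{h\le|z_\gamma|\le1}|z_\gamma|^2\omega_{\gamma,h}+\sum_{|z_\gamma|>1}\omega_{\gamma,h}\Big\}<\infty$; - $(A_{\omega_h}')$ $\displaystyle\sup_{0<h<1}\Big\{\sum_{h\le|z_\gamma|\le1}|z_\gamma|^2\omega_{\gamma,h}+\sum_{|z_\gamma|>1}|z_\gamma|\omega_{\gamma,h}\Big\}<\infty$; - $(A_{\omega_h}'')$ for a given $\alpha\in(0,2)$: $(A_{\omega_h})$ holds and $\displaystyle\sup_{R>1}\sup_{0<h<1}\Big\{R^{\alpha-2}\sum_{1<|z_\gamma|\le R}|z_\gamma|^2\omega_{\gamma,h}+R^{\alpha}\sum_{|z_\gamma|>R}\omega_{\gamma,h}\Big\}<\infty$.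 Assume that one of the following holds: 1. $\mathcal L^h[\psi]_\beta=\Delta_h\psi(x_\beta):=\sum_{i=1}^N\frac{\psi(x_\beta+he_i)+\psi(x_\beta-he_i)-2\psi(x_\beta)}{h^2}$ for all $h\in(0,1)$, with weights satisfying $(A_{\omega_h})$, and $\frac{(N-2)^+}{N}<a\le1$; 2. the weights satisfy $(A_{\omega_h}')$ and $\frac{N-1}{N}<a\le1$; 3. the weights satisfy $(A_{\omega_h}'')$ for some $\alpha\in(0,2)$ and $\frac{(N-\alpha)^+}{N}<a\le1$. *Scheme.* For each $h\in(0,1)$ let $0=t_0<t_1<\dots<t_J=T$ be a (possibly nonuniform, $h$-dependent) time grid, $\Delta t_j=t_j-t_{j-1}$, $R_h=h(-\tfrac12,\tfrac12]^N$, and let $U_\beta^j$ ($\beta\in\mathbb Z^N$, $0\le j\le J$) be a solution of $$U_\beta^j=U_\beta^{j-1}+\Delta t_j\,\mathcal L^h[\varphi(U^j_\cdot)]_\beta+\Delta t_j\,G_\beta^j,\qquad \beta\in\mathbb Z^N,\ 1\le j\le J,$$ $$U_\beta^0=\frac1{h^N}\int_{x_\beta+R_h}u_0\,dx,\qquad G_\beta^j=\frac1{h^N\Delta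 t_j}\int_{t_{j-1}}^{t_j}\int_{x_\beta+R_h}g\,dx\,dt,$$ with $\sum_{\beta}|U^j_\beta|<\infty$ for all $j$. Let $\overline{U^j}(x)=\sum_\beta \mathbf 1_{x_\beta+R_h}(x)\,U^j_\beta$, and let $\widetilde{\overline U}_h:\mathbb R^N\times[0,T]\to\mathbb R$ be the interpolant with $\widetilde{\overline U}_h(\cdot,0)=\overline{U^0}$ and $$\widetilde{\overline U}_h(x,t)=\overline{U^{j-1}}(x)+\frac{t-t_{j-1}}{\Delta t_j}\big(\overline{U^j}(x)-\overline{U^{j-1}}(x)\big),\qquad t\in(t_{j-1},t_j].$$ Then for every sequence $(h_k)\subset(0,1)$ with $h_k\to0$ there are a subsequence $(h_{k_n})_n$ and a $u\in C([0,T];L^r(\mathbb R^N))$ such that $\widetilde{\overline U}_{h_{k_n}}\in C([0,T];L^r(\mathbb R^N))$ for all $n$ and $$\widetilde{\overline U}_{h_{k_n}}\to u\qquad\text{in }C([0,T];L^r(\mathbb R^N))\text{ as }n\to\infty .$$ -/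

import Mathlib

open MeasureTheory Set Filter Topology
open scoped NNReal ENNReal

namespace GPME

/-- Physical space `ℝ^N` with its Euclidean norm. -/
abbrev Space (N : ℕ) := EuclideanSpace ℝ (Fin N)

/-- Multi-indices `β ∈ ℤ^N`. A function on the grid `h ℤ^N` is a function of `β`. -/
abbrev Idx (N : ℕ) := Fin N → ℤ

/-- The grid point `x_β = h β`. -/
noncomputable def gridPoint {N : ℕ} (h : ℝ) (β : Idx N) : Space N :=
  WithLp.toLp 2 (fun i => h * (β i : ℝ))

/-- The cell `x_β + h (-1/2, 1/2]^N`. -/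
def cell {N : ℕ} (h : ℝ) (β : Idx N) : Set (Space N) :=
  {x | ∀ i, x i - gridPoint h β i ∈ Ioc (-(h / 2)) (h / 2)}

/-! ### Assumptions on the data -/

/-- The nonlinearity is locally Hölder continuous with exponent `a ∈ (0, 1]` and nondecreasing. -/
structure AssumptionPhi (a : ℝ≥0) (φ : ℝ → ℝ) : Prop where
  exp_pos : 0 < a
  exp_le_one : a ≤ 1
  holder : ∀ K : Set ℝ, IsCompact K → ∃ C : ℝ≥0, HolderOnWith C a φ K
  mono : Monotone φ

/-- The source `g` is Lebesgue measurable on `ℝ^N × (0, T)` and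
`∫_0^T (‖g(·,t)‖_{L^1} + ‖g(·,t)‖_{L^∞}) dt < ∞`. -/
structure AssumptionG {N : ℕ} (T : ℝ) (g : Space N → ℝ → ℝ) : Prop where
  meas : AEStronglyMeasurable (fun p : Space N × ℝ => g p.1 p.2)
    (volume.restrict (univ ×ˢ Ioo 0 T))
  finite : ∫⁻ t in Ioo 0 T,
    (eLpNorm (fun x => g x t) 1 volume + eLpNorm (fun x => g x t) ∞ volume) < ∞

/-- The initial datum is in `L^1 ∩ L^∞`. -/
structure AssumptionU0 {N : ℕ} (u₀ : Space N → ℝ) : Prop where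
  memLp_one : MemLp u₀ 1 volume
  memLp_top : MemLp u₀ ∞ volume

/-- The local part of the operator is `c Δ` with `c ∈ {0, 1}`. -/
def AssumptionSigma (c : ℝ) : Prop := c = 0 ∨ c = 1

/-- `μ` is a symmetric Lévy measure. A measure on `ℝ^N ∖ {0}` is encoded as a measure on `ℝ^N`
without mass at `0`; the moment condition makes it finite away from `0`, hence Radon there. -/
structure AssumptionMu {N : ℕ} (μ : Measure (Space N)) : Prop where
  zero : μ {0} = 0
  symm : μ.map (fun z => -z) = μ
  finite : (∫⁻ z in {z | 0 < ‖z‖ ∧ ‖z‖ ≤ 1}, ENNReal.ofReal (‖z‖ ^ 2) ∂μ) + μ {z | 1 < ‖z‖} < ∞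

/-! ### Discrete operators -/

/-- The data of a discrete operator at a fixed space step: the offsets `z_γ = h · offset γ`, which
lie on the grid and satisfy `z_{-γ} = -z_γ`, and the weights `ω_γ`, which are summable, `γ ≠ 0`.
The values at `γ = 0` are never used. -/
structure Stencil (N : ℕ) where
  offset : Idx N → Idx N
  weight : Idx N → ℝ
  offset_neg : ∀ γ, γ ≠ 0 → offset (-γ) = -offset γ
  summable_weight : Summable (fun γ : {γ : Idx N // γ ≠ 0} => weight γ)

/-- `L^h[ψ]_β = ∑_{γ ≠ 0} (ψ(x_β + z_γ) - ψ(x_β)) ω_γ`. -/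
noncomputable def Stencil.op {N : ℕ} (S : Stencil N) (ψ : Idx N → ℝ) (β : Idx N) : ℝ :=
  ∑' γ : {γ : Idx N // γ ≠ 0}, (ψ (β + S.offset γ) - ψ β) * S.weight γ

/-- `Δ_h ψ(x_β) = ∑_i (ψ(x_β + h e_i) + ψ(x_β - h e_i) - 2 ψ(x_β)) / h²`. -/
noncomputable def discreteLaplacian {N : ℕ} (h : ℝ) (ψ : Idx N → ℝ) (β : Idx N) : ℝ :=
  ∑ i : Fin N, (ψ (β + Pi.single i 1) + ψ (β - Pi.single i 1) - 2 * ψ β) / h ^ 2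

/-- `∑_{γ ≠ 0, |z_γ| ∈ A} |z_γ|^s ω_γ`, computed in `[0, ∞]`. -/
noncomputable def Stencil.moment {N : ℕ} (S : Stencil N) (h : ℝ) (A : Set ℝ) (s : ℕ) : ℝ≥0∞ :=
  ∑' γ : {γ : Idx N // γ ≠ 0},
    A.indicator (fun ρ => ENNReal.ofReal (ρ ^ s)) ‖gridPoint h (S.offset γ)‖ *
      ENNReal.ofReal (S.weight γ)

/-- Symmetric nonnegative weights for every space step `0 < h < 1`. -/
def SymmNonneg {N : ℕ} (S : ℝ → Stencil N) : Prop :=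
  ∀ h ∈ Ioo (0 : ℝ) 1, ∀ γ, γ ≠ 0 → (S h).weight γ = (S h).weight (-γ) ∧ 0 ≤ (S h).weight γ

/-- Symmetric nonnegative weights with
`sup_{0<h<1} (∑_{h ≤ |z_γ| ≤ 1} |z_γ|² ω_γ + ∑_{|z_γ| > 1} ω_γ) < ∞`. -/
structure AssumptionOmega {N : ℕ} (S : ℝ → Stencil N) : Prop where
  symmNonneg : SymmNonneg S
  bound : ⨆ h ∈ Ioo (0 : ℝ) 1, ((S h).moment h (Icc h 1) 2 + (S h).moment h (Ioi 1) 0) < ∞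

/-- Symmetric nonnegative weights with
`sup_{0<h<1} (∑_{h ≤ |z_γ| ≤ 1} |z_γ|² ω_γ + ∑_{|z_γ| > 1} |z_γ| ω_γ) < ∞`. -/
structure AssumptionOmega' {N : ℕ} (S : ℝ → Stencil N) : Prop where
  symmNonneg : SymmNonneg S
  bound : ⨆ h ∈ Ioo (0 : ℝ) 1, ((S h).moment h (Icc h 1) 2 + (S h).moment h (Ioi 1) 1) < ∞

/-- In addition to `AssumptionOmega`, tails of fractional order `α ∈ (0, 2)`:
`sup_{R>1} sup_{0<h<1} (R^{α-2} ∑_{1 < |z_γ| ≤ R} |z_γ|² ω_γ + R^α ∑_{|z_γ| > R} ω_γ) < ∞`. -/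
structure AssumptionOmega'' {N : ℕ} (α : ℝ) (S : ℝ → Stencil N) : Prop where
  order : α ∈ Ioo (0 : ℝ) 2
  base : AssumptionOmega S
  tail : ⨆ R ∈ Ioi (1 : ℝ), ⨆ h ∈ Ioo (0 : ℝ) 1,
    (ENNReal.ofReal (R ^ (α - 2)) * (S h).moment h (Ioc 1 R) 2 +
      ENNReal.ofReal (R ^ α) * (S h).moment h (Ioi R) 0) < ∞

/-! ### The scheme -/

/-- A (possibly nonuniform) time grid `0 = t_0 < t_1 < ... < t_J = T`.
Only the values `time j` with `j ≤ J` are used. -/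
structure TimeGrid (T : ℝ) where
  J : ℕ
  time : ℕ → ℝ
  time_zero : time 0 = 0
  time_last : time J = T
  time_lt : ∀ j < J, time j < time (j + 1)

/-- `Δt_j = t_{j} - t_{j-1}`, written with `j + 1` in place of `j`. -/
def TimeGrid.step {T : ℝ} (τ : TimeGrid T) (j : ℕ) : ℝ := τ.time (j + 1) - τ.time j

/-- `U_β^0 = h^{-N} ∫_{x_β + R_h} u₀ dx`. -/
noncomputable def initialAverage {N : ℕ} (h : ℝ) (u₀ : Space N → ℝ) (β : Idx N) : ℝ :=
  1 / h ^ N * ∫ x in cell h β, u₀ x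

/-- `G_β^{j+1} = h^{-N} Δt_{j+1}^{-1} ∫_{t_j}^{t_{j+1}} ∫_{x_β + R_h} g dx dt`. -/
noncomputable def sourceAverage {N : ℕ} {T : ℝ} (h : ℝ) (τ : TimeGrid T) (g : Space N → ℝ → ℝ)
    (j : ℕ) (β : Idx N) : ℝ :=
  1 / (h ^ N * τ.step j) * ∫ t in τ.time j..τ.time (j + 1), ∫ x in cell h β, g x t

/-- `U j β = U_β^j` is the summable solution of the implicit scheme
`U_β^j = U_β^{j-1} + Δt_j L^h[φ(U^j)]_β + Δt_j G_β^j`, `1 ≤ j ≤ J`, with initial values `U_β^0`. -/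
structure IsSchemeSolution {N : ℕ} {T : ℝ} (φ : ℝ → ℝ) (u₀ : Space N → ℝ) (g : Space N → ℝ → ℝ)
    (S : Stencil N) (h : ℝ) (τ : TimeGrid T) (U : ℕ → Idx N → ℝ) : Prop where
  summable : ∀ j ≤ τ.J, Summable (fun β => |U j β|)
  initial : ∀ β, U 0 β = initialAverage h u₀ β
  scheme : ∀ j < τ.J, ∀ β,
    U (j + 1) β = U j β + τ.step j * S.op (fun α => φ (U (j + 1) α)) β
      + τ.step j * sourceAverage h τ g j β

/-- The piecewise constant interpolant in space of a grid function. -/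
noncomputable def spaceInterp {N : ℕ} (h : ℝ) (V : Idx N → ℝ) (x : Space N) : ℝ :=
  ∑' β : Idx N, (cell h β).indicator (fun _ => V β) x

/-- The interpolant which is piecewise linear in time and piecewise constant in space. -/
noncomputable def spaceTimeInterp {N : ℕ} {T : ℝ} (h : ℝ) (τ : TimeGrid T) (U : ℕ → Idx N → ℝ)
    (x : Space N) (t : ℝ) : ℝ :=
  ({τ.time 0} : Set ℝ).indicator (fun _ => spaceInterp h (U 0) x) t +
    ∑ j ∈ Finset.range τ.J,
      (Ioc (τ.time j) (τ.time (j + 1))).indicator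
        (fun s => spaceInterp h (U j) x + (s - τ.time j) / (τ.time (j + 1) - τ.time j) *
          (spaceInterp h (U (j + 1)) x - spaceInterp h (U j) x)) t

/-- The three alternatives for the discrete operator and the Hölder exponent. -/
def OperatorCondition (N : ℕ) (a : ℝ≥0) (S : ℝ → Stencil N) : Prop :=
  ((∀ h ∈ Ioo (0 : ℝ) 1, (S h).op = discreteLaplacian h) ∧ AssumptionOmega S ∧
      max ((N : ℝ) - 2) 0 / N < a) ∨
  (AssumptionOmega' S ∧ ((N : ℝ) - 1) / N < a) ∨
  (∃ α : ℝ, AssumptionOmega'' α S ∧ max ((N : ℝ) - α) 0 / N < a)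

end GPME

/-! Each implicit step is an accretive problem. The weights are nonnegative and symmetric and `φ` is
nondecreasing, so a step obeys a maximum principle and contracts `ℓ¹` distances. The source and the
initial datum enter through cell averages, so every bound on `U` reduces to a bound on `u₀` and `g`
that does not see the grid. This gives a uniform sup bound (`IsSchemeSolution.abs_le_supBound`) and,
since the operator commutes with grid translations, `ℓ¹` smallness of `U(· + γ) - U` from the
continuity of translations in `L¹` (`IsSchemeSolution.tsum_abs_translate_sub_le`).

The delicate point is that no mass escapes to infinity. The accretivity estimate is weighted
(`Stencil.weighted_accretive`): a weight `X` costs `∑ |φ(U) - φ(0)| |L X|`. For `X` equal to one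
minus a cutoff at scale `R`, `|L X|` is of order `R^{-α}` uniformly and of order `R^{N-α}` in `L¹`,
where `α` is the decay order of the truncated second moments of the weights
(`OperatorCondition.exists_decay`; `α = 2` and `α = 1` in the first two alternatives). Splitting
`|u|^a ≤ λ^{a-1}|u| + λ^a` at `λ = R^{-N}` bounds the cost by `R^{N(1-a)-α}`, which tends to zero
because the condition on `a` says `N(1-a) < α` (`IsSchemeSolution.tail_le`).

Bounds, translations and tails make the set of all values at all times relatively compact in `L¹`,
by a Kolmogorov–Riesz argument on grids (`totallyBounded_range_of_grid`). In time only weak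
information is available: increments tested against smooth functions are small. On a relatively
compact set weak equicontinuity is strong equicontinuity (`UniformEstimates.equicontinuous_curve`),
so Arzelà–Ascoli yields a subsequence converging in `C([0,T]; L¹)`. The sup bound upgrades this to
`L^r` (`UniformEstimates.dist_curve_le`). -/

namespace GPME

/-! ### The discrete operator: symmetry, weighted accretivity, maximum principle. -/

namespace Stencil

variable {N : ℕ} (S : Stencil N)

/-- At a fixed space step the weights are summable, so boundedness of `ψ` is enough. Decay must not
be required: `φ(U)` tends to `φ(0)`, not to zero. -/
theorem summable_op_term {ψ : Idx N → ℝ} {C : ℝ} (hψ : ∀ β, |ψ β| ≤ C) (β : Idx N) :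
    Summable (fun γ : {γ : Idx N // γ ≠ 0} => (ψ (β + S.offset γ) - ψ β) * S.weight γ) := by
  refine Summable.of_norm_bounded (S.summable_weight.norm.mul_left (2 * C)) fun γ => ?_
  rw [norm_mul]
  refine mul_le_mul_of_nonneg_right ?_ (norm_nonneg _)
  rw [Real.norm_eq_abs]
  have h1 := abs_sub (ψ (β + S.offset γ)) (ψ β)
  linarith [hψ (β + S.offset γ), hψ β]

theorem op_add {ψ χ : Idx N → ℝ} {C D : ℝ} (hψ : ∀ β, |ψ β| ≤ C) (hχ : ∀ β, |χ β| ≤ D)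
    (β : Idx N) : S.op (fun α => ψ α + χ α) β = S.op ψ β + S.op χ β := by
  unfold op
  rw [← (S.summable_op_term hψ β).tsum_add (S.summable_op_term hχ β)]
  exact tsum_congr fun γ => by ring

theorem op_sub {ψ χ : Idx N → ℝ} {C D : ℝ} (hψ : ∀ β, |ψ β| ≤ C) (hχ : ∀ β, |χ β| ≤ D)
    (β : Idx N) : S.op (fun α => ψ α - χ α) β = S.op ψ β - S.op χ β := by
  unfold op
  rw [← (S.summable_op_term hψ β).tsum_sub (S.summable_op_term hχ β)]
  exact tsum_congr fun γ => by ring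

theorem op_const_mul (c : ℝ) (ψ : Idx N → ℝ) (β : Idx N) :
    S.op (fun α => c * ψ α) β = c * S.op ψ β := by
  unfold op
  rw [← tsum_mul_left]
  exact tsum_congr fun γ => by ring

theorem op_neg (ψ : Idx N → ℝ) (β : Idx N) :
    S.op (fun α => -ψ α) β = -S.op ψ β := by
  simpa using S.op_const_mul (-1) ψ β

/-- Allows `φ(U)` to be replaced by `φ(U) - φ(0)`, which vanishes at infinity. -/
theorem op_sub_const (ψ : Idx N → ℝ) (c : ℝ) (β : Idx N) :
    S.op (fun α => ψ α - c) β = S.op ψ β := by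
  unfold op
  exact tsum_congr fun γ => by ring

theorem op_const_sub (ψ : Idx N → ℝ) (c : ℝ) (β : Idx N) :
    S.op (fun α => c - ψ α) β = -S.op ψ β := by
  rw [← op_neg]
  unfold op
  exact tsum_congr fun γ => by ring

theorem op_comp_add (ψ : Idx N → ℝ) (δ β : Idx N) :
    S.op (fun α => ψ (α + δ)) β = S.op ψ (β + δ) := by
  unfold op
  exact tsum_congr fun γ => by rw [add_right_comm]

/-- The weights of the stencil are nonnegative and symmetric. -/
def IsSymm : Prop := ∀ γ, γ ≠ 0 → S.weight γ = S.weight (-γ) ∧ 0 ≤ S.weight γ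

variable {S}

theorem op_mono_term (hS : S.IsSymm) {ψ χ : Idx N → ℝ} {C D : ℝ} (hψ : ∀ β, |ψ β| ≤ C)
    (hχ : ∀ β, |χ β| ≤ D) (β : Idx N)
    (h : ∀ α, ψ α - ψ β ≤ χ α - χ β) : S.op ψ β ≤ S.op χ β :=
  (S.summable_op_term hψ β).tsum_le_tsum
    (fun γ => mul_le_mul_of_nonneg_right (h _) (hS γ γ.2).2) (S.summable_op_term hχ β)

theorem op_nonpos_of_isMax (hS : S.IsSymm) {ψ : Idx N → ℝ} (β : Idx N)
    (h : ∀ α, ψ α ≤ ψ β) : S.op ψ β ≤ 0 :=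
  tsum_nonpos fun γ => mul_nonpos_of_nonpos_of_nonneg (sub_nonpos.2 (h _)) (hS γ γ.2).2

/-- The involution `γ ↦ -γ` of the index set of the stencil. -/
def negIdx (N : ℕ) : {γ : Idx N // γ ≠ 0} ≃ {γ : Idx N // γ ≠ 0} where
  toFun γ := ⟨-γ.1, neg_ne_zero.2 γ.2⟩
  invFun γ := ⟨-γ.1, neg_ne_zero.2 γ.2⟩
  left_inv γ := by simp
  right_inv γ := by simp

/-- Averaging the sum with its image under `γ ↦ -γ` produces second differences, which are `O(|z|²)`
for smooth functions and thus match the moment conditions. -/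
theorem op_eq_half_second_difference (hS : S.IsSymm) {ψ : Idx N → ℝ} {C : ℝ}
    (hψ : ∀ β, |ψ β| ≤ C) (β : Idx N) :
    S.op ψ β = 1 / 2 * ∑' γ : {γ : Idx N // γ ≠ 0},
      (ψ (β + S.offset γ) + ψ (β - S.offset γ) - 2 * ψ β) * S.weight γ := by
  have h1 := S.summable_op_term hψ β
  have h2 := (negIdx N).summable_iff.2 h1
  have h3 : S.op ψ β = ∑' γ : {γ : Idx N // γ ≠ 0},
      (ψ (β + S.offset (negIdx N γ).1) - ψ β) * S.weight (negIdx N γ).1 :=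
    ((negIdx N).tsum_eq (fun γ : {γ : Idx N // γ ≠ 0} =>
      (ψ (β + S.offset γ) - ψ β) * S.weight γ)).symm
  have h4 : S.op ψ β + S.op ψ β = ∑' γ : {γ : Idx N // γ ≠ 0},
      (ψ (β + S.offset γ) + ψ (β - S.offset γ) - 2 * ψ β) * S.weight γ := by
    nth_rewrite 2 [h3]
    unfold op
    have h2' : Summable (fun γ : {γ : Idx N // γ ≠ 0} =>
      (ψ (β + S.offset (negIdx N γ).1) - ψ β) * S.weight (negIdx N γ).1) := h2
    rw [← h1.tsum_add h2']
    refine tsum_congr fun γ => ?_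
    have e1 : S.offset (negIdx N γ).1 = -S.offset γ := S.offset_neg γ γ.2
    have e2 : S.weight (negIdx N γ).1 = S.weight γ := (hS γ γ.2).1.symm
    rw [e1, e2, ← sub_eq_add_neg]; ring
  rw [← h4]; ring

/-- The shear `(β, γ) ↦ (β + z_γ, -γ)`. -/
def shear (S : Stencil N) :
    (Idx N × {γ : Idx N // γ ≠ 0}) ≃ (Idx N × {γ : Idx N // γ ≠ 0}) where
  toFun x := (x.1 + S.offset x.2, negIdx N x.2)
  invFun x := (x.1 + S.offset x.2, negIdx N x.2)
  left_inv x := by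
    have := S.offset_neg x.2 x.2.2
    ext1
    · simp [negIdx, this]
    · simp [negIdx]
  right_inv x := by
    have := S.offset_neg x.2 x.2.2
    ext1
    · simp [negIdx, this]
    · simp [negIdx]

theorem summable_mul_weight {p X : Idx N → ℝ} {C : ℝ} (hp : Summable p) (hX : ∀ β, |X β| ≤ C)
    (f : Idx N × {γ : Idx N // γ ≠ 0} → Idx N) :
    Summable (fun x : Idx N × {γ : Idx N // γ ≠ 0} => p x.1 * X (f x) * S.weight x.2) := by
  have h := (hp.norm.mul_of_nonneg (S.summable_weight.norm) (fun _ => norm_nonneg _)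
    (fun _ => norm_nonneg _)).mul_left C
  refine Summable.of_norm_bounded h fun x => ?_
  have := hX (f x)
  simp only [norm_mul, Real.norm_eq_abs]
  calc |p x.1| * |X (f x)| * |S.weight x.2| ≤ |p x.1| * C * |S.weight x.2| := by gcongr
    _ = _ := by ring

/-- Symmetry of the operator: it may be moved from a summable function to a bounded one. -/
theorem summable_op_mul_and_tsum_eq (hS : S.IsSymm) {p X : Idx N → ℝ} {C : ℝ} (hp : Summable p)
    (hX : ∀ β, |X β| ≤ C) :
    Summable (fun β => S.op p β * X β) ∧
      ∑' β, S.op p β * X β = ∑' β, p β * S.op X β := by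
  have hF := summable_mul_weight (S := S) hp hX (fun x => x.1 + S.offset x.2)
  have hD := summable_mul_weight (S := S) hp hX (fun x => x.1)
  -- The shear exchanges the two endpoints of a jump and keeps its weight, so the double sum over
  -- jumps is symmetric in `p` and `X`.
  have hE := (S.shear).summable_iff.2 hF
  have eqE : ((fun x : Idx N × {γ : Idx N // γ ≠ 0} =>
      p x.1 * X (x.1 + S.offset x.2) * S.weight x.2) ∘ S.shear) =
      fun x => p (x.1 + S.offset x.2) * X x.1 * S.weight x.2 := by
    funext x
    have e1 : S.offset (negIdx N x.2).1 = -S.offset x.2 := S.offset_neg x.2 x.2.2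
    have e2 : S.weight (negIdx N x.2).1 = S.weight x.2 := (hS x.2 x.2.2).1.symm
    simp only [Function.comp, shear, Equiv.coe_fn_mk, e1, e2]
    simp
  have tE := (S.shear).tsum_eq (fun x : Idx N × {γ : Idx N // γ ≠ 0} =>
      p x.1 * X (x.1 + S.offset x.2) * S.weight x.2)
  change ∑' c, ((fun x : Idx N × {γ : Idx N // γ ≠ 0} =>
      p x.1 * X (x.1 + S.offset x.2) * S.weight x.2) ∘ S.shear) c = _ at tE
  rw [eqE] at hE tE
  have h1 := hE.sub hD
  have h2 := hF.sub hD
  have k1 : ∀ β, S.op p β * X β = ∑' γ : {γ : Idx N // γ ≠ 0},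
      (p (β + S.offset γ) * X β * S.weight γ - p β * X β * S.weight γ) := fun β => by
    unfold op
    rw [← tsum_mul_right]
    exact tsum_congr fun γ => by ring
  have k2 : ∀ β, p β * S.op X β = ∑' γ : {γ : Idx N // γ ≠ 0},
      (p β * X (β + S.offset γ) * S.weight γ - p β * X β * S.weight γ) := fun β => by
    unfold op
    rw [← tsum_mul_left]
    exact tsum_congr fun γ => by ring
  refine ⟨?_, ?_⟩
  · simp_rw [k1]
    exact h1.prod
  · simp_rw [k1, k2]
    rw [← h1.tsum_prod, ← h2.tsum_prod, hE.tsum_sub hD, hF.tsum_sub hD, tE]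

theorem summable_op (hS : S.IsSymm) {p : Idx N → ℝ} (hp : Summable p) : Summable (S.op p) := by
  simpa using (summable_op_mul_and_tsum_eq hS hp (X := fun _ => 1) (C := 1) (by simp)).1

/-- An `ℓ¹` bound for the operator from `ℓ¹` bounds for second differences. -/
theorem summable_abs_op_and_tsum_le (hS : S.IsSymm) {ψ : Idx N → ℝ} {C : ℝ} (hψ : ∀ β, |ψ β| ≤ C)
    {K : {γ : Idx N // γ ≠ 0} → ℝ}
    (hsum : ∀ γ : {γ : Idx N // γ ≠ 0},
      Summable (fun β => |ψ (β + S.offset γ) + ψ (β - S.offset γ) - 2 * ψ β|))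
    (hK : ∀ γ : {γ : Idx N // γ ≠ 0},
      ∑' β, |ψ (β + S.offset γ) + ψ (β - S.offset γ) - 2 * ψ β| ≤ K γ)
    (hKw : Summable (fun γ => K γ * S.weight γ)) :
    Summable (fun β => |S.op ψ β|) ∧ ∑' β, |S.op ψ β| ≤ 1 / 2 * ∑' γ, K γ * S.weight γ := by
  set D : {γ : Idx N // γ ≠ 0} → Idx N → ℝ := fun γ β =>
    |ψ (β + S.offset γ) + ψ (β - S.offset γ) - 2 * ψ β| with hD
  have hw : ∀ γ : {γ : Idx N // γ ≠ 0}, 0 ≤ S.weight γ := fun γ => (hS γ γ.2).2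
  have h1 : Summable (fun x : {γ : Idx N // γ ≠ 0} × Idx N => D x.1 x.2 * S.weight x.1) := by
    rw [summable_prod_of_nonneg (fun x => mul_nonneg (abs_nonneg _) (hw _))]
    refine ⟨fun γ => ?_, ?_⟩
    · have : Summable (D γ) := hsum γ
      exact this.mul_right (S.weight γ)
    refine Summable.of_nonneg_of_le (fun γ => tsum_nonneg fun β =>
      mul_nonneg (abs_nonneg _) (hw _)) (fun γ => ?_) hKw
    simp only [tsum_mul_right]
    exact mul_le_mul_of_nonneg_right (hK γ) (hw γ)
  have h2 : Summable (fun x : Idx N × {γ : Idx N // γ ≠ 0} => D x.2 x.1 * S.weight x.2) :=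
    (Equiv.prodComm _ _).summable_iff.2 h1
  have h3 : ∀ β, |S.op ψ β| ≤ 1 / 2 * ∑' γ, D γ β * S.weight γ := fun β => by
    rw [op_eq_half_second_difference hS hψ, abs_mul, abs_of_pos (by norm_num : (0:ℝ) < 1 / 2)]
    refine mul_le_mul_of_nonneg_left ?_ (by norm_num)
    have hs : Summable (fun γ : {γ : Idx N // γ ≠ 0} =>
        ‖(ψ (β + S.offset γ) + ψ (β - S.offset γ) - 2 * ψ β) * S.weight γ‖) := by
      simp only [norm_mul, Real.norm_eq_abs, abs_of_nonneg (hw _)]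
      exact h2.prod_factor β
    have := norm_tsum_le_tsum_norm hs
    simp only [norm_mul, Real.norm_eq_abs, abs_of_nonneg (hw _)] at this
    exact this
  have h4 : Summable (fun β => 1 / 2 * ∑' γ, D γ β * S.weight γ) := h2.prod.mul_left _
  have h5 := Summable.of_nonneg_of_le (fun β => abs_nonneg _) h3 h4
  refine ⟨h5, (h5.tsum_le_tsum h3 h4).trans ?_⟩
  rw [tsum_mul_left]
  refine mul_le_mul_of_nonneg_left ?_ (by norm_num)
  rw [Summable.tsum_comm (f := fun (γ : {γ : Idx N // γ ≠ 0}) (β : Idx N) => D γ β * S.weight γ) h1]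
  refine h1.prod.tsum_le_tsum (fun γ => ?_) hKw
  simp only [tsum_mul_right]
  exact mul_le_mul_of_nonneg_right (hK γ) (hw γ)

theorem exists_abs_le_of_tendsto {w : Idx N → ℝ} (hw : Tendsto w cofinite (𝓝 0)) :
    ∃ C, ∀ β, |w β| ≤ C := by
  have h : ∀ᶠ β in cofinite, |w β| < 1 := by
    have := hw.abs
    rw [abs_zero] at this
    exact this.eventually_lt_const one_pos
  have hf : {β | ¬ |w β| < 1}.Finite := h
  obtain ⟨C, hC⟩ := (hf.image fun β => |w β|).bddAbove
  refine ⟨max C 1, fun β => ?_⟩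
  by_cases hb : |w β| < 1
  · exact hb.le.trans (le_max_right _ _)
  · exact (hC (mem_image_of_mem _ hb)).trans (le_max_left _ _)

/-- Weighted accretivity, for a strictly compatible pair: `w` vanishes only where `d` does. -/
theorem weighted_accretive_strict (hS : S.IsSymm) {d e f w X : Idx N → ℝ} {C lam : ℝ}
    (hlam : 0 ≤ lam) (he : Summable e) (hw : Tendsto w cofinite (𝓝 0))
    (hsign : ∀ β, 0 ≤ d β * w β) (hzero : ∀ β, d β = 0 ↔ w β = 0) (hX0 : ∀ β, 0 ≤ X β)
    (hXC : ∀ β, X β ≤ C) (hLX : Summable (fun β => |S.op X β|))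
    (he0 : ∀ β, |f β| ≤ e β)
    (heq : ∀ β, d β = f β + lam * S.op w β) :
    ∑' β, |d β| * X β ≤ ∑' β, e β * X β + lam * ∑' β, |w β| * |S.op X β| := by
  obtain ⟨D, hD⟩ := exists_abs_le_of_tendsto hw
  have hXa : ∀ β, |X β| ≤ C := fun β => by rw [abs_of_nonneg (hX0 β)]; exact hXC β
  have hC : 0 ≤ C := (hX0 0).trans (hXC 0)
  have he00 : ∀ β, 0 ≤ e β := fun β => (abs_nonneg _).trans (he0 β)
  have hwX : Summable (fun β => |w β| * |S.op X β|) :=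
    Summable.of_nonneg_of_le (fun β => by positivity)
      (fun β => mul_le_mul_of_nonneg_right (hD β) (abs_nonneg _)) (hLX.mul_left D)
  have heX : Summable (fun β => e β * X β) :=
    Summable.of_nonneg_of_le (fun β => mul_nonneg (he00 β) (hX0 β))
      (fun β => mul_le_mul_of_nonneg_left (hXC β) (he00 β)) (he.mul_right C)
  refine Real.tsum_le_of_sum_le (fun β => mul_nonneg (abs_nonneg _) (hX0 β)) fun F => ?_
  classical
  -- On the finite set `F`, `w` is bounded away from zero wherever `d` does not vanish. Cutting at
  -- this level loses no term of the sum over `F`.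
  obtain ⟨δ, hδ, hδF⟩ : ∃ δ > 0, ∀ β ∈ F, d β ≠ 0 → δ < |w β| := by
    induction F using Finset.induction_on with
    | empty => exact ⟨1, one_pos, by simp⟩
    | insert b F _ ih =>
      obtain ⟨δ, hδ, h⟩ := ih
      by_cases hb : d b = 0
      · refine ⟨δ, hδ, fun β hβ hne => ?_⟩
        rcases Finset.mem_insert.1 hβ with rfl | hβ
        · exact absurd hb hne
        · exact h β hβ hne
      · have hwb : 0 < |w b| := abs_pos.2 fun h0 => hb ((hzero b).2 h0)
        refine ⟨min δ (|w b| / 2), by positivity, fun β hβ hne => ?_⟩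
        rcases Finset.mem_insert.1 hβ with rfl | hβ
        · exact (min_le_right _ _).trans_lt (by linarith)
        · exact (min_le_left _ _).trans_lt (h β hβ hne)
  have hfin : {β | δ < |w β|}.Finite := by
    have h1 := hw.abs
    rw [abs_zero] at h1
    have h2 : ∀ᶠ β in cofinite, |w β| < δ := h1.eventually_lt_const hδ
    refine Set.Finite.subset (show {β | ¬ |w β| < δ}.Finite from h2) fun β hβ => ?_
    simpa using (le_of_lt hβ)
  set A := hfin.toFinset with hA
  -- The truncation `(|w| - δ)⁺` has finite support because `w` tends to zero, so the operator may
  -- be moved from it to the bounded weight `X`.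
  set p : Idx N → ℝ := fun β => max (|w β| - δ) 0 with hp
  have hp0 : ∀ β, 0 ≤ p β := fun β => le_max_right _ _
  have hpw : ∀ β, p β ≤ |w β| := fun β => max_le (by linarith) (abs_nonneg _)
  have hpD : ∀ β, |p β| ≤ D := fun β => by
    rw [abs_of_nonneg (hp0 β)]; exact (hpw β).trans (hD β)
  have hpA : ∀ β ∉ A, p β = 0 := fun β hβ => by
    have : ¬ δ < |w β| := by simpa [hA] using hβ
    exact max_eq_right (by linarith [not_lt.1 this])
  have hps : Summable p := summable_of_ne_finset_zero (s := A) hpA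
  obtain ⟨hpX, hdual⟩ := summable_op_mul_and_tsum_eq hS hps hXa
  -- A discrete Kato inequality: on `A` one has `p = |w| - δ`, while `p ≥ |w| - δ` everywhere, hence
  -- `sign(w) L w ≤ L p` there.
  have key : ∀ β ∈ A, |d β| ≤ e β + lam * S.op p β := fun β hβ => by
    have hβ' : δ < |w β| := by simpa [hA] using hβ
    have hwne : w β ≠ 0 := fun h0 => by rw [h0, abs_zero] at hβ'; linarith
    have hpβ : p β = |w β| - δ := max_eq_left (by linarith)
    have hle : ∀ α, |w α| ≤ p α + δ := fun α => by
      have := le_max_left (|w α| - δ) 0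
      simp only [hp]; linarith
    rcases lt_or_gt_of_ne hwne with hneg | hpos
    · have hd0 : d β ≤ 0 := by
        by_contra! hcon
        nlinarith [hsign β]
      have h1 : S.op (fun α => -w α) β ≤ S.op p β :=
        op_mono_term hS (C := D) (D := D) (by simpa using hD) hpD β fun α => by
          rw [hpβ, abs_of_neg hneg]
          linarith [neg_abs_le (w α), hle α]
      rw [op_neg] at h1
      rw [abs_of_nonpos hd0, heq β]
      nlinarith [neg_abs_le (f β), he0 β]
    · have hd0 : 0 ≤ d β := by
        by_contra! hcon
        nlinarith [hsign β]
      have h1 : S.op w β ≤ S.op p β :=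
        op_mono_term hS hD hpD β fun α => by
          rw [hpβ, abs_of_pos hpos]
          linarith [le_abs_self (w α), hle α]
      rw [abs_of_nonneg hd0, heq β]
      nlinarith [le_abs_self (f β), he0 β]
  -- Off `A` the function `p` takes its minimum `0`, so `L p ≥ 0` and the sum over `A` may be
  -- enlarged to all indices.
  have hopnn : ∀ β ∉ A, 0 ≤ S.op p β := fun β hβ =>
    tsum_nonneg fun γ => by
      rw [hpA β hβ, sub_zero]; exact mul_nonneg (hp0 _) (hS γ γ.2).2
  calc ∑ β ∈ F, |d β| * X β ≤ ∑ β ∈ A, |d β| * X β := by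
        rw [← Finset.sum_filter_add_sum_filter_not F (fun β => d β ≠ 0)]
        have : ∑ β ∈ F with ¬ d β ≠ 0, |d β| * X β = 0 := by
          refine Finset.sum_eq_zero fun β hβ => ?_
          have : d β = 0 := by simpa using (Finset.mem_filter.1 hβ).2
          simp [this]
        rw [this, add_zero]
        refine Finset.sum_le_sum_of_subset_of_nonneg (fun β hβ => ?_)
          fun β _ _ => mul_nonneg (abs_nonneg _) (hX0 β)
        obtain ⟨h1, h2⟩ := Finset.mem_filter.1 hβ
        simpa [hA] using hδF β h1 h2
    _ ≤ ∑ β ∈ A, (e β * X β + lam * (S.op p β * X β)) := Finset.sum_le_sum fun β hβ => by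
        have := mul_le_mul_of_nonneg_right (key β hβ) (hX0 β)
        linarith
    _ = ∑ β ∈ A, e β * X β + lam * ∑ β ∈ A, S.op p β * X β := by
        rw [Finset.sum_add_distrib, Finset.mul_sum]
    _ ≤ ∑' β, e β * X β + lam * ∑' β, S.op p β * X β := by
        refine add_le_add (heX.sum_le_tsum _ fun β _ => mul_nonneg (he00 β) (hX0 β))
          (mul_le_mul_of_nonneg_left (hpX.sum_le_tsum _ fun β hβ => ?_) hlam)
        exact mul_nonneg (hopnn β hβ) (hX0 β)
    _ ≤ _ := by
        rw [hdual]
        have h1 : ∀ β, p β * S.op X β ≤ |w β| * |S.op X β| := fun β =>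
          (mul_le_mul_of_nonneg_left (le_abs_self _) (hp0 β)).trans
            (mul_le_mul_of_nonneg_right (hpw β) (abs_nonneg _))
        have h2 : Summable (fun β => p β * S.op X β) :=
          summable_of_ne_finset_zero (s := A) fun β hβ => by rw [hpA β hβ, zero_mul]
        have := h2.tsum_le_tsum h1 hwX
        gcongr

/-- Weighted accretivity: the weighted `ℓ¹` norm of a solution of `d = f + λ L w`, where `w` has
the sign of `d`, is controlled by that of `f`, up to the action of the operator on the weight. -/
theorem weighted_accretive (hS : S.IsSymm) {d f w X : Idx N → ℝ} {C lam : ℝ}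
    (hlam : 0 ≤ lam) (hd : Summable d) (hf : Summable f) (hw : Tendsto w cofinite (𝓝 0))
    (hsign : ∀ β, 0 ≤ d β * w β) (hzero : ∀ β, d β = 0 → w β = 0) (hX0 : ∀ β, 0 ≤ X β)
    (hXC : ∀ β, X β ≤ C) (hLX : Summable (fun β => |S.op X β|))
    (heq : ∀ β, d β = f β + lam * S.op w β) :
    ∑' β, |d β| * X β ≤ ∑' β, |f β| * X β + lam * ∑' β, |w β| * |S.op X β| := by
  obtain ⟨D, hD⟩ := exists_abs_le_of_tendsto hw
  have hd0 := hd.tendsto_cofinite_zero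
  obtain ⟨E, hE⟩ := exists_abs_le_of_tendsto hd0
  have hLd := (summable_op hS hd).abs
  have mulX : ∀ {q : Idx N → ℝ}, (∀ β, 0 ≤ q β) → Summable q → Summable (fun β => q β * X β) :=
    fun hq0 hq => Summable.of_nonneg_of_le (fun β => mul_nonneg (hq0 β) (hX0 β))
      (fun β => mul_le_mul_of_nonneg_left (hXC β) (hq0 β)) (hq.mul_right C)
  have mulL : ∀ {q : Idx N → ℝ} {B : ℝ}, (∀ β, |q β| ≤ B) →
      Summable (fun β => |q β| * |S.op X β|) := fun {q B} hq =>
    Summable.of_nonneg_of_le (fun β => by positivity)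
      (fun β => mul_le_mul_of_nonneg_right (hq β) (abs_nonneg _)) (hLX.mul_left B)
  set B := lam * (∑' β, |S.op d β| * X β + ∑' β, |d β| * |S.op X β|) with hB
  have hBnn : 0 ≤ B := mul_nonneg hlam (add_nonneg
    (tsum_nonneg fun β => mul_nonneg (abs_nonneg _) (hX0 β)) (tsum_nonneg fun β => by positivity))
  -- Where `φ` is flat, `w` may vanish although `d` does not. Replacing `w` by `w + ε d` restores
  -- strict compatibility; the compensating term `ε λ L d` goes to the right-hand side and
  -- disappears as `ε → 0`.
  have main : ∀ ε > 0, ∑' β, |d β| * X β ≤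
      ∑' β, |f β| * X β + lam * ∑' β, |w β| * |S.op X β| + ε * B := fun ε hε => by
    have hw' : Tendsto (fun β => w β + ε * d β) cofinite (𝓝 0) := by
      simpa using hw.add (hd0.const_mul ε)
    have hεd : ∀ β, |ε * d β| ≤ ε * E := fun β => by
      rw [abs_mul, abs_of_pos hε]; exact mul_le_mul_of_nonneg_left (hE β) hε.le
    have h := weighted_accretive_strict hS (d := d) (e := fun β => |f β| + ε * lam * |S.op d β|)
      (f := fun β => f β - ε * lam * S.op d β) (w := fun β => w β + ε * d β) hlam
      (hf.abs.add (hLd.mul_left _)) hw'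
      (fun β => by nlinarith [hsign β, mul_nonneg hε.le (mul_self_nonneg (d β))])
      (fun β => ⟨fun h => by simp [h, hzero β h], fun h => by
        by_contra hne
        have := mul_self_pos.2 hne
        have h1 : d β * w β = -(ε * (d β * d β)) := by linear_combination d β * h
        linarith [hsign β, mul_pos hε this]⟩) hX0 hXC hLX
      (fun β => by
        refine (abs_sub _ _).trans ?_
        rw [abs_mul, abs_of_nonneg (mul_nonneg hε.le hlam)])
      (fun β => by
        rw [op_add S hD hεd, op_const_mul, heq β]; ring)
    have e1 : ∑' β, (|f β| + ε * lam * |S.op d β|) * X β =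
        ∑' β, |f β| * X β + ε * lam * ∑' β, |S.op d β| * X β := by
      rw [← tsum_mul_left, ← (mulX (fun _ => abs_nonneg _) hf.abs).tsum_add
        ((mulX (fun _ => abs_nonneg _) hLd).mul_left _)]
      exact tsum_congr fun β => by ring
    have e2 : ∑' β, |w β + ε * d β| * |S.op X β| ≤
        ∑' β, |w β| * |S.op X β| + ε * ∑' β, |d β| * |S.op X β| := by
      rw [← tsum_mul_left, ← (mulL hD).tsum_add ((mulL hE).mul_left ε)]
      refine (mulL (B := D + ε * E) fun β => (abs_add_le _ _).trans
        (add_le_add (hD β) (hεd β))).tsum_le_tsum (fun β => ?_)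
        ((mulL hD).add ((mulL hE).mul_left ε))
      have := abs_add_le (w β) (ε * d β)
      rw [abs_mul ε, abs_of_pos hε] at this
      nlinarith [mul_le_mul_of_nonneg_right this (abs_nonneg (S.op X β))]
    have e3 := mul_le_mul_of_nonneg_left e2 hlam
    rw [e1] at h
    rw [hB]
    linarith
  refine le_of_forall_pos_le_add fun η hη => ?_
  have hB1 : 0 < B + 1 := by linarith
  have h := main (η / (B + 1)) (by positivity)
  have : η / (B + 1) * B ≤ η := by
    rw [div_mul_eq_mul_div, div_le_iff₀ hB1]
    nlinarith
  linarith

/-- If `U` exceeded `m ≥ 0` somewhere it would attain its maximum, since it vanishes at infinity.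
There `φ(U)` is maximal too, so the operator is nonpositive and `U ≤ f ≤ m`. -/
theorem le_of_implicit_step (hS : S.IsSymm) {φ : ℝ → ℝ} (hφ : Monotone φ) {U f : Idx N → ℝ}
    {lam m : ℝ} (hlam : 0 ≤ lam) (hm : 0 ≤ m) (hU : Summable U) (hf : ∀ β, f β ≤ m)
    (heq : ∀ β, U β = f β + lam * S.op (fun α => φ (U α)) β) (β : Idx N) : U β ≤ m := by
  by_contra! hβ
  have h0 := hU.tendsto_cofinite_zero
  have h1 : ∀ᶠ α in cofinite, U α < U β := h0.eventually_lt_const (hm.trans_lt hβ)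
  have hfin : {α | U β ≤ U α}.Finite := by simpa using (show {α | ¬ U α < U β}.Finite from h1)
  obtain ⟨b, hb, hmax⟩ := hfin.exists_maximalFor U _ ⟨β, le_refl (U β)⟩
  have hmax' : ∀ α, U α ≤ U b := fun α => by
    rcases le_total (U b) (U α) with h | h
    · exact hmax (le_trans (show U β ≤ U b from hb) h) h
    · exact h
  have := op_nonpos_of_isMax hS (ψ := fun α => φ (U α)) b fun α => hφ (hmax' α)
  have h2 := heq b
  have h3 : U β ≤ U b := hb
  nlinarith [hf b]

/-- The maximum principle for an implicit step. -/
theorem abs_le_of_implicit_step (hS : S.IsSymm) {φ : ℝ → ℝ} (hφ : Monotone φ) {U f : Idx N → ℝ}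
    {lam m : ℝ} (hlam : 0 ≤ lam) (hU : Summable U) (hf : ∀ β, |f β| ≤ m)
    (heq : ∀ β, U β = f β + lam * S.op (fun α => φ (U α)) β) (β : Idx N) : |U β| ≤ m := by
  have hm : 0 ≤ m := (abs_nonneg _).trans (hf 0)
  refine abs_le.2 ⟨?_, le_of_implicit_step hS hφ hlam hm hU
    (fun β => (le_abs_self _).trans (hf β)) heq β⟩
  -- The lower bound is the upper bound for `-U`, with the nonlinearity `x ↦ -φ(-x)`, again
  -- nondecreasing.
  have := le_of_implicit_step hS (φ := fun x => -φ (-x)) (U := fun β => -U β)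
    (f := fun β => -f β) (fun x y hxy => neg_le_neg (hφ (neg_le_neg hxy))) hlam hm hU.neg
    (fun β => (neg_le_abs _).trans (hf β)) (fun β => by
      simp only [neg_neg]
      rw [op_neg, heq β]; ring) β
  linarith

end Stencil

/-! ### Grid points and the decay of the truncated second moments. -/

variable {N : ℕ}

theorem gridPoint_apply (h : ℝ) (β : Idx N) (i : Fin N) : gridPoint h β i = h * β i := rfl

theorem gridPoint_add (h : ℝ) (β γ : Idx N) :
    gridPoint h (β + γ) = gridPoint h β + gridPoint h γ := by
  ext i
  simp [gridPoint_apply, mul_add]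

theorem gridPoint_neg (h : ℝ) (β : Idx N) : gridPoint h (-β) = -gridPoint h β := by
  ext i
  simp [gridPoint_apply]

theorem gridPoint_zero (h : ℝ) : gridPoint h (0 : Idx N) = 0 := by
  ext i
  simp [gridPoint_apply]

/-- The moment conditions see only `|z_γ| ≥ h`. By this lemma the offsets they miss are zero, and
those contribute nothing to the operator. -/
theorem eq_zero_of_norm_gridPoint_lt {h : ℝ} (hh : 0 < h) {β : Idx N} (hβ : ‖gridPoint h β‖ < h) :
    β = 0 := by
  funext i
  have h1 : ‖gridPoint h β i‖ ≤ ‖gridPoint h β‖ := PiLp.norm_apply_le _ i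
  rw [gridPoint_apply, norm_mul, Real.norm_eq_abs, abs_of_pos hh] at h1
  have h2 : ‖(β i : ℝ)‖ < 1 := by
    by_contra! hc
    nlinarith
  rw [Real.norm_eq_abs, ← Int.cast_abs] at h2
  have h3 : |β i| < 1 := by exact_mod_cast h2
  simpa using Int.abs_lt_one_iff.1 h3

namespace Stencil

/-- The truncated second moment `∑_{γ ≠ 0} min(|z_γ|²/R², 1) ω_γ`. -/
noncomputable def truncMoment (S : Stencil N) (h R : ℝ) : ℝ :=
  ∑' γ : {γ : Idx N // γ ≠ 0}, min ((‖gridPoint h (S.offset γ)‖ / R) ^ 2) 1 * S.weight γ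

variable {S : Stencil N}

theorem summable_truncMoment (h R : ℝ) : Summable (fun γ : {γ : Idx N // γ ≠ 0} =>
    min ((‖gridPoint h (S.offset γ)‖ / R) ^ 2) 1 * S.weight γ) := by
  refine Summable.of_norm_bounded S.summable_weight.norm fun γ => ?_
  have h0 : 0 ≤ min ((‖gridPoint h (S.offset γ)‖ / R) ^ 2) 1 := by positivity
  rw [norm_mul, Real.norm_eq_abs, abs_of_nonneg h0]
  exact mul_le_of_le_one_left (norm_nonneg _) (min_le_right _ _)

/-- The minimum is estimated by `|z|²/R²` up to `|z| = R` and by `1` beyond; the first range is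
split at `|z| = 1` to match the assumptions. -/
theorem ofReal_truncMoment_le (hS : S.IsSymm) {h R : ℝ} (hh : h ∈ Ioo (0 : ℝ) 1) (hR : 1 < R) :
    ENNReal.ofReal (S.truncMoment h R) ≤
      ENNReal.ofReal (R⁻¹ ^ 2) * S.moment h (Icc h 1) 2 +
        ENNReal.ofReal (R⁻¹ ^ 2) * S.moment h (Ioc 1 R) 2 + S.moment h (Ioi R) 0 := by
  have hw : ∀ γ : {γ : Idx N // γ ≠ 0}, 0 ≤ S.weight γ := fun γ => (hS γ γ.2).2
  unfold truncMoment moment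
  rw [ENNReal.ofReal_tsum_of_nonneg (fun γ => mul_nonneg (by positivity) (hw γ))
    (summable_truncMoment h R), ← ENNReal.tsum_mul_left, ← ENNReal.tsum_mul_left,
    ← ENNReal.tsum_add, ← ENNReal.tsum_add]
  refine ENNReal.tsum_le_tsum fun γ => ?_
  set ρ := ‖gridPoint h (S.offset γ)‖ with hρ
  have hρ0 : 0 ≤ ρ := norm_nonneg _
  rw [ENNReal.ofReal_mul (by positivity), ← mul_assoc, ← mul_assoc, ← add_mul, ← add_mul]
  gcongr
  rcases lt_or_ge ρ h with h1 | h1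
  · have : ρ = 0 := by
      have := eq_zero_of_norm_gridPoint_lt hh.1 h1
      rw [hρ, this, gridPoint_zero, norm_zero]
    simp [this]
  have hmin : ENNReal.ofReal (min ((ρ / R) ^ 2) 1) ≤
      ENNReal.ofReal (R⁻¹ ^ 2) * ENNReal.ofReal (ρ ^ 2) := by
    rw [← ENNReal.ofReal_mul (by positivity)]
    refine ENNReal.ofReal_le_ofReal ((min_le_left _ _).trans_eq ?_)
    rw [div_eq_mul_inv]; ring
  rcases le_or_gt ρ 1 with h2 | h2
  · rw [indicator_of_mem (show ρ ∈ Icc h 1 from ⟨h1, h2⟩)]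
    exact hmin.trans (by rw [add_assoc]; exact le_self_add)
  rcases le_or_gt ρ R with h3 | h3
  · rw [indicator_of_mem (show ρ ∈ Ioc 1 R from ⟨h2, h3⟩)]
    refine hmin.trans ?_
    rw [add_right_comm]
    exact le_add_self
  · rw [indicator_of_mem (show ρ ∈ Ioi R from h3) (fun ρ => ENNReal.ofReal (ρ ^ 0))]
    refine le_trans ?_ le_add_self
    simp

/-- Since `|z|² ≤ R|z|` for `|z| ≤ R`. Together with the Markov-type bound `mul_moment_Ioi_zero_le`,
it turns a finite first moment at infinity into a tail condition of order one. -/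
theorem moment_Ioc_two_le {h R : ℝ} (hR : 1 < R) :
    S.moment h (Ioc 1 R) 2 ≤ ENNReal.ofReal R * S.moment h (Ioi 1) 1 := by
  unfold moment
  rw [← ENNReal.tsum_mul_left]
  refine ENNReal.tsum_le_tsum fun γ => ?_
  set ρ := ‖gridPoint h (S.offset γ)‖
  rw [← mul_assoc]
  gcongr
  by_cases hρ : ρ ∈ Ioc 1 R
  · rw [indicator_of_mem hρ, indicator_of_mem (show ρ ∈ Ioi 1 from hρ.1),
      ← ENNReal.ofReal_mul (by linarith)]
    refine ENNReal.ofReal_le_ofReal ?_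
    nlinarith [hρ.1, hρ.2]
  · rw [indicator_of_notMem hρ]; exact zero_le

theorem mul_moment_Ioi_zero_le {h R : ℝ} (hR : 1 < R) :
    ENNReal.ofReal R * S.moment h (Ioi R) 0 ≤ S.moment h (Ioi 1) 1 := by
  unfold moment
  rw [← ENNReal.tsum_mul_left]
  refine ENNReal.tsum_le_tsum fun γ => ?_
  set ρ := ‖gridPoint h (S.offset γ)‖
  rw [← mul_assoc]
  gcongr
  by_cases hρ : ρ ∈ Ioi R
  · rw [indicator_of_mem hρ, indicator_of_mem (show ρ ∈ Ioi 1 from hR.trans hρ),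
      ← ENNReal.ofReal_mul (by linarith)]
    refine ENNReal.ofReal_le_ofReal ?_
    simpa using (le_of_lt (show R < ρ from hρ))
  · rw [indicator_of_notMem hρ, mul_zero]; exact zero_le

/-- After multiplication by `R^α` the short jumps carry the factor `R^{α-2} ≤ 1`, and the long ones
form the tail condition. The endpoint `α = 2` is allowed because the discrete Laplacian needs it. -/
theorem truncMoment_le_rpow (hS : S.IsSymm) {h R α : ℝ} (hh : h ∈ Ioo (0 : ℝ) 1) (hR : 1 < R)
    (hα : α ≤ 2) {A B : ℝ≥0∞} (hA : A ≠ ∞) (hB : B ≠ ∞) (h1 : S.moment h (Icc h 1) 2 ≤ A)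
    (h2 : ENNReal.ofReal (R ^ (α - 2)) * S.moment h (Ioc 1 R) 2 +
      ENNReal.ofReal (R ^ α) * S.moment h (Ioi R) 0 ≤ B) :
    S.truncMoment h R ≤ (A + B).toReal * R ^ (-α) := by
  have hR0 : 0 < R := by linarith
  have hpow : R ^ α * R⁻¹ ^ 2 = R ^ (α - 2) := by
    rw [Real.rpow_sub hR0, inv_pow, ← Real.rpow_natCast R 2]
    norm_num [div_eq_mul_inv]
  have key : ENNReal.ofReal (R ^ α * S.truncMoment h R) ≤ A + B := by
    rw [ENNReal.ofReal_mul (by positivity)]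
    calc _ ≤ ENNReal.ofReal (R ^ α) * (ENNReal.ofReal (R⁻¹ ^ 2) * S.moment h (Icc h 1) 2 +
          ENNReal.ofReal (R⁻¹ ^ 2) * S.moment h (Ioc 1 R) 2 + S.moment h (Ioi R) 0) := by
          gcongr
          exact ofReal_truncMoment_le hS hh hR
      _ = ENNReal.ofReal (R ^ (α - 2)) * S.moment h (Icc h 1) 2 +
          (ENNReal.ofReal (R ^ (α - 2)) * S.moment h (Ioc 1 R) 2 +
            ENNReal.ofReal (R ^ α) * S.moment h (Ioi R) 0) := by
          rw [mul_add, mul_add, ← mul_assoc, ← mul_assoc, ← ENNReal.ofReal_mul (by positivity),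
            hpow, add_assoc]
      _ ≤ 1 * A + B := by
          gcongr
          rw [ENNReal.ofReal_le_one]
          exact Real.rpow_le_one_of_one_le_of_nonpos hR.le (by linarith)
      _ = A + B := by rw [one_mul]
  have h3 := (ENNReal.ofReal_le_iff_le_toReal (by simp [hA, hB])).1 key
  rw [Real.rpow_neg hR0.le, ← div_eq_mul_inv, le_div_iff₀ (by positivity)]
  linarith

end Stencil

theorem discreteLaplacian_single {h : ℝ} {δ : Idx N} (h0 : δ ≠ 0)
    (h1 : ∀ i, δ ≠ Pi.single i 1 ∧ δ ≠ -Pi.single i 1) :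
    discreteLaplacian h (Pi.single δ 1 : Idx N → ℝ) 0 = 0 := by
  unfold discreteLaplacian
  refine Finset.sum_eq_zero fun i _ => ?_
  rw [Pi.single_eq_of_ne (M := fun _ => ℝ) h0.symm, zero_add, zero_sub,
    Pi.single_eq_of_ne (M := fun _ => ℝ) (h1 i).1.symm,
    Pi.single_eq_of_ne (M := fun _ => ℝ) (h1 i).2.symm]
  simp

theorem norm_gridPoint_single {h : ℝ} (hh : 0 ≤ h) (i : Fin N) :
    ‖gridPoint h (Pi.single i 1 : Idx N)‖ = h := by
  have : gridPoint h (Pi.single i 1 : Idx N) = EuclideanSpace.single i h := by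
    ext j
    by_cases hj : j = i
    · subst hj; simp [gridPoint_apply]
    · simp [gridPoint_apply, hj]
  rw [this]
  simp [abs_of_nonneg hh]

namespace Stencil

/-- Several `γ` may share an offset, so equality of operators does not determine the stencil.
Applied to a unit mass at `z_γ` and evaluated at `0`, it gives the total weight of all indices with
that offset. The Laplacian only jumps by `h < 1`, so for a longer offset this sum of nonnegative
terms is zero, and so is each term. -/
theorem weight_eq_zero_of_op_eq_discreteLaplacian {S : Stencil N} (hS : S.IsSymm) {h : ℝ}
    (hh : h ∈ Ioo (0 : ℝ) 1) (hop : S.op = discreteLaplacian h) (γ : {γ : Idx N // γ ≠ 0})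
    (hγ : 1 < ‖gridPoint h (S.offset γ)‖) : S.weight γ = 0 := by
  have h0 : S.offset γ ≠ 0 := fun h0 => by
    rw [h0, gridPoint_zero, norm_zero] at hγ
    linarith
  have h1 : ∀ i, S.offset γ ≠ Pi.single i 1 ∧ S.offset γ ≠ -Pi.single i 1 := fun i => by
    constructor <;> intro hc
    · rw [hc, norm_gridPoint_single hh.1.le] at hγ
      exact absurd hγ (not_lt.2 hh.2.le)
    · rw [hc, gridPoint_neg, norm_neg, norm_gridPoint_single hh.1.le] at hγ
      exact absurd hγ (not_lt.2 hh.2.le)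
  have h2 := discreteLaplacian_single (h := h) h0 h1
  rw [← hop] at h2
  have hb : ∀ β, |(Pi.single (S.offset γ) 1 : Idx N → ℝ) β| ≤ 1 := fun β => by
    by_cases hβ : β = S.offset γ
    · subst hβ; simp
    · simp [Pi.single_eq_of_ne (M := fun _ => ℝ) hβ]
  have hs := S.summable_op_term hb 0
  have h3 := hs.le_tsum γ fun δ _ => by
    rw [Pi.single_eq_of_ne (M := fun _ => ℝ) h0.symm, sub_zero]
    refine mul_nonneg ?_ (hS δ δ.2).2
    by_cases hβ : 0 + S.offset δ = S.offset γ
    · rw [hβ]; simp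
    · rw [Pi.single_eq_of_ne (M := fun _ => ℝ) hβ]
  unfold op at h2
  rw [h2, zero_add, Pi.single_eq_of_ne (M := fun _ => ℝ) h0.symm, Pi.single_eq_same] at h3
  have := (hS γ γ.2).2
  linarith

theorem moment_eq_zero {S : Stencil N} {h : ℝ} {A : Set ℝ} {s : ℕ}
    (hA : ∀ γ : {γ : Idx N // γ ≠ 0}, ‖gridPoint h (S.offset γ)‖ ∈ A → S.weight γ = 0) :
    S.moment h A s = 0 := by
  unfold moment
  rw [ENNReal.tsum_eq_zero]
  intro γ
  by_cases hγ : ‖gridPoint h (S.offset γ)‖ ∈ A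
  · simp [hA γ hγ]
  · simp [indicator_of_notMem hγ]

end Stencil

/-- Puts the condition on the Hölder exponent into the form in which the tail estimate uses it. -/
theorem mul_one_sub_lt_of_max_div_lt (hN : 1 ≤ N) {α a : ℝ}
    (h : max ((N : ℝ) - α) 0 / N < a) : (N : ℝ) * (1 - a) < α := by
  have hN0 : (0 : ℝ) < N := by exact_mod_cast hN
  rw [div_lt_iff₀ hN0] at h
  linarith [le_max_left ((N : ℝ) - α) 0]

/-- In each of the three alternatives the truncated second moments of the weights decay like
`R^{-α}` with an order `α > N (1 - a)`. -/
theorem OperatorCondition.exists_decay (hN : 1 ≤ N) {a : ℝ≥0} {S : ℝ → Stencil N}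
    (hS : OperatorCondition N a S) :
    ∃ α C : ℝ, 0 < α ∧ (N : ℝ) * (1 - a) < α ∧ 0 ≤ C ∧ ∀ h ∈ Ioo (0 : ℝ) 1,
      (S h).IsSymm ∧ ∀ R > 1, (S h).truncMoment h R ≤ C * R ^ (-α) := by
  have base : AssumptionOmega S → ∃ A : ℝ≥0∞, A ≠ ∞ ∧ ∀ h ∈ Ioo (0 : ℝ) 1,
      (S h).moment h (Icc h 1) 2 ≤ A := fun hω =>
    ⟨_, hω.bound.ne, fun h hh => le_self_add.trans
      (le_iSup₂_of_le (f := fun h (_ : h ∈ Ioo (0 : ℝ) 1) =>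
        (S h).moment h (Icc h 1) 2 + (S h).moment h (Ioi 1) 0) h hh le_rfl)⟩
  rcases hS with ⟨hop, hω, hlt⟩ | ⟨hω, hlt⟩ | ⟨α, hω, hlt⟩
  · obtain ⟨A, hA, hA'⟩ := base hω
    -- The discrete Laplacian has no jumps longer than `1`, so both tail moments vanish and the
    -- order is `2`.
    refine ⟨2, (A + 0).toReal, two_pos, mul_one_sub_lt_of_max_div_lt hN hlt,
      ENNReal.toReal_nonneg, fun h hh => ⟨hω.symmNonneg h hh, fun R hR => ?_⟩⟩
    have hz := Stencil.weight_eq_zero_of_op_eq_discreteLaplacian (hω.symmNonneg h hh) hh (hop h hh)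
    refine Stencil.truncMoment_le_rpow (hω.symmNonneg h hh) hh hR le_rfl hA ENNReal.zero_ne_top
      (hA' h hh) ?_
    rw [Stencil.moment_eq_zero fun γ hγ => hz γ hγ.1,
      Stencil.moment_eq_zero (A := Ioi R) fun γ hγ => hz γ (lt_trans hR hγ)]
    simp
  · set B := ⨆ h ∈ Ioo (0 : ℝ) 1, ((S h).moment h (Icc h 1) 2 + (S h).moment h (Ioi 1) 1) with hB
    have hBt : B ≠ ∞ := hω.bound.ne
    have hle : ∀ h ∈ Ioo (0 : ℝ) 1,
        (S h).moment h (Icc h 1) 2 + (S h).moment h (Ioi 1) 1 ≤ B := fun h hh =>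
      le_iSup₂_of_le (f := fun h (_ : h ∈ Ioo (0 : ℝ) 1) =>
        (S h).moment h (Icc h 1) 2 + (S h).moment h (Ioi 1) 1) h hh le_rfl
    have hlt' : (N : ℝ) * (1 - a) < 1 := by
      have hN0 : (0 : ℝ) < N := by exact_mod_cast hN
      rw [div_lt_iff₀ hN0] at hlt
      linarith
    -- One `B` bounds the short jumps, and one each of the two tail terms of order one.
    refine ⟨1, (B + (B + B)).toReal, one_pos, hlt', ENNReal.toReal_nonneg,
      fun h hh => ⟨hω.symmNonneg h hh, fun R hR => ?_⟩⟩
    have hm : (S h).moment h (Ioi 1) 1 ≤ B := le_add_self.trans (hle h hh)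
    refine Stencil.truncMoment_le_rpow (hω.symmNonneg h hh) hh hR one_le_two hBt
      (by simp [hBt]) (le_self_add.trans (hle h hh)) (add_le_add ?_ ?_)
    · calc _ ≤ ENNReal.ofReal (R ^ ((1 : ℝ) - 2)) *
            (ENNReal.ofReal R * (S h).moment h (Ioi 1) 1) := by
            gcongr
            exact Stencil.moment_Ioc_two_le hR
        _ = (S h).moment h (Ioi 1) 1 := by
            rw [← mul_assoc, ← ENNReal.ofReal_mul (by positivity)]
            norm_num [Real.rpow_neg_one]
            rw [inv_mul_cancel₀ (by linarith)]
            simp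
        _ ≤ B := hm
    · rw [Real.rpow_one]
      exact (Stencil.mul_moment_Ioi_zero_le hR).trans hm
  · obtain ⟨A, hA, hA'⟩ := base hω.base
    have hsym := hω.base.symmNonneg
    set B := ⨆ R ∈ Ioi (1 : ℝ), ⨆ h ∈ Ioo (0 : ℝ) 1,
      (ENNReal.ofReal (R ^ (α - 2)) * (S h).moment h (Ioc 1 R) 2 +
        ENNReal.ofReal (R ^ α) * (S h).moment h (Ioi R) 0) with hB
    refine ⟨α, (A + B).toReal, hω.order.1, mul_one_sub_lt_of_max_div_lt hN hlt,
      ENNReal.toReal_nonneg, fun h hh => ⟨hsym h hh, fun R hR => ?_⟩⟩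
    exact Stencil.truncMoment_le_rpow (hsym h hh) hh hR hω.order.2.le hA hω.tail.ne (hA' h hh)
      (le_iSup₂_of_le (f := fun R (_ : R ∈ Ioi (1 : ℝ)) => ⨆ h ∈ Ioo (0 : ℝ) 1,
        (ENNReal.ofReal (R ^ (α - 2)) * (S h).moment h (Ioc 1 R) 2 +
          ENNReal.ofReal (R ^ α) * (S h).moment h (Ioi R) 0)) R hR
      (le_iSup₂_of_le (f := fun h (_ : h ∈ Ioo (0 : ℝ) 1) =>
        (ENNReal.ofReal (R ^ (α - 2)) * (S h).moment h (Ioc 1 R) 2 +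
          ENNReal.ofReal (R ^ α) * (S h).moment h (Ioi R) 0)) h hh le_rfl))

/-! ### Cells, piecewise constant functions and cell averages. -/

theorem norm_le_of_forall_abs_le {x : Space N} {c : ℝ} (hc : 0 ≤ c) (h : ∀ i, |x i| ≤ c) :
    ‖x‖ ≤ N * c := by
  have h1 : ‖x‖ ^ 2 ≤ (N * c) ^ 2 := by
    rw [EuclideanSpace.real_norm_sq_eq]
    calc ∑ i, x i ^ 2 ≤ ∑ _i : Fin N, c ^ 2 := Finset.sum_le_sum fun i _ => sq_le_sq' 
          (abs_le.1 (h i)).1 (abs_le.1 (h i)).2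
      _ = N * c ^ 2 := by simp
      _ ≤ (N * c) ^ 2 := by
          rw [mul_pow]
          gcongr
          exact_mod_cast Nat.le_self_pow two_ne_zero N
  exact (sq_le_sq₀ (norm_nonneg _) (by positivity)).1 h1

/-- The index of the cell containing `x`. -/
noncomputable def idx (h : ℝ) (x : Space N) : Idx N := fun i => ⌈x i / h - 1 / 2⌉

/-- The cells are the fibres of one measurable map, so piecewise constant functions become
compositions `V ∘ idx h`. The ceiling in `idx` reflects that the cells are open on the left and
closed on the right. -/
theorem mem_cell_iff {h : ℝ} (hh : 0 < h) {β : Idx N} {x : Space N} :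
    x ∈ cell h β ↔ idx h x = β := by
  rw [funext_iff]
  refine forall_congr' fun i => ?_
  rw [gridPoint_apply, idx, Int.ceil_eq_iff, mem_Ioc]
  have e : x i = h * (x i / h) := by field_simp
  set y := x i / h
  rw [e]
  constructor
  · rintro ⟨h1, h2⟩
    constructor
    · by_contra! hc; nlinarith
    · by_contra! hc; nlinarith
  · rintro ⟨h1, h2⟩
    constructor <;> nlinarith

theorem cell_eq_preimage {h : ℝ} (hh : 0 < h) (β : Idx N) : cell h β = idx h ⁻¹' {β} := by
  ext x
  simp [mem_cell_iff hh]

theorem spaceInterp_eq {h : ℝ} (hh : 0 < h) (V : Idx N → ℝ) :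
    spaceInterp h V = fun x => V (idx h x) := by
  funext x
  unfold spaceInterp
  rw [tsum_eq_single (idx h x), indicator_of_mem ((mem_cell_iff hh).2 rfl)]
  intro β hβ
  rw [indicator_of_notMem]
  rw [mem_cell_iff hh]
  exact hβ.symm

@[fun_prop]
theorem measurable_idx (h : ℝ) : Measurable (idx h : Space N → Idx N) := by
  refine measurable_pi_lambda _ fun i => ?_
  exact Int.measurable_ceil.comp (by fun_prop)

theorem measurableSet_cell {h : ℝ} (hh : 0 < h) (β : Idx N) : MeasurableSet (cell h β) := by
  rw [cell_eq_preimage hh]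
  exact measurable_idx h (measurableSet_singleton β)

theorem iUnion_cell {h : ℝ} (hh : 0 < h) : ⋃ β : Idx N, cell h β = univ := by
  ext x
  simp [mem_cell_iff hh]

theorem pairwise_disjoint_cell {h : ℝ} (hh : 0 < h) :
    Pairwise (Function.onFun Disjoint (cell (N := N) h)) := fun β γ hβγ => by
  refine Set.disjoint_left.2 fun x hx hy => hβγ ?_
  rw [← (mem_cell_iff hh).1 hx, (mem_cell_iff hh).1 hy]

theorem volume_cell {h : ℝ} (hh : 0 < h) (β : Idx N) :
    volume (cell h β) = ENNReal.ofReal (h ^ N) := by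
  have hc : cell h β = (WithLp.ofLp : Space N → Fin N → ℝ) ⁻¹'
      (univ.pi fun i => Ioc (h * β i - h / 2) (h * β i + h / 2)) := by
    ext x
    simp only [cell, Set.mem_ofPred_eq, gridPoint_apply, mem_Ioc, mem_preimage, Set.mem_pi, mem_univ,
      true_imp_iff]
    refine forall_congr' fun i => ?_
    constructor <;> rintro ⟨h1, h2⟩ <;> constructor <;> linarith
  rw [hc, (PiLp.volume_preserving_ofLp (Fin N)).measure_preimage
    (MeasurableSet.univ_pi fun i => measurableSet_Ioc).nullMeasurableSet, volume_pi_pi]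
  simp only [Real.volume_Ioc]
  rw [Finset.prod_congr rfl fun i _ => by
    rw [show h * β i + h / 2 - (h * β i - h / 2) = h by ring], Finset.prod_const,
    Finset.card_univ, Fintype.card_fin, ENNReal.ofReal_pow hh.le]

theorem volume_cell_ne_top {h : ℝ} (hh : 0 < h) (β : Idx N) : volume (cell h β) ≠ ∞ := by
  rw [volume_cell hh]; exact ENNReal.ofReal_ne_top

/-- The image of Lebesgue measure under `idx h` is `h^N` times counting measure. -/
theorem lintegral_comp_idx {h : ℝ} (hh : 0 < h) (F : Idx N → ℝ≥0∞) :
    ∫⁻ x, F (idx h x) = ENNReal.ofReal (h ^ N) * ∑' β, F β := by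
  rw [← lintegral_map (f := F) (measurable_of_countable F) (measurable_idx h),
    lintegral_countable', ← ENNReal.tsum_mul_left]
  refine tsum_congr fun β => ?_
  rw [Measure.map_apply (measurable_idx h) (measurableSet_singleton β), ← cell_eq_preimage hh,
    volume_cell hh, mul_comm]

theorem lintegral_enorm_comp_idx {h : ℝ} (hh : 0 < h) {V : Idx N → ℝ}
    (hV : Summable fun β => |V β|) :
    ∫⁻ x, ‖V (idx h x)‖ₑ = ENNReal.ofReal (h ^ N * ∑' β, |V β|) := by
  rw [lintegral_comp_idx hh (fun β => ‖V β‖ₑ), ENNReal.ofReal_mul (by positivity),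
    ENNReal.ofReal_tsum_of_nonneg (fun β => abs_nonneg _) hV]
  simp_rw [Real.enorm_eq_ofReal_abs]

theorem aestronglyMeasurable_comp_idx (h : ℝ) (V : Idx N → ℝ) :
    AEStronglyMeasurable (fun x : Space N => V (idx h x)) volume :=
  ((measurable_of_countable V).comp (measurable_idx h)).aestronglyMeasurable

theorem integrable_comp_idx {h : ℝ} (hh : 0 < h) {V : Idx N → ℝ} (hV : Summable fun β => |V β|) :
    Integrable (fun x : Space N => V (idx h x)) := by
  refine ⟨aestronglyMeasurable_comp_idx h V, ?_⟩
  rw [hasFiniteIntegral_iff_enorm, lintegral_enorm_comp_idx hh hV]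
  exact ENNReal.ofReal_lt_top

theorem hasSum_setIntegral_cell {h : ℝ} (hh : 0 < h) {f : Space N → ℝ} (hf : Integrable f) :
    HasSum (fun β => ∫ x in cell h β, f x) (∫ x, f x) := by
  have := hasSum_integral_iUnion (measurableSet_cell hh) (pairwise_disjoint_cell hh)
    (f := f) (μ := volume) (by rw [iUnion_cell hh]; exact hf.integrableOn)
  rwa [iUnion_cell hh, setIntegral_univ] at this

theorem pow_mul_initialAverage {h : ℝ} (hh : 0 < h) (f : Space N → ℝ) (β : Idx N) :
    h ^ N * initialAverage h f β = ∫ x in cell h β, f x := by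
  unfold initialAverage
  field_simp

theorem initialAverage_sub {h : ℝ} {f g : Space N → ℝ} (hf : Integrable f)
    (hg : Integrable g) (β : Idx N) :
    initialAverage h (fun x => f x - g x) β = initialAverage h f β - initialAverage h g β := by
  unfold initialAverage
  rw [integral_sub hf.integrableOn hg.integrableOn]; ring

theorem initialAverage_add {h : ℝ} {f g : Space N → ℝ} (hf : Integrable f)
    (hg : Integrable g) (β : Idx N) :
    initialAverage h (fun x => f x + g x) β = initialAverage h f β + initialAverage h g β := by
  unfold initialAverage
  rw [integral_add hf.integrableOn hg.integrableOn]; ring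

theorem initialAverage_const_mul {h : ℝ} (c : ℝ) (f : Space N → ℝ) (β : Idx N) :
    initialAverage h (fun x => c * f x) β = c * initialAverage h f β := by
  unfold initialAverage
  rw [integral_const_mul]; ring

/-- Translations by grid vectors permute the cells. Hence discrete translation differences of the
data are controlled by continuous ones. -/
theorem initialAverage_translate {h : ℝ} (hh : 0 < h) (f : Space N → ℝ) (γ β : Idx N) :
    initialAverage h (fun x => f (x + gridPoint h γ)) β = initialAverage h f (β + γ) := by
  unfold initialAverage
  congr 1
  rw [← integral_indicator (measurableSet_cell hh β),
    ← integral_indicator (measurableSet_cell hh (β + γ)),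
    ← integral_add_right_eq_self ((cell h (β + γ)).indicator f) (gridPoint h γ)]
  refine integral_congr_ae (Eventually.of_forall fun x => ?_)
  have : x ∈ cell h β ↔ x + gridPoint h γ ∈ cell h (β + γ) := by
    simp only [cell, Set.mem_ofPred_eq, gridPoint_add]
    refine forall_congr' fun i => ?_
    simp
  by_cases hx : x ∈ cell h β
  · simp only [indicator_of_mem hx, indicator_of_mem (this.1 hx)]
  · simp only [indicator_of_notMem hx, indicator_of_notMem (mt this.2 hx)]

theorem abs_initialAverage_le {h : ℝ} (hh : 0 < h) {f : Space N → ℝ} {M : ℝ}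
    (hf : ∀ᵐ x, |f x| ≤ M) (β : Idx N) : |initialAverage h f β| ≤ M := by
  have hv := (volume_cell_ne_top hh β).lt_top
  have h1 : ‖∫ x in cell h β, f x‖ ≤ M * volume.real (cell h β) :=
    norm_setIntegral_le_of_norm_le_const_ae hv (ae_restrict_of_ae hf)
  rw [Measure.real, volume_cell hh, ENNReal.toReal_ofReal (by positivity), Real.norm_eq_abs,
    ← pow_mul_initialAverage hh, abs_mul, abs_of_pos (pow_pos hh N), mul_comm M] at h1
  exact le_of_mul_le_mul_left h1 (pow_pos hh N)

/-- Weighted `ℓ¹` bound for cell averages, for weights supported on cells inside a set `s`. -/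
theorem summable_and_tsum_abs_initialAverage_mul_le {h : ℝ} (hh : 0 < h) {f : Space N → ℝ}
    (hf : Integrable f) {X : Idx N → ℝ} (hX0 : ∀ β, 0 ≤ X β) (hX1 : ∀ β, X β ≤ 1)
    {s : Set (Space N)} (hs : MeasurableSet s) (hX : ∀ β, X β ≠ 0 → cell h β ⊆ s) :
    Summable (fun β => |initialAverage h f β| * X β) ∧
      h ^ N * ∑' β, |initialAverage h f β| * X β ≤ ∫ x in s, |f x| := by
  have hsum := hasSum_setIntegral_cell hh (f := s.indicator fun x => |f x|)
    (hf.abs.indicator hs)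
  have hle : ∀ β, h ^ N * (|initialAverage h f β| * X β) ≤
      ∫ x in cell h β, s.indicator (fun x => |f x|) x := fun β => by
    have hnn : 0 ≤ ∫ x in cell h β, s.indicator (fun x => |f x|) x :=
      integral_nonneg fun x => indicator_nonneg (fun _ _ => abs_nonneg _) x
    by_cases h0 : X β = 0
    · simpa [h0] using hnn
    · rw [setIntegral_congr_fun (measurableSet_cell hh β) (g := fun x => |f x|)
        fun x hx => indicator_of_mem (hX β h0 hx) _, ← mul_assoc]
      calc _ ≤ h ^ N * |initialAverage h f β| * 1 := by
            gcongr
            exact hX1 β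
        _ = |∫ x in cell h β, f x| := by
            rw [mul_one, ← pow_mul_initialAverage hh, abs_mul, abs_of_pos (pow_pos hh N)]
        _ ≤ _ := abs_integral_le_integral_abs
  have hp := pow_pos hh N
  have h1 : Summable (fun β => h ^ N * (|initialAverage h f β| * X β)) :=
    Summable.of_nonneg_of_le
      (fun β => mul_nonneg hp.le (mul_nonneg (abs_nonneg _) (hX0 β))) hle hsum.summable
  refine ⟨(summable_mul_left_iff hp.ne').1 h1, ?_⟩
  rw [← tsum_mul_left, ← integral_indicator hs, ← hsum.tsum_eq]
  exact h1.tsum_le_tsum hle hsum.summable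

theorem summable_abs_initialAverage {h : ℝ} (hh : 0 < h) {f : Space N → ℝ} (hf : Integrable f) :
    Summable (fun β => |initialAverage h f β|) := by
  simpa using (summable_and_tsum_abs_initialAverage_mul_le hh hf (X := fun _ => 1) (by simp)
    (by simp) MeasurableSet.univ (by simp)).1

theorem tsum_abs_initialAverage_le {h : ℝ} (hh : 0 < h) {f : Space N → ℝ} (hf : Integrable f) :
    h ^ N * ∑' β, |initialAverage h f β| ≤ ∫ x, |f x| := by
  simpa using (summable_and_tsum_abs_initialAverage_mul_le hh hf (X := fun _ => 1) (by simp)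
    (by simp) MeasurableSet.univ (by simp)).2

theorem tsum_abs_initialAverage_translate_sub_le {h : ℝ} (hh : 0 < h) {f : Space N → ℝ}
    (hf : Integrable f) (γ : Idx N) :
    h ^ N * ∑' β, |initialAverage h f (β + γ) - initialAverage h f β| ≤
      ∫ x, |f (x + gridPoint h γ) - f x| := by
  have h1 := hf.comp_add_right (gridPoint h γ)
  have := tsum_abs_initialAverage_le hh (h1.sub hf)
  simp_rw [Pi.sub_def, initialAverage_sub h1 hf, initialAverage_translate hh] at this
  exact this

theorem norm_sub_le_of_mem_cell {h : ℝ} (hh : 0 ≤ h) {β : Idx N} {x y : Space N}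
    (hx : x ∈ cell h β) (hy : y ∈ cell h β) : ‖x - y‖ ≤ N * h := by
  refine norm_le_of_forall_abs_le hh fun i => ?_
  have h1 := hx i
  have h2 := hy i
  rw [mem_Ioc] at h1 h2
  rw [PiLp.sub_apply, abs_le]
  constructor <;> linarith

/-! ### Time grids, space-time integrability and the averaged source. -/

variable {T : ℝ}

namespace TimeGrid

variable (τ : TimeGrid T)

theorem step_pos {j : ℕ} (hj : j < τ.J) : 0 < τ.step j := sub_pos.2 (τ.time_lt j hj)

theorem time_mono {i j : ℕ} (hij : i ≤ j) (hj : j ≤ τ.J) : τ.time i ≤ τ.time j := by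
  induction j, hij using Nat.le_induction with
  | base => exact le_rfl
  | succ k _ ih => exact (ih (by omega)).trans (τ.time_lt k (by omega)).le

theorem time_nonneg {j : ℕ} (hj : j ≤ τ.J) : 0 ≤ τ.time j := by
  rw [← τ.time_zero]; exact τ.time_mono (Nat.zero_le j) hj

theorem time_le {j : ℕ} (hj : j ≤ τ.J) : τ.time j ≤ T :=
  (τ.time_mono hj le_rfl).trans_eq τ.time_last

/-- A discrete Gronwall-type summation: increments bounded by integrals over the time steps. -/
theorem le_of_increment_le {A : ℕ → ℝ} {b : ℝ → ℝ} {E : ℝ}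
    (hb : IntervalIntegrable b volume 0 T)
    (hA : ∀ j < τ.J, A (j + 1) ≤ A j + (∫ s in τ.time j..τ.time (j + 1), b s) + τ.step j * E)
    {j : ℕ} (hj : j ≤ τ.J) : A j ≤ A 0 + (∫ s in 0..τ.time j, b s) + τ.time j * E := by
  have hsub : ∀ {i k : ℕ}, i ≤ k → k ≤ τ.J →
      IntervalIntegrable b volume (τ.time i) (τ.time k) := fun {i k} hik hk => by
    refine hb.mono_set ?_
    rw [uIcc_of_le (τ.time_mono hik hk),
      uIcc_of_le ((τ.time_nonneg le_rfl).trans (τ.time_le le_rfl))]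
    exact Icc_subset_Icc (τ.time_nonneg (hik.trans hk)) (τ.time_le hk)
  induction j with
  | zero => simp [τ.time_zero]
  | succ k ih =>
    have h1 := ih (by omega)
    have h2 := hA k (by omega)
    have h3 : (∫ s in 0..τ.time k, b s) + ∫ s in τ.time k..τ.time (k + 1), b s =
        ∫ s in 0..τ.time (k + 1), b s := by
      refine intervalIntegral.integral_add_adjacent_intervals ?_ (hsub (Nat.le_succ k) hj)
      rw [← τ.time_zero]
      exact hsub (Nat.zero_le k) (by omega)
    rw [step] at h2
    rw [← h3]
    linarith

end TimeGrid

/-- The function `(x, t) ↦ k x t` is integrable on `ℝ^N × (0, T)`. -/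
def IntegrableST (T : ℝ) (k : Space N → ℝ → ℝ) : Prop :=
  Integrable (fun p : Space N × ℝ => k p.1 p.2) (volume.prod (volume.restrict (Ioc 0 T)))

/-- The spatial `L¹` norm at time `t`. -/
noncomputable def spaceNorm (k : Space N → ℝ → ℝ) (t : ℝ) : ℝ := ∫ x, |k x t|

theorem spaceNorm_nonneg (k : Space N → ℝ → ℝ) (t : ℝ) : 0 ≤ spaceNorm k t :=
  integral_nonneg fun _ => abs_nonneg _

namespace IntegrableST

variable {k : Space N → ℝ → ℝ}

theorem intervalIntegrable_spaceNorm (hT : 0 ≤ T) (hk : IntegrableST T k) :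
    IntervalIntegrable (spaceNorm k) volume 0 T := by
  rw [intervalIntegrable_iff_integrableOn_Ioc_of_le hT]
  exact hk.abs.integral_prod_right

theorem restrict {s t : ℝ} (hk : IntegrableST T k) (hs : 0 ≤ s) (ht : t ≤ T) :
    Integrable (fun p : Space N × ℝ => k p.1 p.2) (volume.prod (volume.restrict (Ioc s t))) := by
  refine hk.mono_measure (Measure.prod_mono le_rfl ?_)
  exact Measure.restrict_mono (Ioc_subset_Ioc hs ht) le_rfl

theorem integrable_intervalIntegral {s t : ℝ} (hk : IntegrableST T k) (hs : 0 ≤ s)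
    (hst : s ≤ t) (ht : t ≤ T) : Integrable (fun x => ∫ r in s..t, k x r) := by
  simp_rw [intervalIntegral.integral_of_le hst]
  exact (hk.restrict hs ht).integral_prod_left

theorem integral_abs_intervalIntegral_le {s t : ℝ} (hk : IntegrableST T k) (hs : 0 ≤ s)
    (hst : s ≤ t) (ht : t ≤ T) :
    ∫ x, |∫ r in s..t, k x r| ≤ ∫ r in s..t, spaceNorm k r := by
  have h := hk.restrict hs ht
  have h1 := hk.integrable_intervalIntegral hs hst ht
  simp_rw [intervalIntegral.integral_of_le hst] at h1 ⊢
  calc ∫ x, |∫ r in Ioc s t, k x r| ≤ ∫ x, ∫ r in Ioc s t, |k x r| :=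
        integral_mono h1.abs h.abs.integral_prod_left fun x => abs_integral_le_integral_abs
    _ = _ := integral_integral_swap h.abs

theorem abs (hk : IntegrableST T k) : IntegrableST T (fun x t => |k x t|) := Integrable.abs hk

theorem sub {l : Space N → ℝ → ℝ} (hk : IntegrableST T k) (hl : IntegrableST T l) :
    IntegrableST T (fun x t => k x t - l x t) := Integrable.sub hk hl

theorem indicator {s : Set (Space N)} (hs : MeasurableSet s) (hk : IntegrableST T k) :
    IntegrableST T (fun x t => s.indicator (fun y => k y t) x) := by
  have := Integrable.indicator hk (hs.prod (MeasurableSet.univ (α := ℝ)))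
  refine this.congr (Eventually.of_forall fun p => ?_)
  by_cases hp : p.1 ∈ s
  · simp [hp]
  · simp [hp]

theorem comp_add_right (hk : IntegrableST T k) (ξ : Space N) :
    IntegrableST T (fun x t => k (x + ξ) t) := by
  have h1 : MeasurePreserving (fun p : Space N × ℝ => (p.1 + ξ, p.2))
      (volume.prod (volume.restrict (Ioc 0 T))) (volume.prod (volume.restrict (Ioc 0 T))) :=
    (measurePreserving_add_right volume ξ).prod (MeasurePreserving.id _)
  exact h1.integrable_comp_of_integrable hk

end IntegrableST

theorem AssumptionG.integrableST {g : Space N → ℝ → ℝ} (hg : AssumptionG T g) :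
    IntegrableST T g := by
  have hm := hg.meas
  have e : (volume : Measure (Space N × ℝ)).restrict (univ ×ˢ Ioo 0 T) =
      volume.prod (volume.restrict (Ioc 0 T)) := by
    rw [Measure.volume_eq_prod, ← Measure.prod_restrict, Measure.restrict_univ,
      restrict_Ioo_eq_restrict_Ioc]
  rw [e] at hm
  refine ⟨hm, ?_⟩
  rw [hasFiniteIntegral_iff_enorm, lintegral_prod_symm _ hm.enorm]
  refine lt_of_le_of_lt ?_ hg.finite
  rw [restrict_Ioo_eq_restrict_Ioc]
  refine lintegral_mono fun t => ?_
  rw [eLpNorm_one_eq_lintegral_enorm]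
  exact le_self_add

/-- The time integral of the source over a time step. -/
noncomputable def stepSource (τ : TimeGrid T) (g : Space N → ℝ → ℝ) (j : ℕ) (x : Space N) : ℝ :=
  ∫ t in τ.time j..τ.time (j + 1), g x t

/-- By Fubini the source term of a step is the cell average of a function of `x`, so it is estimated
exactly like the initial datum. -/
theorem step_mul_sourceAverage {g : Space N → ℝ → ℝ} (hg : IntegrableST T g) (h : ℝ)
    (τ : TimeGrid T) {j : ℕ} (hj : j < τ.J) (β : Idx N) :
    τ.step j * sourceAverage h τ g j β = initialAverage h (stepSource τ g j) β := by
  have hs := (τ.step_pos hj).ne'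
  have hst := (τ.time_lt j hj).le
  have h1 := hg.restrict (τ.time_nonneg hj.le) (τ.time_le hj)
  unfold sourceAverage initialAverage stepSource
  simp_rw [intervalIntegral.integral_of_le hst]
  rw [integral_integral_swap (f := fun t x => g x t)]
  · rw [← mul_assoc]
    congr 1
    rw [mul_comm (h ^ N), one_div, mul_inv, ← mul_assoc, mul_inv_cancel₀ hs, one_mul, one_div]
  · refine Integrable.swap (f := fun p : Space N × ℝ => g p.1 p.2) ?_
    exact h1.mono_measure (Measure.prod_mono Measure.restrict_le_self le_rfl)

/-- The bound is kept as a `[0, ∞]`-valued integral in time, so that measurability of `t ↦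
‖g(·,t)‖_∞` is never needed. -/
theorem abs_step_mul_sourceAverage_le {g : Space N → ℝ → ℝ} {h : ℝ} (hh : 0 < h)
    (τ : TimeGrid T) {j : ℕ} (hj : j < τ.J)
    (hfin : ∫⁻ t in Ioc (τ.time j) (τ.time (j + 1)), eLpNorm (fun x => g x t) ∞ volume ≠ ∞)
    (β : Idx N) :
    |τ.step j * sourceAverage h τ g j β| ≤
      (∫⁻ t in Ioc (τ.time j) (τ.time (j + 1)), eLpNorm (fun x => g x t) ∞ volume).toReal := by
  have hs := τ.step_pos hj
  have hst := (τ.time_lt j hj).le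
  have hp := pow_pos hh N
  have e : τ.step j * sourceAverage h τ g j β =
      (h ^ N)⁻¹ * ∫ t in Ioc (τ.time j) (τ.time (j + 1)), ∫ x in cell h β, g x t := by
    unfold sourceAverage
    rw [intervalIntegral.integral_of_le hst]
    field_simp
  rw [e, abs_mul, abs_of_pos (inv_pos.2 hp), inv_mul_le_iff₀ hp]
  have key : ‖∫ t in Ioc (τ.time j) (τ.time (j + 1)), ∫ x in cell h β, g x t‖ₑ ≤
      ENNReal.ofReal (h ^ N) *
        ∫⁻ t in Ioc (τ.time j) (τ.time (j + 1)), eLpNorm (fun x => g x t) ∞ volume := by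
    calc _ ≤ ∫⁻ t in Ioc (τ.time j) (τ.time (j + 1)), ‖∫ x in cell h β, g x t‖ₑ :=
          enorm_integral_le_lintegral_enorm _
      _ ≤ ∫⁻ t in Ioc (τ.time j) (τ.time (j + 1)),
          ENNReal.ofReal (h ^ N) * eLpNorm (fun x => g x t) ∞ volume := by
          refine lintegral_mono fun t => ?_
          calc _ ≤ ∫⁻ x in cell h β, ‖g x t‖ₑ := enorm_integral_le_lintegral_enorm _
            _ ≤ ∫⁻ _x in cell h β, eLpNorm (fun x => g x t) ∞ volume := by
              refine lintegral_mono_ae (ae_restrict_of_ae ?_)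
              rw [eLpNorm_exponent_top]
              exact ae_le_eLpNormEssSup
            _ = _ := by rw [setLIntegral_const, volume_cell hh, mul_comm]
      _ = _ := lintegral_const_mul' _ _ ENNReal.ofReal_ne_top
  rw [Real.enorm_eq_ofReal_abs, ENNReal.ofReal_le_iff_le_toReal
    (ENNReal.mul_ne_top ENNReal.ofReal_ne_top hfin), ENNReal.toReal_mul,
    ENNReal.toReal_ofReal hp.le] at key
  exact key

/-! ### A priori estimates for the scheme: sup bound, weighted `ℓ¹` bound, `ℓ¹` contraction. -/

namespace IsSchemeSolution

variable {φ : ℝ → ℝ} {u₀ : Space N → ℝ} {g : Space N → ℝ → ℝ} {S : Stencil N} {h : ℝ}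
  {τ : TimeGrid T} {U : ℕ → Idx N → ℝ}

/-- The uniform bound of a solution of the scheme. -/
noncomputable def supBound (T : ℝ) (u₀ : Space N → ℝ) (g : Space N → ℝ → ℝ) : ℝ :=
  (eLpNorm u₀ ∞ volume).toReal +
    (∫⁻ t in Ioc 0 T, eLpNorm (fun x => g x t) ∞ volume).toReal

theorem abs_le_supBound (hU : IsSchemeSolution φ u₀ g S h τ U) (hh : 0 < h) (hS : S.IsSymm)
    (hφ : Monotone φ) (hu₀ : AssumptionU0 u₀) (hg : AssumptionG T g) {j : ℕ} (hj : j ≤ τ.J)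
    (β : Idx N) : |U j β| ≤ supBound T u₀ g := by
  set m : ℝ → ℝ≥0∞ := fun t => ∫⁻ s in Ioc 0 t, eLpNorm (fun x => g x s) ∞ volume with hm
  have hT : m T ≠ ∞ := by
    refine ne_top_of_le_ne_top hg.finite.ne ?_
    rw [restrict_Ioo_eq_restrict_Ioc]
    exact lintegral_mono fun t => le_add_self
  have hmono : ∀ {s t : ℝ}, s ≤ t → m s ≤ m t := fun hst =>
    lintegral_mono_set (Ioc_subset_Ioc_right hst)
  have hfin : ∀ t ≤ T, m t ≠ ∞ := fun t ht => ne_top_of_le_ne_top hT (hmono ht)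
  -- The induction needs a bound that grows in time: each step adds at most the integral of the sup
  -- norm of the source over that step.
  have main : ∀ j ≤ τ.J, ∀ β, |U j β| ≤ (eLpNorm u₀ ∞ volume).toReal + (m (τ.time j)).toReal := by
    intro j
    induction j with
    | zero =>
      intro _ β
      rw [hU.initial]
      refine (abs_initialAverage_le hh ?_ β).trans (le_add_of_nonneg_right ENNReal.toReal_nonneg)
      have h1 : ∀ᵐ x, ‖u₀ x‖ₑ ≤ eLpNorm u₀ ∞ volume := by
        rw [eLpNorm_exponent_top]
        exact ae_le_eLpNormEssSup
      filter_upwards [h1] with x hx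
      rwa [Real.enorm_eq_ofReal_abs,
        ENNReal.ofReal_le_iff_le_toReal hu₀.memLp_top.eLpNorm_ne_top] at hx
    | succ k ih =>
      intro hk β
      have hk' : k < τ.J := hk
      have hadd : m (τ.time (k + 1)) = m (τ.time k) + ∫⁻ t in Ioc (τ.time k) (τ.time (k + 1)),
          eLpNorm (fun x => g x t) ∞ volume := by
        simp only [hm]
        rw [← lintegral_union measurableSet_Ioc
          (Set.disjoint_left.2 fun x hx hy => not_lt.2 hx.2 hy.1),
          Ioc_union_Ioc_eq_Ioc (τ.time_nonneg hk'.le) (τ.time_lt k hk').le]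
      have hf1 := hfin _ (τ.time_le hk)
      have hf2 : ∫⁻ t in Ioc (τ.time k) (τ.time (k + 1)),
          eLpNorm (fun x => g x t) ∞ volume ≠ ∞ :=
        ne_top_of_le_ne_top hf1 (hadd ▸ le_add_self)
      refine Stencil.abs_le_of_implicit_step hS hφ (τ.step_pos hk').le
        (hU.summable (k + 1) hk).of_abs
        (f := fun β => U k β + τ.step k * sourceAverage h τ g k β) (fun α => ?_) (fun α => ?_) β
      · refine (abs_add_le _ _).trans ?_
        rw [hadd, ENNReal.toReal_add (hfin _ (τ.time_le hk'.le)) hf2, ← add_assoc]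
        exact add_le_add (ih hk'.le α) (abs_step_mul_sourceAverage_le hh τ hk' hf2 α)
      · rw [hU.scheme k hk' α]; ring
  refine (main j hj β).trans ?_
  unfold supBound
  gcongr
  exact hmono (τ.time_le hj)

/-- Supplies the function `w` of the accretivity estimate. For `a < 1` summability of `V` need not
make `φ(V) - φ(0)` summable, which is why that estimate asks only for decay of `w`. -/
theorem tendsto_phi (hφc : Continuous φ) {V : Idx N → ℝ} (hV : Summable V) :
    Tendsto (fun β => φ (V β) - φ 0) cofinite (𝓝 0) := by
  have := ((hφc.tendsto 0).comp hV.tendsto_cofinite_zero).sub_const (φ 0)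
  simpa using this

/-- One step of the weighted `ℓ¹` estimate. -/
theorem weighted_step (hU : IsSchemeSolution φ u₀ g S h τ U) (hh : 0 < h) (hS : S.IsSymm)
    (hφ : Monotone φ) (hφc : Continuous φ) (hg : IntegrableST T g)
    {X : Idx N → ℝ} (hX0 : ∀ β, 0 ≤ X β) (hX1 : ∀ β, X β ≤ 1)
    (hLX : Summable (fun β => |S.op X β|)) {s : Set (Space N)} (hs : MeasurableSet s)
    (hX : ∀ β, X β ≠ 0 → cell h β ⊆ s) {j : ℕ} (hj : j < τ.J) :
    h ^ N * ∑' β, |U (j + 1) β| * X β ≤ h ^ N * ∑' β, |U j β| * X β +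
      (∫ t in τ.time j..τ.time (j + 1), spaceNorm (fun x t => s.indicator (fun y => g y t) x) t) +
      τ.step j * (h ^ N * ∑' β, |φ (U (j + 1) β) - φ 0| * |S.op X β|) := by
  have hp := pow_pos hh N
  have hst := (τ.time_lt j hj).le
  have hint : Integrable (stepSource τ g j) := hg.integrable_intervalIntegral (τ.time_nonneg hj.le) hst (τ.time_le hj)
  have hsrc := summable_and_tsum_abs_initialAverage_mul_le hh hint hX0 hX1 hs hX
  have hsa := summable_abs_initialAverage hh hint
  have h1 := hU.summable j hj.le
  have h2 := hU.summable (j + 1) hj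
  have mulX : ∀ {q : Idx N → ℝ}, Summable (fun β => |q β|) → Summable (fun β => |q β| * X β) :=
    fun hq => Summable.of_nonneg_of_le (fun β => mul_nonneg (abs_nonneg _) (hX0 β))
      (fun β => mul_le_of_le_one_right (abs_nonneg _) (hX1 β)) hq
  -- By monotonicity `φ(U) - φ(0)` has the sign of `U`, so the solution can be compared with zero
  -- even when `φ(0) ≠ 0`.
  have hacc := Stencil.weighted_accretive hS (d := U (j + 1))
    (f := fun β => U j β + initialAverage h (stepSource τ g j) β)
    (w := fun β => φ (U (j + 1) β) - φ 0) (X := X) (C := 1) (τ.step_pos hj).le h2.of_abs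
    (h1.of_abs.add hsa.of_abs) (tendsto_phi hφc h2.of_abs)
    (fun β => by
      rcases le_total 0 (U (j + 1) β) with h0 | h0
      · exact mul_nonneg h0 (sub_nonneg.2 (hφ h0))
      · exact mul_nonneg_of_nonpos_of_nonpos h0 (sub_nonpos.2 (hφ h0)))
    (fun β h0 => by simp [h0]) hX0 hX1 hLX
    (fun β => by
      rw [Stencil.op_sub_const, hU.scheme j hj β, step_mul_sourceAverage hg h τ hj β]; ring)
  have h3 : ∑' β, |U j β + initialAverage h (stepSource τ g j) β| * X β ≤
      ∑' β, |U j β| * X β + ∑' β, |initialAverage h (stepSource τ g j) β| * X β := by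
    rw [← (mulX h1).tsum_add (mulX hsa)]
    refine (mulX (Summable.abs (h1.of_abs.add hsa.of_abs))).tsum_le_tsum (fun β => ?_)
      ((mulX h1).add (mulX hsa))
    rw [← add_mul]
    exact mul_le_mul_of_nonneg_right (abs_add_le _ _) (hX0 β)
  have h4 : ∫ x in s, |stepSource τ g j x| ≤ ∫ t in τ.time j..τ.time (j + 1),
      spaceNorm (fun x t => s.indicator (fun y => g y t) x) t := by
    refine le_trans (le_of_eq ?_) ((hg.indicator hs).integral_abs_intervalIntegral_le
      (τ.time_nonneg hj.le) hst (τ.time_le hj))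
    rw [← integral_indicator hs]
    refine integral_congr_ae (Eventually.of_forall fun x => ?_)
    by_cases hx : x ∈ s
    · simp [hx, stepSource]
    · simp [hx]
  have h5 := mul_le_mul_of_nonneg_left (hacc.trans (add_le_add_left h3 _)) hp.le
  have h6 := hsrc.2.trans h4
  nlinarith

/-- The weighted `ℓ¹` estimate. -/
theorem weighted_bound (hU : IsSchemeSolution φ u₀ g S h τ U) (hh : 0 < h) (hS : S.IsSymm)
    (hT : 0 ≤ T) (hφ : Monotone φ) (hφc : Continuous φ) (hu₀ : Integrable u₀)
    (hg : IntegrableST T g)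
    {X : Idx N → ℝ} (hX0 : ∀ β, 0 ≤ X β) (hX1 : ∀ β, X β ≤ 1)
    (hLX : Summable (fun β => |S.op X β|)) {s : Set (Space N)} (hs : MeasurableSet s)
    (hX : ∀ β, X β ≠ 0 → cell h β ⊆ s) {E : ℝ} (hE0 : 0 ≤ E)
    (hE : ∀ j < τ.J, h ^ N * ∑' β, |φ (U (j + 1) β) - φ 0| * |S.op X β| ≤ E)
    {j : ℕ} (hj : j ≤ τ.J) :
    h ^ N * ∑' β, |U j β| * X β ≤ (∫ x in s, |u₀ x|) +
      (∫ t in 0..T, spaceNorm (fun x t => s.indicator (fun y => g y t) x) t) + T * E := by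
  have hb := (hg.indicator hs).intervalIntegrable_spaceNorm hT
  have h1 := τ.le_of_increment_le (A := fun j => h ^ N * ∑' β, |U j β| * X β) hb
    (fun j hj => (hU.weighted_step hh hS hφ hφc hg hX0 hX1 hLX hs hX hj).trans
      (add_le_add_right (mul_le_mul_of_nonneg_left (hE j hj) (τ.step_pos hj).le) _)) hj
  refine h1.trans (add_le_add (add_le_add ?_ ?_) ?_)
  · simp_rw [hU.initial]
    exact (summable_and_tsum_abs_initialAverage_mul_le hh hu₀ hX0 hX1 hs hX).2
  · exact intervalIntegral.integral_mono_interval le_rfl (τ.time_nonneg hj) (τ.time_le hj)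
      (Eventually.of_forall fun t => spaceNorm_nonneg _ t) hb
  · exact mul_le_mul_of_nonneg_right (τ.time_le hj) hE0

/-- The `ℓ¹` bound. -/
theorem tsum_abs_le (hU : IsSchemeSolution φ u₀ g S h τ U) (hh : 0 < h) (hS : S.IsSymm)
    (hT : 0 ≤ T) (hφ : Monotone φ) (hφc : Continuous φ) (hu₀ : Integrable u₀)
    (hg : IntegrableST T g) {j : ℕ} (hj : j ≤ τ.J) :
    h ^ N * ∑' β, |U j β| ≤ (∫ x, |u₀ x|) + ∫ t in 0..T, spaceNorm g t := by
  -- The operator annihilates the constant weight, so the weighted estimate has no error term here.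
  have hop : ∀ β, S.op (fun _ => (1 : ℝ)) β = 0 := fun β => by simp [Stencil.op]
  have := hU.weighted_bound hh hS hT hφ hφc hu₀ hg (X := fun _ => 1) (fun _ => zero_le_one)
    (fun _ => le_rfl) (by simp [hop]) MeasurableSet.univ (by simp) (E := 0) le_rfl
    (by simp [hop]) hj
  simpa using this

/-- The `ℓ¹` contraction between a solution and its translate. -/
theorem tsum_abs_translate_sub_le (hU : IsSchemeSolution φ u₀ g S h τ U) (hh : 0 < h)
    (hS : S.IsSymm) (hT : 0 ≤ T) (hφ : Monotone φ) (hφc : Continuous φ) (hu₀ : Integrable u₀)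
    (hg : IntegrableST T g) (γ : Idx N) {j : ℕ} (hj : j ≤ τ.J) :
    h ^ N * ∑' β, |U j (β + γ) - U j β| ≤ (∫ x, |u₀ (x + gridPoint h γ) - u₀ x|) +
      ∫ t in 0..T, spaceNorm (fun x t => g (x + gridPoint h γ) t - g x t) t := by
  have hp := pow_pos hh N
  have hgs := (hg.comp_add_right (gridPoint h γ)).sub hg
  have hb := hgs.intervalIntegrable_spaceNorm hT
  have hshift : ∀ {V : Idx N → ℝ}, Summable V → Summable (fun β => V (β + γ)) := fun hV =>
    (Equiv.addRight γ).summable_iff.2 hV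
  have step : ∀ j < τ.J, h ^ N * ∑' β, |U (j + 1) (β + γ) - U (j + 1) β| ≤
      h ^ N * ∑' β, |U j (β + γ) - U j β| + (∫ t in τ.time j..τ.time (j + 1),
        spaceNorm (fun x t => g (x + gridPoint h γ) t - g x t) t) + τ.step j * 0 := by
    intro j hj
    have hst := (τ.time_lt j hj).le
    have hint : Integrable (stepSource τ g j) := hg.integrable_intervalIntegral (τ.time_nonneg hj.le) hst (τ.time_le hj)
    have hsa := (summable_abs_initialAverage hh hint).of_abs
    have h1 := (hU.summable j hj.le).of_abs
    have h2 := (hU.summable (j + 1) hj).of_abs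
    set w : Idx N → ℝ := fun β => φ (U (j + 1) β) - φ 0 with hw
    have hw0 : Tendsto w cofinite (𝓝 0) := tendsto_phi hφc h2
    obtain ⟨C, hC⟩ := Stencil.exists_abs_le_of_tendsto hw0
    have hop : ∀ β, S.op (fun _ => (1 : ℝ)) β = 0 := fun β => by simp [Stencil.op]
    have hd1 := (hshift h1).sub h1
    have hd2 := (hshift hsa).sub hsa
    -- The operator commutes with grid translations, so the translate solves the scheme with
    -- translated data; the difference `w(· + γ) - w` has the sign of `U(· + γ) - U` by
    -- monotonicity.
    have hacc := Stencil.weighted_accretive hS (d := fun β => U (j + 1) (β + γ) - U (j + 1) β)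
      (f := fun β => (U j (β + γ) - U j β) + (initialAverage h (stepSource τ g j) (β + γ) -
        initialAverage h (stepSource τ g j) β))
      (w := fun β => w (β + γ) - w β) (X := fun _ => 1) (C := 1) (τ.step_pos hj).le
      ((hshift h2).sub h2) (hd1.add hd2)
      (by
        have e : Tendsto (fun β => w (β + γ)) cofinite (𝓝 0) :=
          hw0.comp (add_left_injective γ).tendsto_cofinite
        simpa using e.sub hw0)
      (fun β => by
        simp only [hw]
        rcases le_total (U (j + 1) β) (U (j + 1) (β + γ)) with h0 | h0
        · exact mul_nonneg (sub_nonneg.2 h0) (by linarith [hφ h0])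
        · exact mul_nonneg_of_nonpos_of_nonpos (sub_nonpos.2 h0) (by linarith [hφ h0]))
      (fun β h0 => by simp [hw, sub_eq_zero.1 h0]) (fun _ => zero_le_one) (fun _ => le_rfl)
      (by simp [hop])
      (fun β => by
        rw [S.op_sub (fun β => hC (β + γ)) hC, Stencil.op_comp_add, Stencil.op_sub_const,
          Stencil.op_sub_const, hU.scheme j hj β, hU.scheme j hj (β + γ),
          step_mul_sourceAverage hg h τ hj β, step_mul_sourceAverage hg h τ hj (β + γ)]
        ring)
    simp only [mul_one, hop, abs_zero, mul_zero, tsum_zero, add_zero] at hacc ⊢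
    have h3 := hacc.trans ((hd1.add hd2).abs.tsum_le_tsum (fun β => abs_add_le _ _)
      (hd1.abs.add hd2.abs))
    rw [hd1.abs.tsum_add hd2.abs] at h3
    have h4 := mul_le_mul_of_nonneg_left h3 hp.le
    rw [mul_add] at h4
    refine h4.trans (add_le_add le_rfl ?_)
    refine (tsum_abs_initialAverage_translate_sub_le hh hint γ).trans ?_
    refine le_trans (le_of_eq ?_) (hgs.integral_abs_intervalIntegral_le (τ.time_nonneg hj.le) hst
      (τ.time_le hj))
    have hae : ∀ᵐ x, IntervalIntegrable (g x) volume (τ.time j) (τ.time (j + 1)) := by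
      have := (hg.restrict (τ.time_nonneg hj.le) (τ.time_le hj)).prod_right_ae
      filter_upwards [this] with x hx
      rwa [intervalIntegrable_iff_integrableOn_Ioc_of_le hst]
    have hae' : ∀ᵐ x, IntervalIntegrable (g (x + gridPoint h γ)) volume (τ.time j)
        (τ.time (j + 1)) :=
      (measurePreserving_add_right volume (gridPoint h γ)).quasiMeasurePreserving.ae hae
    refine integral_congr_ae ?_
    filter_upwards [hae, hae'] with x hx hx'
    rw [intervalIntegral.integral_sub hx' hx]
    rfl
  have h1 := τ.le_of_increment_le (A := fun j => h ^ N * ∑' β, |U j (β + γ) - U j β|) hb step hj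
  rw [mul_zero, add_zero] at h1
  refine h1.trans (add_le_add ?_ ?_)
  · simp_rw [hU.initial]
    exact tsum_abs_initialAverage_translate_sub_le hh hu₀ γ
  · exact intervalIntegral.integral_mono_interval le_rfl (τ.time_nonneg hj) (τ.time_le hj)
      (Eventually.of_forall fun t => spaceNorm_nonneg _ t) hb

end IsSchemeSolution

/-! ### Test functions under the discrete operator, and the tail weights. -/

/-- Second differences of a compactly supported `C²` function are bounded by
`C min(|z|², 1)`, both uniformly and in `L¹`. -/
theorem exists_second_difference_bound {θ : Space N → ℝ} (hθ : ContDiff ℝ 2 θ)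
    (hc : HasCompactSupport θ) : ∃ C : ℝ, 0 ≤ C ∧
      (∀ z x, |θ (x + z) + θ (x - z) - 2 * θ x| ≤ C * min (‖z‖ ^ 2) 1) ∧
      ∀ z, ∫ x, |θ (x + z) + θ (x - z) - 2 * θ x| ≤ C * min (‖z‖ ^ 2) 1 := by
  have hcont := hθ.continuous
  have hdiff : Differentiable ℝ θ := hθ.differentiable two_ne_zero
  obtain ⟨K, hK⟩ : ∃ K, LipschitzWith K (fderiv ℝ θ) :=
    ContDiff.lipschitzWith_of_hasCompactSupport (hc.fderiv ℝ)
      (hθ.fderiv_right (m := 1) (by norm_num)) one_ne_zero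
  obtain ⟨B, hB⟩ := hcont.bounded_above_of_compact_support hc
  have hB0 : 0 ≤ B := (norm_nonneg _).trans (hB 0)
  -- The derivative is Lipschitz, so the first-order remainder is quadratic. In the second
  -- difference the linear terms at `z` and `-z` cancel.
  have taylor : ∀ x z, |θ (x + z) - θ x - fderiv ℝ θ x z| ≤ K * ‖z‖ ^ 2 := fun x z => by
    have h := (convex_closedBall x ‖z‖).norm_image_sub_le_of_norm_fderiv_le' (𝕜 := ℝ) (f := θ)
      (φ := fderiv ℝ θ x) (C := K * ‖z‖) (x := x) (y := x + z) (fun y _ => hdiff y)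
      (fun y hy => by
        rw [← dist_eq_norm]
        refine (hK.dist_le_mul y x).trans ?_
        gcongr
        exact hy) (Metric.mem_closedBall_self (norm_nonneg _)) (by simp)
    rw [add_sub_cancel_left, Real.norm_eq_abs] at h
    exact h.trans_eq (by ring)
  set D : Space N → Space N → ℝ := fun z x => θ (x + z) + θ (x - z) - 2 * θ x with hD
  have hD1 : ∀ z x, |D z x| ≤ 2 * K * ‖z‖ ^ 2 := fun z x => by
    have h1 := taylor x z
    have h2 := taylor x (-z)
    rw [norm_neg, map_neg, ← sub_eq_add_neg] at h2
    have e : D z x = (θ (x + z) - θ x - fderiv ℝ θ x z) +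
        (θ (x - z) - θ x - -fderiv ℝ θ x z) := by simp only [hD]; ring
    rw [e]
    refine (abs_add_le _ _).trans ?_
    linarith
  have hD2 : ∀ z x, |D z x| ≤ 4 * B := fun z x => by
    have h1 := hB (x + z)
    have h2 := hB (x - z)
    have h3 := hB x
    rw [Real.norm_eq_abs, abs_le] at h1 h2 h3
    simp only [hD]
    rw [abs_le]
    constructor <;> linarith
  have hint : Integrable θ := hcont.integrable_of_hasCompactSupport hc
  have hDint : ∀ z, Integrable (D z) := fun z =>
    ((hint.comp_add_right z).add (hint.comp_sub_right z)).sub (hint.const_mul 2)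
  obtain ⟨r, hr⟩ := hc.isCompact.isBounded.subset_closedBall 0
  have hz : ∀ x, r < ‖x‖ → θ x = 0 := fun x hx => by
    by_contra hne
    have := hr (subset_tsupport _ hne)
    rw [mem_closedBall_zero_iff] at this
    linarith
  set V := volume.real (Metric.closedBall (0 : Space N) (r + 1)) with hV
  set I := ∫ x, |θ x| with hI
  have hV0 : 0 ≤ V := measureReal_nonneg
  have hI0 : 0 ≤ I := integral_nonneg fun _ => abs_nonneg _
  have hKB : (0 : ℝ) ≤ 2 * K + 4 * B := by positivity
  -- The three summands serve the uniform bound, the `L¹` bound for `‖z‖ ≤ 1`, where the second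
  -- difference lives on a ball of volume `V`, and the `L¹` bound for `‖z‖ ≥ 1`, where the triangle
  -- inequality gives `4 I`.
  refine ⟨(2 * K + 4 * B) + (2 * K + 4 * B) * V + 4 * I, by positivity, fun z x => ?_,
    fun z => ?_⟩
  · have hm : 0 ≤ min (‖z‖ ^ 2) 1 := by positivity
    have h1 : |D z x| ≤ (2 * K + 4 * B) * min (‖z‖ ^ 2) 1 := by
      rcases le_total (‖z‖ ^ 2) 1 with h | h
      · rw [min_eq_left h]
        nlinarith [hD1 z x, sq_nonneg ‖z‖]
      · rw [min_eq_right h]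
        linarith [hD2 z x, K.coe_nonneg]
    refine h1.trans (mul_le_mul_of_nonneg_right ?_ hm)
    nlinarith [mul_nonneg hKB hV0]
  · rcases le_total ‖z‖ 1 with h | h
    · have h' : ‖z‖ ^ 2 ≤ 1 := pow_le_one₀ (norm_nonneg _) h
      rw [min_eq_left h']
      have hzero : ∀ x ∉ Metric.closedBall (0 : Space N) (r + 1), |D z x| = 0 := fun x hx => by
        rw [mem_closedBall_zero_iff, not_le] at hx
        have h1 : ‖x‖ ≤ ‖x + z‖ + ‖z‖ := by simpa using norm_sub_le (x + z) z
        have h2 : ‖x‖ ≤ ‖x - z‖ + ‖z‖ := by simpa using norm_add_le (x - z) z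
        simp only [hD]
        rw [hz (x + z) (by linarith), hz (x - z) (by linarith), hz x (by linarith)]
        simp
      rw [← setIntegral_eq_integral_of_forall_compl_eq_zero hzero]
      have h3 : ‖∫ x in Metric.closedBall (0 : Space N) (r + 1), |D z x|‖ ≤
          2 * K * ‖z‖ ^ 2 * V :=
        norm_setIntegral_le_of_norm_le_const measure_closedBall_lt_top fun x _ => by
          rw [Real.norm_eq_abs, abs_abs]; exact hD1 z x
      refine (le_abs_self _).trans (h3.trans ?_)
      have : 2 * K * V ≤ (2 * K + 4 * B) + (2 * K + 4 * B) * V + 4 * I := by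
        nlinarith [mul_nonneg hB0 hV0]
      nlinarith [mul_le_mul_of_nonneg_right this (sq_nonneg ‖z‖)]
    · have h' : 1 ≤ ‖z‖ ^ 2 := one_le_pow₀ h
      rw [min_eq_right h', mul_one]
      have h4 : ∫ x, |D z x| ≤ ∫ x, (|θ (x + z)| + |θ (x - z)| + 2 * |θ x|) := by
        refine integral_mono (hDint z).abs (((hint.comp_add_right z).abs.add
          (hint.comp_sub_right z).abs).add (hint.abs.const_mul 2)) fun x => ?_
        simp only [hD]
        refine (abs_sub _ _).trans (add_le_add (abs_add_le _ _) ?_)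
        rw [abs_mul, abs_two]
      have h5 : Integrable (fun x => |θ (x + z)| + |θ (x - z)|) :=
        (hint.comp_add_right z).abs.add (hint.comp_sub_right z).abs
      rw [integral_add h5 (hint.abs.const_mul 2), integral_add (hint.comp_add_right z).abs
        (hint.comp_sub_right z).abs, integral_const_mul,
        integral_add_right_eq_self (fun x => |θ x|) z,
        integral_sub_right_eq_self (fun x => |θ x|) z] at h4
      nlinarith [mul_nonneg hKB hV0]

/-- The action of the discrete operator on the cell averages of a dilated test function. -/
theorem op_initialAverage_dilation_bound {θ : Space N → ℝ} (hθ : Continuous θ)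
    (hc : HasCompactSupport θ) {C : ℝ}
    (h1 : ∀ z x, |θ (x + z) + θ (x - z) - 2 * θ x| ≤ C * min (‖z‖ ^ 2) 1)
    (h2 : ∀ z, ∫ x, |θ (x + z) + θ (x - z) - 2 * θ x| ≤ C * min (‖z‖ ^ 2) 1)
    (hC : 0 ≤ C) {S : Stencil N} (hS : S.IsSymm) {h R : ℝ} (hh : 0 < h) (hR : 0 < R) :
    (∀ β, |S.op (initialAverage h fun x => θ (R⁻¹ • x)) β| ≤ C * S.truncMoment h R) ∧
      Summable (fun β => |S.op (initialAverage h fun x => θ (R⁻¹ • x)) β|) ∧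
      h ^ N * ∑' β, |S.op (initialAverage h fun x => θ (R⁻¹ • x)) β| ≤
        C * R ^ N * S.truncMoment h R := by
  have hp := pow_pos hh N
  set f : Space N → ℝ := fun x => θ (R⁻¹ • x) with hf
  set ψ := initialAverage h f with hψ
  have hRi : R⁻¹ ≠ 0 := inv_ne_zero hR.ne'
  have hfc : Continuous f := hθ.comp (continuous_const_smul _)
  have hfi : Integrable f := (hθ.integrable_of_hasCompactSupport hc).comp_smul hRi
  obtain ⟨B, hB⟩ := hθ.bounded_above_of_compact_support hc
  have hψB : ∀ β, |ψ β| ≤ B := abs_initialAverage_le hh (Eventually.of_forall fun x => hB _)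
  set D : Space N → Space N → ℝ := fun z x => f (x + z) + f (x - z) - 2 * f x with hD
  have hDint : ∀ z, Integrable (D z) := fun z =>
    ((hfi.comp_add_right z).add (hfi.comp_sub_right z)).sub (hfi.const_mul 2)
  have hDθ : ∀ z x, D z x = θ (R⁻¹ • x + R⁻¹ • z) + θ (R⁻¹ • x - R⁻¹ • z) - 2 * θ (R⁻¹ • x) :=
    fun z x => by simp only [hD, hf, smul_add, smul_sub]
  have hnorm : ∀ z : Space N, ‖R⁻¹ • z‖ = ‖z‖ / R := fun z => by
    rw [norm_smul, norm_inv, Real.norm_of_nonneg hR.le, inv_mul_eq_div]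
  -- Dilating by `R` turns `z` into `z / R`, and integration adds the Jacobian `R^N`. Summed against
  -- the weights, `min((|z|/R)², 1)` becomes the truncated moment at scale `R`.
  have hDsup : ∀ z x, |D z x| ≤ C * min ((‖z‖ / R) ^ 2) 1 := fun z x => by
    rw [hDθ, ← hnorm]; exact h1 _ _
  have hDL1 : ∀ z, ∫ x, |D z x| ≤ R ^ N * (C * min ((‖z‖ / R) ^ 2) 1) := fun z => by
    simp_rw [hDθ]
    have := Measure.integral_comp_inv_smul_of_nonneg (volume : Measure (Space N))
      (fun y => |θ (y + R⁻¹ • z) + θ (y - R⁻¹ • z) - 2 * θ y|) hR.le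
    rw [this, finrank_euclideanSpace_fin, smul_eq_mul, ← hnorm]
    gcongr
    exact h2 _
  have hdiff : ∀ γ β, ψ (β + γ) + ψ (β - γ) - 2 * ψ β =
      initialAverage h (D (gridPoint h γ)) β := fun γ β => by
    have i1 := hfi.comp_add_right (gridPoint h γ)
    have i2 := hfi.comp_sub_right (gridPoint h γ)
    have e2 : initialAverage h (fun x => f (x - gridPoint h γ)) β = ψ (β - γ) := by
      have := initialAverage_translate hh f (-γ) β
      rw [gridPoint_neg] at this
      simpa only [← sub_eq_add_neg] using this
    simp only [hD]
    have i3 : Integrable (fun x => f (x + gridPoint h γ) + f (x - gridPoint h γ)) := i1.add i2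
    rw [initialAverage_sub i3 (hfi.const_mul 2), initialAverage_add i1 i2,
      initialAverage_const_mul, initialAverage_translate hh, e2]
  have hw : ∀ γ : {γ : Idx N // γ ≠ 0}, 0 ≤ S.weight γ := fun γ => (hS γ γ.2).2
  have hQ := S.summable_truncMoment h R
  refine ⟨fun β => ?_, ?_⟩
  · rw [Stencil.op_eq_half_second_difference hS hψB, abs_mul,
      abs_of_pos (by norm_num : (0 : ℝ) < 1 / 2)]
    have h3 : ∀ γ : {γ : Idx N // γ ≠ 0}, ‖(ψ (β + S.offset γ) + ψ (β - S.offset γ) - 2 * ψ β) *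
        S.weight γ‖ ≤ C * (min ((‖gridPoint h (S.offset γ)‖ / R) ^ 2) 1 * S.weight γ) := by
      intro γ
      rw [norm_mul, Real.norm_of_nonneg (hw γ), ← mul_assoc, hdiff]
      exact mul_le_mul_of_nonneg_right
        (abs_initialAverage_le hh (Eventually.of_forall (hDsup _)) β) (hw γ)
    have h4 := tsum_of_norm_bounded (hQ.mul_left C).hasSum h3
    rw [tsum_mul_left] at h4
    change ‖_‖ ≤ C * S.truncMoment h R at h4
    rw [Real.norm_eq_abs] at h4
    linarith [abs_nonneg (∑' γ : {γ : Idx N // γ ≠ 0},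
      (ψ (β + S.offset γ) + ψ (β - S.offset γ) - 2 * ψ β) * S.weight γ)]
  · have h3 := Stencil.summable_abs_op_and_tsum_le hS hψB
      (K := fun γ => (h ^ N)⁻¹ * (C * R ^ N) * min ((‖gridPoint h (S.offset γ)‖ / R) ^ 2) 1)
      (fun γ => by
        simp_rw [hdiff]
        exact summable_abs_initialAverage hh (hDint _))
      (fun γ => by
        simp_rw [hdiff, mul_assoc]
        rw [le_inv_mul_iff₀ hp]
        refine (tsum_abs_initialAverage_le hh (hDint _)).trans ((hDL1 _).trans_eq ?_)
        ring)
      (by simp_rw [mul_assoc ((h ^ N)⁻¹ * (C * R ^ N))]; exact hQ.mul_left _)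
    refine ⟨h3.1, ?_⟩
    have h4 := h3.2
    simp_rw [mul_assoc ((h ^ N)⁻¹ * (C * R ^ N))] at h4
    rw [tsum_mul_left] at h4
    change _ ≤ 1 / 2 * ((h ^ N)⁻¹ * (C * R ^ N) * S.truncMoment h R) at h4
    have h5 := mul_le_mul_of_nonneg_left h4 hp.le
    have hQ0 : 0 ≤ S.truncMoment h R := tsum_nonneg fun γ => mul_nonneg (by positivity) (hw γ)
    have h6 : h ^ N * (1 / 2 * ((h ^ N)⁻¹ * (C * R ^ N) * S.truncMoment h R)) =
        1 / 2 * (C * R ^ N * S.truncMoment h R) := by field_simp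
    rw [h6] at h5
    have h7 : 0 ≤ C * R ^ N * S.truncMoment h R := by positivity
    linarith

/-- A smooth cutoff function: `1` on the unit ball and `0` outside the ball of radius `2`. -/
noncomputable def cutoff (N : ℕ) : ContDiffBump (0 : Space N) where
  rIn := 1
  rOut := 2
  rIn_pos := one_pos
  rIn_lt_rOut := one_lt_two

/-- The weight `1 - (average of the cutoff at scale R)`, which is `1` far away. -/
noncomputable def tailWeight (h R : ℝ) (β : Idx N) : ℝ :=
  1 - initialAverage h (fun x => cutoff N (R⁻¹ • x)) β

theorem initialAverage_congr {h : ℝ} (hh : 0 < h) {f g : Space N → ℝ} {β : Idx N}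
    (hfg : ∀ x ∈ cell h β, f x = g x) : initialAverage h f β = initialAverage h g β := by
  unfold initialAverage
  rw [setIntegral_congr_fun (measurableSet_cell hh β) hfg]

theorem initialAverage_const {h : ℝ} (hh : 0 < h) (c : ℝ) (β : Idx N) :
    initialAverage h (fun _ => c) β = c := by
  have hp := pow_pos hh N
  unfold initialAverage
  rw [setIntegral_const, Measure.real, volume_cell hh, ENNReal.toReal_ofReal hp.le]
  simp only [smul_eq_mul]
  field_simp

theorem tailWeight_mem {h : ℝ} (hh : 0 < h) (R : ℝ) (β : Idx N) :
    0 ≤ tailWeight h R β ∧ tailWeight h R β ≤ 1 := by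
  have h1 : |initialAverage h (fun x => cutoff N (R⁻¹ • x)) β| ≤ 1 :=
    abs_initialAverage_le hh (Eventually.of_forall fun x => by
      rw [abs_of_nonneg (cutoff N).nonneg]; exact (cutoff N).le_one) β
  have h2 : 0 ≤ initialAverage h (fun x => cutoff N (R⁻¹ • x)) β :=
    mul_nonneg (by positivity) (integral_nonneg fun x => (cutoff N).nonneg)
  rw [abs_of_nonneg h2] at h1
  unfold tailWeight
  constructor <;> linarith

/-- Since `h < 1`, points of one cell are at distance at most `N`. A cell that meets the ball of
radius `R - N` therefore lies where the dilated cutoff equals `1`. -/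
theorem cell_subset_of_tailWeight_ne_zero {h R : ℝ} (hh : h ∈ Ioo (0 : ℝ) 1) (hR : 0 < R)
    {β : Idx N} (hβ : tailWeight h R β ≠ 0) : cell h β ⊆ {x | R - N ≤ ‖x‖} := by
  intro x hx
  show R - N ≤ ‖x‖
  by_contra! hcon
  refine hβ ?_
  unfold tailWeight
  rw [initialAverage_congr hh.1 (g := fun _ => 1), initialAverage_const hh.1, sub_self]
  intro y hy
  refine (cutoff N).one_of_mem_closedBall ?_
  rw [mem_closedBall_zero_iff, norm_smul, norm_inv, Real.norm_of_nonneg hR.le]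
  have h1 := norm_sub_le_of_mem_cell hh.1.le hy hx
  have h2 : ‖y‖ ≤ ‖y - x‖ + ‖x‖ := by simpa using norm_add_le (y - x) x
  have h3 : (N : ℝ) * h ≤ N := mul_le_of_le_one_right (Nat.cast_nonneg N) hh.2.le
  show R⁻¹ * ‖y‖ ≤ 1
  rw [inv_mul_le_iff₀ hR]
  linarith

theorem tailWeight_eq_one {h R : ℝ} (hh : h ∈ Ioo (0 : ℝ) 1) (hR : 0 < R) {β : Idx N}
    {x : Space N} (hx : x ∈ cell h β) (hxR : 2 * R + N ≤ ‖x‖) : tailWeight h R β = 1 := by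
  unfold tailWeight
  rw [initialAverage_congr hh.1 (g := fun _ => 0), initialAverage_const hh.1, sub_zero]
  intro y hy
  refine (cutoff N).zero_of_le_dist ?_
  rw [dist_zero_right, norm_smul, norm_inv, Real.norm_of_nonneg hR.le]
  have h1 := norm_sub_le_of_mem_cell hh.1.le hx hy
  have h2 : ‖x‖ ≤ ‖x - y‖ + ‖y‖ := by simpa using norm_add_le (x - y) y
  have h3 : (N : ℝ) * h ≤ N := mul_le_of_le_one_right (Nat.cast_nonneg N) hh.2.le
  show 2 ≤ R⁻¹ * ‖y‖
  rw [le_inv_mul_iff₀ hR]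
  linarith

/-- Below the level `lam` the power is at most `lam ^ a`; above it `u ^ (a - 1) ≤ lam ^ (a - 1)`.
This makes the Hölder bound on `φ` affine in `|U|`, with a free parameter. -/
theorem rpow_le_add_mul {u lam a : ℝ} (hu : 0 ≤ u) (hl : 0 < lam) (ha0 : 0 < a) (ha1 : a ≤ 1) :
    u ^ a ≤ lam ^ (a - 1) * u + lam ^ a := by
  rcases le_total u lam with h | h
  · have h1 := Real.rpow_le_rpow hu h ha0.le
    have h2 : 0 ≤ lam ^ (a - 1) * u := by positivity
    linarith
  · have hu' : 0 < u := hl.trans_le h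
    have h1 : u ^ a = u ^ (a - 1) * u := by
      rw [Real.rpow_sub_one hu'.ne', div_mul_cancel₀ _ hu'.ne']
    have h2 := Real.rpow_le_rpow_of_nonpos hl h (by linarith : a - 1 ≤ 0)
    have h3 : 0 ≤ lam ^ a := by positivity
    rw [h1]
    nlinarith

/-! ### The tail estimate. -/

namespace IsSchemeSolution

variable {φ : ℝ → ℝ} {u₀ : Space N → ℝ} {g : Space N → ℝ → ℝ} {S : Stencil N} {h : ℝ}
  {τ : TimeGrid T} {U : ℕ → Idx N → ℝ}

/-- Uniform smallness of the tails. -/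
theorem tail_le (hU : IsSchemeSolution φ u₀ g S h τ U) (hh : h ∈ Ioo (0 : ℝ) 1) (hS : S.IsSymm)
    (hT : 0 ≤ T) (hφ : Monotone φ) (hφc : Continuous φ) (hu₀ : AssumptionU0 u₀)
    (hg : AssumptionG T g) {a H C Q α R : ℝ} (ha0 : 0 < a) (ha1 : a ≤ 1) (hH0 : 0 ≤ H)
    (hH : ∀ u, |u| ≤ supBound T u₀ g → |φ u - φ 0| ≤ H * |u| ^ a) (hC0 : 0 ≤ C)
    (hC1 : ∀ z x, |cutoff N (x + z) + cutoff N (x - z) - 2 * cutoff N x| ≤ C * min (‖z‖ ^ 2) 1)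
    (hC2 : ∀ z, ∫ x, |cutoff N (x + z) + cutoff N (x - z) - 2 * cutoff N x| ≤
      C * min (‖z‖ ^ 2) 1)
    (hQ : S.truncMoment h R ≤ Q * R ^ (-α)) (hR : 1 < R) {j : ℕ} (hj : j ≤ τ.J) :
    h ^ N * ∑' β, |U j β| * tailWeight h R β ≤ (∫ x in {x | R - N ≤ ‖x‖}, |u₀ x|) +
      (∫ t in 0..T, spaceNorm (fun x t => {x | R - N ≤ ‖x‖}.indicator (fun y => g y t) x) t) +
      T * (H * C * Q * ((∫ x, |u₀ x|) + (∫ t in 0..T, spaceNorm g t) + 1) *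
        R ^ (N * (1 - a) - α)) := by
  have hR0 : 0 < R := by linarith
  have hp := pow_pos hh.1 N
  have hu₀i : Integrable u₀ := memLp_one_iff_integrable.1 hu₀.memLp_one
  have hgi := hg.integrableST
  have hcc : HasCompactSupport (cutoff N : Space N → ℝ) := (cutoff N).hasCompactSupport
  obtain ⟨b1, b2, b3⟩ := op_initialAverage_dilation_bound (cutoff N).continuous hcc hC1 hC2 hC0 hS
    hh.1 hR0
  set ψ := initialAverage h fun x => cutoff N (R⁻¹ • x) with hψ
  have hopX : ∀ β, |S.op (tailWeight h R) β| = |S.op ψ β| := fun β => by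
    rw [← abs_neg (S.op ψ β), ← Stencil.op_const_sub S ψ 1]
    rfl
  set M₁ := (∫ x, |u₀ x|) + ∫ t in 0..T, spaceNorm g t with hM₁
  have hM₁0 : 0 ≤ M₁ := add_nonneg (integral_nonneg fun _ => abs_nonneg _)
    (intervalIntegral.integral_nonneg hT fun t _ => spaceNorm_nonneg _ t)
  set Q₀ := S.truncMoment h R with hQ₀
  have hQ00 : 0 ≤ Q₀ := tsum_nonneg fun γ => mul_nonneg (by positivity) (hS γ γ.2).2
  refine hU.weighted_bound hh.1 hS hT hφ hφc hu₀i hgi (fun β => (tailWeight_mem hh.1 R β).1)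
    (fun β => (tailWeight_mem hh.1 R β).2) (by simpa only [hopX] using b2)
    (measurableSet_le measurable_const measurable_norm)
    (fun β hβ => cell_subset_of_tailWeight_ne_zero hh hR0 hβ) ?_ (fun j hj => ?_) hj
  · have : 0 ≤ Q * R ^ (-α) := hQ00.trans hQ
    have hQ' : 0 ≤ Q := nonneg_of_mul_nonneg_left this (by positivity)
    positivity
  · have hsum := hU.summable (j + 1) hj
    have hl1 := hU.tsum_abs_le hh.1 hS hT hφ hφc hu₀i hgi (j := j + 1) hj
    -- This level balances the two contributions. The part linear in `|U|` meets the uniform bound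
    -- `C Q₀` of `|L X|` and gives `lam ^ (a - 1) * M₁`; the constant part meets its `ℓ¹` bound and
    -- gives `lam ^ a * R ^ N`. Both are multiples of `R^{N(1-a)}`, whence the factor `M₁ + 1`.
    set lam : ℝ := (R ^ N)⁻¹ with hlam
    have hlam0 : 0 < lam := by positivity
    have hpt : ∀ β, |φ (U (j + 1) β) - φ 0| * |S.op (tailWeight h R) β| ≤
        H * (lam ^ (a - 1) * (C * Q₀)) * |U (j + 1) β| + H * lam ^ a * |S.op ψ β| := fun β => by
      rw [hopX]
      have h1 := hH _ (hU.abs_le_supBound hh.1 hS hφ hu₀ hg (j := j + 1) hj β)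
      have h2 := rpow_le_add_mul (abs_nonneg (U (j + 1) β)) hlam0 ha0 ha1
      calc _ ≤ H * (lam ^ (a - 1) * |U (j + 1) β| + lam ^ a) * |S.op ψ β| := by
            gcongr
            exact h1.trans (mul_le_mul_of_nonneg_left h2 hH0)
        _ = H * (lam ^ (a - 1) * |S.op ψ β|) * |U (j + 1) β| + H * lam ^ a * |S.op ψ β| := by
            ring
        _ ≤ _ := by
            gcongr
            exact b1 β
    have hs1 := (hsum.mul_left (H * (lam ^ (a - 1) * (C * Q₀)))).add
      (b2.mul_left (H * lam ^ a))
    have hs2 := Summable.of_nonneg_of_le (fun β => by positivity) hpt hs1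
    have h3 := hs2.tsum_le_tsum hpt hs1
    rw [(hsum.mul_left (H * (lam ^ (a - 1) * (C * Q₀)))).tsum_add (b2.mul_left (H * lam ^ a)),
      tsum_mul_left, tsum_mul_left] at h3
    have hRN : (R ^ N : ℝ) = R ^ (N : ℝ) := (Real.rpow_natCast R N).symm
    have e1 : lam ^ (a - 1) = R ^ (N * (1 - a)) := by
      rw [hlam, hRN, ← Real.rpow_neg hR0.le, ← Real.rpow_mul hR0.le]
      congr 1; ring
    have e2 : lam ^ a * R ^ N = R ^ (N * (1 - a)) := by
      rw [hlam, hRN, ← Real.rpow_neg hR0.le, ← Real.rpow_mul hR0.le, ← Real.rpow_add hR0]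
      congr 1; ring
    calc _ ≤ h ^ N * (H * (lam ^ (a - 1) * (C * Q₀)) * ∑' β, |U (j + 1) β| +
          H * lam ^ a * ∑' β, |S.op ψ β|) := mul_le_mul_of_nonneg_left h3 hp.le
      _ = H * (lam ^ (a - 1) * (C * Q₀)) * (h ^ N * ∑' β, |U (j + 1) β|) +
          H * lam ^ a * (h ^ N * ∑' β, |S.op ψ β|) := by ring
      _ ≤ H * (lam ^ (a - 1) * (C * Q₀)) * M₁ + H * lam ^ a * (C * R ^ N * Q₀) := by
          gcongr
      _ = H * C * (M₁ + 1) * R ^ (N * (1 - a)) * Q₀ := by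
          rw [← e2, e1, ← e2]; ring
      _ ≤ H * C * (M₁ + 1) * R ^ (N * (1 - a)) * (Q * R ^ (-α)) := by
          gcongr
      _ = _ := by
          rw [sub_eq_add_neg (N * (1 - a)) α, Real.rpow_add hR0]; ring

end IsSchemeSolution

/-! ### Tails and translations of the data in `L¹`. -/

/-- The part of an integrable function outside large balls is small. -/
theorem tendsto_setIntegral_norm_ge {f : Space N → ℝ} (hf : Integrable f) (c : ℝ) :
    Tendsto (fun R : ℝ => ∫ x in {x | R - c ≤ ‖x‖}, |f x|) atTop (𝓝 0) := by
  have hm : ∀ R : ℝ, MeasurableSet {x : Space N | R - c ≤ ‖x‖} := fun R =>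
    measurableSet_le measurable_const measurable_norm
  simp_rw [← integral_indicator (hm _)]
  rw [← integral_zero (Space N) ℝ (μ := volume)]
  refine tendsto_integral_filter_of_dominated_convergence (fun x => |f x|)
    (Eventually.of_forall fun R => (hf.abs.indicator (hm R)).aestronglyMeasurable)
    (Eventually.of_forall fun R => Eventually.of_forall fun x => ?_) hf.abs
    (Eventually.of_forall fun x => ?_)
  · exact (norm_indicator_le_norm_self _ _).trans_eq (by simp)
  · refine tendsto_const_nhds.congr' ?_
    filter_upwards [eventually_gt_atTop (‖x‖ + c)] with R hR
    rw [indicator_of_notMem]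
    show ¬ (R - c ≤ ‖x‖)
    linarith

theorem tendsto_spaceNorm_norm_ge (hT : 0 ≤ T) {g : Space N → ℝ → ℝ} (hg : IntegrableST T g)
    (c : ℝ) :
    Tendsto (fun R : ℝ => ∫ t in 0..T,
      spaceNorm (fun x t => {x | R - c ≤ ‖x‖}.indicator (fun y => g y t) x) t) atTop (𝓝 0) := by
  have hm : ∀ R : ℝ, MeasurableSet {x : Space N | R - c ≤ ‖x‖} := fun R =>
    measurableSet_le measurable_const measurable_norm
  have e : ∀ R : ℝ, ∫ t in 0..T,
      spaceNorm (fun x t => {x | R - c ≤ ‖x‖}.indicator (fun y => g y t) x) t =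
      ∫ p, |{x : Space N | R - c ≤ ‖x‖}.indicator (fun y => g y p.2) p.1|
        ∂(volume.prod (volume.restrict (Ioc 0 T))) := fun R => by
    rw [intervalIntegral.integral_of_le hT]
    exact (integral_prod_symm _ (hg.indicator (hm R)).abs).symm
  simp_rw [e]
  have h0 : (0 : ℝ) = ∫ _p : Space N × ℝ, (0 : ℝ) ∂(volume.prod (volume.restrict (Ioc 0 T))) :=
    (integral_zero _ _).symm
  conv => arg 3; rw [h0]
  refine tendsto_integral_filter_of_dominated_convergence (fun p : Space N × ℝ => |g p.1 p.2|)
    (Eventually.of_forall fun R => (hg.indicator (hm R)).abs.aestronglyMeasurable)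
    (Eventually.of_forall fun R => Eventually.of_forall fun p => ?_) hg.abs
    (Eventually.of_forall fun p => ?_)
  · rw [Real.norm_eq_abs, abs_abs]
    exact norm_indicator_le_norm_self (fun y => g y p.2) p.1
  · refine tendsto_const_nhds.congr' ?_
    filter_upwards [eventually_gt_atTop (‖p.1‖ + c)] with R hR
    rw [indicator_of_notMem, abs_zero]
    show ¬ (R - c ≤ ‖p.1‖)
    linarith

/-- Continuity of translations in `L¹`. -/
theorem tendsto_integral_abs_translate_sub {E : Type*} [NormedAddCommGroup E] [NormedSpace ℝ E]
    [FiniteDimensional ℝ E] [MeasurableSpace E] [BorelSpace E] (μ : Measure E)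
    [μ.IsAddHaarMeasure] {f : E → ℝ} (hf : Integrable f μ) :
    Tendsto (fun ξ => ∫ x, |f (x + ξ) - f x| ∂μ) (𝓝 0) (𝓝 0) := by
  have hmem := memLp_one_iff_integrable.2 hf
  -- Translations depend continuously on `ξ` in the compact-open topology, and composition with
  -- measure-preserving maps is continuous in `L¹` for that topology.
  let G : E → C(E, E) := fun ξ => ⟨fun x => x + ξ, by fun_prop⟩
  have hG : Tendsto G (𝓝 0) (𝓝 (G 0)) := by
    have : Continuous G :=
      (ContinuousMap.mk (fun p : E × E => p.2 + p.1) (by fun_prop)).curry.continuous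
    exact this.tendsto 0
  have hmp : ∀ ξ, MeasurePreserving (G ξ) μ μ := fun ξ => measurePreserving_add_right μ ξ
  have h1 := (tendsto_const_nhds (x := hmem.toLp f)).compMeasurePreservingLp hG hmp (hmp 0)
    ENNReal.one_ne_top
  have h2 := (tendsto_iff_dist_tendsto_zero).1 h1
  refine h2.congr fun ξ => ?_
  rw [dist_eq_norm, L1.norm_eq_integral_norm]
  refine integral_congr_ae ?_
  have e1 : ∀ ξ, Lp.compMeasurePreserving (G ξ) (hmp ξ) (hmem.toLp f) =ᵐ[μ]
      fun x => f (x + ξ) := fun ξ => by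
    refine (Lp.coeFn_compMeasurePreserving _ (hmp ξ)).trans ?_
    exact (hmp ξ).quasiMeasurePreserving.ae_eq hmem.coeFn_toLp
  filter_upwards [Lp.coeFn_sub (Lp.compMeasurePreserving (G ξ) (hmp ξ) (hmem.toLp f))
    (Lp.compMeasurePreserving (G 0) (hmp 0) (hmem.toLp f)), e1 ξ, e1 0] with x h h' h''
  rw [h, Pi.sub_apply, h', h'', add_zero, Real.norm_eq_abs]

/-- Extended by zero in time, `g` is integrable on `ℝ^N × ℝ`, and the claim is continuity of
translations there along the vectors `(ξ, 0)`. -/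
theorem tendsto_spaceNorm_translate_sub (hT : 0 ≤ T) {g : Space N → ℝ → ℝ}
    (hg : IntegrableST T g) :
    Tendsto (fun ξ => ∫ t in 0..T, spaceNorm (fun x t => g (x + ξ) t - g x t) t) (𝓝 0)
      (𝓝 0) := by
  have hm : MeasurableSet ((univ : Set (Space N)) ×ˢ Ioc 0 T) :=
    MeasurableSet.univ.prod measurableSet_Ioc
  have e : volume.prod (volume.restrict (Ioc 0 T)) =
      (volume.prod volume : Measure (Space N × ℝ)).restrict (univ ×ˢ Ioc 0 T) := by
    rw [← Measure.prod_restrict, Measure.restrict_univ]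
  set f : Space N × ℝ → ℝ := (univ ×ˢ Ioc 0 T).indicator fun p => g p.1 p.2 with hf
  have hfi : Integrable f (volume.prod volume) := by
    rw [hf, integrable_indicator_iff hm, IntegrableOn, ← e]
    exact hg
  have h1 := tendsto_integral_abs_translate_sub _ hfi
  have h2 : Tendsto (fun ξ : Space N => (ξ, (0 : ℝ))) (𝓝 0) (𝓝 0) := by
    have : Continuous (fun ξ : Space N => (ξ, (0 : ℝ))) := by fun_prop
    exact this.tendsto 0
  refine (h1.comp h2).congr fun ξ => ?_
  rw [intervalIntegral.integral_of_le hT]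
  have h3 := integral_prod_symm _ ((hg.comp_add_right ξ).sub hg).abs
  refine Eq.trans ?_ h3
  rw [e, ← integral_indicator hm]
  refine integral_congr_ae (Eventually.of_forall fun p => ?_)
  by_cases hp : p.2 ∈ Ioc 0 T
  · simp [hf, indicator, hp]
  · simp [hf, indicator, hp]

/-! ### Piecewise linear interpolation in time. -/

namespace TimeGrid

variable (τ : TimeGrid T)

/-- The ramp which increases from `0` to `1` on the `j`-th time step. -/
noncomputable def ramp (j : ℕ) (t : ℝ) : ℝ := max 0 (min 1 ((t - τ.time j) / τ.step j))

/-- The piecewise linear interpolation in time of a sequence. -/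
noncomputable def interp {E : Type*} [AddCommGroup E] [Module ℝ E] (F : ℕ → E) (t : ℝ) : E :=
  F 0 + ∑ j ∈ Finset.range τ.J, τ.ramp j t • (F (j + 1) - F j)

theorem continuous_ramp (j : ℕ) : Continuous (τ.ramp j) := by
  unfold ramp
  fun_prop

theorem ramp_mem (j : ℕ) (t : ℝ) : τ.ramp j t ∈ Icc (0 : ℝ) 1 :=
  ⟨le_max_left _ _, max_le zero_le_one (min_le_left _ _)⟩

theorem ramp_mono {j : ℕ} (hj : j < τ.J) : Monotone (τ.ramp j) := fun s t hst => by
  have := (τ.step_pos hj).le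
  unfold ramp
  gcongr

theorem ramp_eq_zero {j : ℕ} (hj : j < τ.J) {t : ℝ} (ht : t ≤ τ.time j) : τ.ramp j t = 0 := by
  have h := τ.step_pos hj
  exact max_eq_left ((min_le_right _ _).trans (div_nonpos_of_nonpos_of_nonneg (by linarith) h.le))

theorem ramp_eq_one {j : ℕ} (hj : j < τ.J) {t : ℝ} (ht : τ.time (j + 1) ≤ t) :
    τ.ramp j t = 1 := by
  have h := τ.step_pos hj
  have h1 : 1 ≤ (t - τ.time j) / τ.step j := by
    rw [le_div_iff₀ h, step]; linarith
  rw [ramp, min_eq_left h1, max_eq_right zero_le_one]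

theorem ramp_of_mem {j : ℕ} (hj : j < τ.J) {t : ℝ} (ht : t ∈ Icc (τ.time j) (τ.time (j + 1))) :
    τ.ramp j t = (t - τ.time j) / τ.step j := by
  have h := τ.step_pos hj
  have h1 : (t - τ.time j) / τ.step j ≤ 1 := by
    rw [div_le_one h, step]; linarith [ht.2]
  have h2 : 0 ≤ (t - τ.time j) / τ.step j := div_nonneg (by linarith [ht.1]) h.le
  rw [ramp, min_eq_right h1, max_eq_right h2]

theorem exists_mem_Ioc {t : ℝ} (ht : t ∈ Ioc 0 T) :
    ∃ m < τ.J, t ∈ Ioc (τ.time m) (τ.time (m + 1)) := by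
  have h : ∃ n, t ≤ τ.time n := ⟨τ.J, by rw [τ.time_last]; exact ht.2⟩
  classical
  have h1 := Nat.find_spec h
  have h2 : Nat.find h ≤ τ.J := Nat.find_le (by rw [τ.time_last]; exact ht.2)
  have h3 : Nat.find h ≠ 0 := fun h0 => by
    rw [h0, τ.time_zero] at h1
    exact absurd ht.1 (not_lt.2 h1)
  obtain ⟨m, hm⟩ := Nat.exists_eq_succ_of_ne_zero h3
  rw [hm] at h1 h2
  refine ⟨m, h2, ?_, h1⟩
  by_contra! hcon
  have := Nat.find_min' h hcon
  omega

variable {E : Type*} [AddCommGroup E] [Module ℝ E]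

theorem interp_zero (F : ℕ → E) : τ.interp F 0 = F 0 := by
  unfold interp
  rw [Finset.sum_eq_zero, add_zero]
  intro j hj
  have hj' := Finset.mem_range.1 hj
  rw [τ.ramp_eq_zero hj' (τ.time_nonneg hj'.le), zero_smul]

/-- The ramps before `m` are complete and telescope to `F m - F 0`, and those after `m` have not
started. -/
theorem interp_of_mem (F : ℕ → E) {m : ℕ} (hm : m < τ.J) {t : ℝ}
    (ht : t ∈ Ioc (τ.time m) (τ.time (m + 1))) :
    τ.interp F t = F m + ((t - τ.time m) / τ.step m) • (F (m + 1) - F m) := by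
  unfold interp
  rw [← Finset.sum_subset (Finset.range_subset_range.2 (Nat.succ_le_of_lt hm)),
    Finset.sum_range_succ, τ.ramp_of_mem hm (Ioc_subset_Icc_self ht),
    Finset.sum_congr rfl (g := fun j => F (j + 1) - F j), Finset.sum_range_sub]
  · abel
  · intro j hj
    have hj' := Finset.mem_range.1 hj
    rw [τ.ramp_eq_one (by omega)
      ((τ.time_mono (Nat.succ_le_of_lt hj') hm.le).trans ht.1.le), one_smul]
  · intro j hj hj'
    have h1 := Finset.mem_range.1 hj
    have h2 : m + 1 ≤ j := by simpa using hj'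
    rw [τ.ramp_eq_zero h1 (ht.2.trans (τ.time_mono h2 h1.le)), zero_smul]

/-- Interpolated values are convex combinations of two consecutive values. -/
theorem exists_interp_eq (hT : 0 < T) {t : ℝ} (ht : t ∈ Icc 0 T) :
    ∃ m < τ.J, ∃ c ∈ Icc (0 : ℝ) 1, ∀ {E : Type} [AddCommGroup E] [Module ℝ E] (F : ℕ → E),
      τ.interp F t = (1 - c) • F m + c • F (m + 1) := by
  rcases ht.1.eq_or_lt with h0 | h0
  · have hJ : 0 < τ.J := by
      by_contra! hcon
      have h1 := τ.time_last
      rw [Nat.le_zero.1 hcon, τ.time_zero] at h1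
      linarith
    refine ⟨0, hJ, 0, ⟨le_rfl, zero_le_one⟩, fun F => ?_⟩
    rw [← h0, interp_zero]
    simp
  · obtain ⟨m, hm, hmt⟩ := τ.exists_mem_Ioc ⟨h0, ht.2⟩
    have hr := τ.ramp_of_mem hm (Ioc_subset_Icc_self hmt)
    refine ⟨m, hm, (t - τ.time m) / τ.step m, hr ▸ τ.ramp_mem m t, fun F => ?_⟩
    rw [interp_of_mem τ F hm hmt, smul_sub, sub_smul, one_smul]
    abel

/-- The half-open time intervals miss `t = 0`, which the singleton term supplies; for `t > 0`
exactly one interval is active. -/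
theorem spaceTimeInterp_eq {h : ℝ} (hh : 0 < h) (U : ℕ → Idx N → ℝ) {t : ℝ} (ht : t ∈ Icc 0 T)
    (x : Space N) :
    spaceTimeInterp h τ U x t = τ.interp (fun j => U j (idx h x)) t := by
  unfold spaceTimeInterp
  simp only [spaceInterp_eq hh]
  rcases ht.1.eq_or_lt with h0 | h0
  · rw [← h0, interp_zero, τ.time_zero, indicator_of_mem (mem_singleton (0 : ℝ)),
      Finset.sum_eq_zero, add_zero]
    intro j hj
    rw [indicator_of_notMem]
    exact fun hc => absurd hc.1 (not_lt.2 (τ.time_nonneg (Finset.mem_range.1 hj).le))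
  · obtain ⟨m, hm, hmt⟩ := τ.exists_mem_Ioc ⟨h0, ht.2⟩
    rw [interp_of_mem τ _ hm hmt, indicator_of_notMem, zero_add,
      Finset.sum_eq_single_of_mem m (Finset.mem_range.2 hm), indicator_of_mem hmt]
    · rfl
    · intro j hj hne
      have hj' := Finset.mem_range.1 hj
      rw [indicator_of_notMem]
      rintro ⟨h1, h2⟩
      rcases lt_or_gt_of_ne hne with h | h
      · have := τ.time_mono (Nat.succ_le_of_lt h) hm.le
        linarith [hmt.1]
      · have := τ.time_mono (Nat.succ_le_of_lt h) hj'.le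
        linarith [hmt.2]
    · rw [mem_singleton_iff, τ.time_zero]; exact h0.ne'

/-- Writing the interpolant as a sum of ramps makes it visibly continuous in time and linear in `F`,
with no matching at the nodes. -/
theorem continuous_interp {E : Type*} [NormedAddCommGroup E] [NormedSpace ℝ E] (F : ℕ → E) :
    Continuous (τ.interp F) := by
  unfold interp
  have := τ.continuous_ramp
  fun_prop

/-- The modulus of continuity of an interpolation. -/
theorem norm_interp_sub_le {E : Type*} [NormedAddCommGroup E] [NormedSpace ℝ E] {F : ℕ → E}
    {K ε : ℝ} {e : ℕ → ℝ} (hF : ∀ j < τ.J, ‖F (j + 1) - F j‖ ≤ τ.step j * K + e j)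
    (he0 : ∀ j < τ.J, 0 ≤ e j) (he : ∑ j ∈ Finset.range τ.J, e j ≤ ε) {s t : ℝ} (hst : s ≤ t)
    (hs : s ∈ Icc 0 T) (ht : t ∈ Icc 0 T) :
    ‖τ.interp F t - τ.interp F s‖ ≤ (t - s) * K + ε := by
  -- Interpolating the grid times themselves gives the identity, so the ramp increments weighted by
  -- the steps add up to `t - s`.
  have hid : ∀ t ∈ Icc 0 T, τ.interp τ.time t = t := fun t ht => by
    rcases ht.1.eq_or_lt with h0 | h0
    · rw [← h0, interp_zero, τ.time_zero]
    · obtain ⟨m, hm, hmt⟩ := τ.exists_mem_Ioc ⟨h0, ht.2⟩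
      have := (τ.step_pos hm).ne'
      rw [interp_of_mem τ _ hm hmt, smul_eq_mul, ← step, div_mul_cancel₀ _ this]
      ring
  have hts : ∑ j ∈ Finset.range τ.J, (τ.ramp j t - τ.ramp j s) * τ.step j = t - s := by
    conv_rhs => rw [← hid t ht, ← hid s hs]
    unfold interp
    rw [add_sub_add_left_eq_sub, ← Finset.sum_sub_distrib]
    exact Finset.sum_congr rfl fun j _ => by rw [sub_mul]; rfl
  have e1 : τ.interp F t - τ.interp F s =
      ∑ j ∈ Finset.range τ.J, (τ.ramp j t - τ.ramp j s) • (F (j + 1) - F j) := by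
    unfold interp
    rw [add_sub_add_left_eq_sub, ← Finset.sum_sub_distrib]
    exact Finset.sum_congr rfl fun j _ => by rw [sub_smul]
  rw [e1]
  calc _ ≤ ∑ j ∈ Finset.range τ.J, ((τ.ramp j t - τ.ramp j s) * τ.step j * K + e j) := by
        refine norm_sum_le_of_le _ fun j hj => ?_
        have hj' := Finset.mem_range.1 hj
        have h1 : 0 ≤ τ.ramp j t - τ.ramp j s := sub_nonneg.2 (τ.ramp_mono hj' hst)
        -- A ramp increment is at most `1`, so each error `e j` is counted at most once.
        have h2 : τ.ramp j t - τ.ramp j s ≤ 1 := by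
          linarith [(τ.ramp_mem j t).2, (τ.ramp_mem j s).1]
        rw [norm_smul, Real.norm_of_nonneg h1]
        nlinarith [mul_le_mul_of_nonneg_left (hF j hj') h1, he0 j hj']
    _ = (t - s) * K + ∑ j ∈ Finset.range τ.J, e j := by
        rw [Finset.sum_add_distrib, ← Finset.sum_mul, hts]
    _ ≤ _ := by gcongr

end TimeGrid

/-! ### Compactness in `L¹` of families of piecewise constant functions. -/

/-- Interpolation between `L¹` and `L^∞`. -/
theorem eLpNorm_le_of_bound {α : Type*} [MeasurableSpace α] {μ : Measure α} {f : α → ℝ} {M : ℝ}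
    (hM : ∀ᵐ x ∂μ, |f x| ≤ M) {r : ℝ≥0∞} (hr1 : 1 ≤ r) (hr : r ≠ ∞) :
    eLpNorm f r μ ≤ ENNReal.ofReal M ^ ((r.toReal - 1) / r.toReal) *
      eLpNorm f 1 μ ^ (1 / r.toReal) := by
  have hr0 : r ≠ 0 := (one_pos.trans_le hr1).ne'
  have hr' : 1 ≤ r.toReal := by
    rw [← ENNReal.toReal_one]; exact ENNReal.toReal_mono hr hr1
  have h0 : 0 < r.toReal := by linarith
  rw [eLpNorm_eq_lintegral_rpow_enorm_toReal hr0 hr, eLpNorm_one_eq_lintegral_enorm]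
  have h1 : ∫⁻ x, ‖f x‖ₑ ^ r.toReal ∂μ ≤
      ENNReal.ofReal M ^ (r.toReal - 1) * ∫⁻ x, ‖f x‖ₑ ∂μ := by
    rw [← lintegral_const_mul' _ _
      (ENNReal.rpow_ne_top_of_nonneg (by linarith) ENNReal.ofReal_ne_top)]
    refine lintegral_mono_ae ?_
    filter_upwards [hM] with x hx
    have e : ‖f x‖ₑ ^ r.toReal = ‖f x‖ₑ ^ (r.toReal - 1) * ‖f x‖ₑ := by
      conv_lhs => rw [show r.toReal = (r.toReal - 1) + 1 by ring]
      rw [ENNReal.rpow_add_of_nonneg _ _ (by linarith) zero_le_one, ENNReal.rpow_one]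
    have hx' : ‖f x‖ₑ ≤ ENNReal.ofReal M := by
      rw [Real.enorm_eq_ofReal_abs]
      exact ENNReal.ofReal_le_ofReal hx
    rw [e]
    exact mul_le_mul_left (ENNReal.rpow_le_rpow hx' (by linarith)) _
  calc _ ≤ (ENNReal.ofReal M ^ (r.toReal - 1) * ∫⁻ x, ‖f x‖ₑ ∂μ) ^ (1 / r.toReal) := by gcongr
    _ = _ := by
      rw [ENNReal.mul_rpow_of_nonneg _ _ (by positivity), ← ENNReal.rpow_mul, mul_one_div]

theorem memLp_comp_idx {h : ℝ} (hh : 0 < h) {V : Idx N → ℝ} (hV : Summable fun β => |V β|)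
    {r : ℝ≥0∞} (hr1 : 1 ≤ r) (hr : r ≠ ∞) : MemLp (fun x : Space N => V (idx h x)) r volume := by
  obtain ⟨M, hM⟩ := Stencil.exists_abs_le_of_tendsto hV.of_abs.tendsto_cofinite_zero
  have hr' : 1 ≤ r.toReal := by
    rw [← ENNReal.toReal_one]; exact ENNReal.toReal_mono hr hr1
  refine ⟨aestronglyMeasurable_comp_idx h V, (eLpNorm_le_of_bound (M := M)
    (Eventually.of_forall fun x => hM _) hr1 hr).trans_lt (ENNReal.mul_lt_top ?_ ?_)⟩
  · exact ENNReal.rpow_lt_top_of_nonneg (div_nonneg (by linarith) (by linarith))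
      ENNReal.ofReal_ne_top
  · exact ENNReal.rpow_lt_top_of_nonneg (by positivity)
      (memLp_one_iff_integrable.2 (integrable_comp_idx hh hV)).eLpNorm_ne_top

/-- The `L¹` distance of a piecewise constant function to its translates. -/
theorem lintegral_translate_sub_comp_idx_le {h : ℝ} (hh : 0 < h) {V : Idx N → ℝ}
    (hV : Summable fun β => |V β|) {ξ : Space N} {m : ℝ}
    (hm : ∀ γ : Idx N, ‖gridPoint h γ‖ ≤ N * (‖ξ‖ + h) →
      h ^ N * ∑' β, |V (β + γ) - V β| ≤ m) :
    ∫⁻ x, ‖V (idx h (x + ξ)) - V (idx h x)‖ₑ ≤ 2 ^ N * ENNReal.ofReal m := by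
  -- When `x` moves by `ξ`, each coordinate of its cell index moves by `⌊ξ i / h⌋` or one more. So a
  -- translation is dominated by at most `2 ^ N` grid translations.
  set Γ : Finset (Idx N) :=
    Fintype.piFinset fun i => {⌊ξ i / h⌋, ⌊ξ i / h⌋ + 1} with hΓ
  have hcard : (Γ.card : ℝ≥0∞) ≤ 2 ^ N := by
    have : Γ.card ≤ 2 ^ N := by
      rw [hΓ, Fintype.card_piFinset]
      calc _ ≤ ∏ _i : Fin N, 2 := Finset.prod_le_prod' fun i _ => Finset.card_le_two
        _ = 2 ^ N := by simp
    exact_mod_cast this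
  have hmem : ∀ x, idx h (x + ξ) - idx h x ∈ Γ := fun x => by
    rw [hΓ, Fintype.mem_piFinset]
    intro i
    have e : (x + ξ) i / h - 1 / 2 = (x i / h - 1 / 2) + ξ i / h := by
      rw [PiLp.add_apply]; ring
    simp only [Pi.sub_apply, idx, e]
    set y := x i / h - 1 / 2
    set s := ξ i / h
    have h1 := Int.ceil_le_floor_add_one s
    have h2 := Int.ceil_add_le y s
    have h3 : ⌈y⌉ + ⌊s⌋ ≤ ⌈y + s⌉ := by
      rw [← Int.ceil_add_intCast]
      exact Int.ceil_le_ceil (add_le_add_right (Int.floor_le s) y)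
    rw [Finset.mem_insert, Finset.mem_singleton]
    omega
  have hnorm : ∀ γ ∈ Γ, ‖gridPoint h γ‖ ≤ N * (‖ξ‖ + h) := fun γ hγ => by
    refine norm_le_of_forall_abs_le (by positivity) fun i => ?_
    rw [gridPoint_apply, abs_mul, abs_of_pos hh]
    have h1 := (Fintype.mem_piFinset.1 hγ) i
    rw [Finset.mem_insert, Finset.mem_singleton] at h1
    have h2 : |ξ i| ≤ ‖ξ‖ := PiLp.norm_apply_le ξ i
    have h3 : |(γ i : ℝ) - ξ i / h| ≤ 1 := by
      have f1 := Int.floor_le (ξ i / h)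
      have f2 := Int.lt_floor_add_one (ξ i / h)
      rw [abs_le]
      rcases h1 with h1 | h1 <;> rw [h1] <;> push_cast <;> constructor <;> linarith
    have h4 : h * |(γ i : ℝ)| ≤ h * (|(γ i : ℝ) - ξ i / h| + |ξ i / h|) := by
      gcongr
      simpa using abs_add_le ((γ i : ℝ) - ξ i / h) (ξ i / h)
    have h5 : h * |ξ i / h| = |ξ i| := by
      rw [abs_div, abs_of_pos hh]; field_simp
    nlinarith
  have hshift : ∀ γ : Idx N, Summable (fun β => |V (β + γ) - V β|) := fun γ =>
    (((Equiv.addRight γ).summable_iff.2 hV.of_abs).sub hV.of_abs).abs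
  calc _ ≤ ∫⁻ x, ∑ γ ∈ Γ, ‖V (idx h x + γ) - V (idx h x)‖ₑ := by
        refine lintegral_mono fun x => ?_
        have := Finset.single_le_sum (f := fun γ => ‖V (idx h x + γ) - V (idx h x)‖ₑ)
          (fun γ _ => zero_le) (hmem x)
        simpa using this
    _ = ∑ γ ∈ Γ, ∫⁻ x, ‖V (idx h x + γ) - V (idx h x)‖ₑ :=
        lintegral_finsetSum _ fun γ _ =>
          (measurable_of_countable fun β => ‖V (β + γ) - V β‖ₑ).comp (measurable_idx h)
    _ ≤ ∑ _γ ∈ Γ, ENNReal.ofReal m := by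
        refine Finset.sum_le_sum fun γ hγ => ?_
        rw [lintegral_enorm_comp_idx hh (V := fun β => V (β + γ) - V β) (hshift γ)]
        exact ENNReal.ofReal_le_ofReal (hm γ (hnorm γ hγ))
    _ = Γ.card * ENNReal.ofReal m := by rw [Finset.sum_const, nsmul_eq_mul]
    _ ≤ _ := by gcongr

/-- The `L¹` distance of a function to its averages over cells of size `ρ`. -/
theorem lintegral_sub_initialAverage_le {ρ : ℝ} (hρ : 0 < ρ) {f : Space N → ℝ}
    (hf : Measurable f) (hfi : Integrable f) {m : ℝ≥0∞}
    (hm : ∀ ξ : Space N, ‖ξ‖ ≤ N * ρ → ∫⁻ x, ‖f (x + ξ) - f x‖ₑ ≤ m) :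
    ∫⁻ x, ‖f x - initialAverage ρ f (idx ρ x)‖ₑ ≤
      ENNReal.ofReal (N ^ N) * volume (Metric.ball (0 : Space N) 1) * m := by
  have hp := pow_pos hρ N
  -- The cell of `x` lies in `x + b`, so the cell average is controlled by an integral over shifts
  -- `ξ ∈ b`. Exchanging the integrals leaves the factor `|b| / ρ^N`, which is `N^N` times the
  -- volume of the unit ball.
  set b := Metric.closedBall (0 : Space N) (N * ρ) with hb
  have hpt : ∀ x, ‖f x - initialAverage ρ f (idx ρ x)‖ₑ ≤
      ENNReal.ofReal ((ρ ^ N)⁻¹) * ∫⁻ ξ in b, ‖f (x + ξ) - f x‖ₑ := fun x => by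
    have e : f x - initialAverage ρ f (idx ρ x) =
        (ρ ^ N)⁻¹ * ∫ y in cell ρ (idx ρ x), (f x - f y) := by
      have hv := volume_cell_ne_top hρ (idx ρ x)
      have hc : Integrable (fun _ => f x) (volume.restrict (cell ρ (idx ρ x))) :=
        integrableOn_const hv (by simp)
      rw [integral_sub hc hfi.integrableOn,
        ← pow_mul_initialAverage hρ, ← pow_mul_initialAverage hρ, initialAverage_const hρ]
      field_simp
    rw [e, enorm_mul, Real.enorm_eq_ofReal_abs, abs_of_pos (inv_pos.2 hp)]
    gcongr
    refine (enorm_integral_le_lintegral_enorm _).trans ?_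
    rw [← lintegral_indicator (measurableSet_cell hρ _),
      ← lintegral_indicator Metric.isClosed_closedBall.measurableSet,
      ← lintegral_add_left_eq_self _ x]
    refine lintegral_mono fun ξ => ?_
    by_cases hξ : x + ξ ∈ cell ρ (idx ρ x)
    · have h1 : ξ ∈ b := by
        rw [hb, mem_closedBall_zero_iff]
        simpa using norm_sub_le_of_mem_cell hρ.le hξ ((mem_cell_iff hρ).2 rfl : x ∈ cell ρ _)
      rw [indicator_of_mem hξ, indicator_of_mem h1, ← enorm_neg, neg_sub]
    · rw [indicator_of_notMem hξ]; exact zero_le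
  calc _ ≤ ∫⁻ x, ENNReal.ofReal ((ρ ^ N)⁻¹) * ∫⁻ ξ in b, ‖f (x + ξ) - f x‖ₑ :=
        lintegral_mono hpt
    _ = ENNReal.ofReal ((ρ ^ N)⁻¹) * ∫⁻ ξ in b, ∫⁻ x, ‖f (x + ξ) - f x‖ₑ := by
        rw [lintegral_const_mul' _ _ ENNReal.ofReal_ne_top, lintegral_lintegral_swap]
        refine Measurable.aemeasurable ?_
        fun_prop
    _ ≤ ENNReal.ofReal ((ρ ^ N)⁻¹) * ∫⁻ _ξ in b, m := by
        gcongr 1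
        refine setLIntegral_mono measurable_const fun ξ hξ => hm ξ ?_
        rwa [hb, mem_closedBall_zero_iff] at hξ
    _ = _ := by
        rw [setLIntegral_const, hb, Measure.addHaar_closedBall _ _ (by positivity),
          finrank_euclideanSpace_fin, mul_pow, ENNReal.ofReal_mul (by positivity)]
        have : ENNReal.ofReal ((ρ ^ N)⁻¹) * ENNReal.ofReal (ρ ^ N) = 1 := by
          rw [← ENNReal.ofReal_mul (by positivity), inv_mul_cancel₀ hp.ne', ENNReal.ofReal_one]
        calc _ = (ENNReal.ofReal ((ρ ^ N)⁻¹) * ENNReal.ofReal (ρ ^ N)) *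
              (ENNReal.ofReal (N ^ N) * volume (Metric.ball (0 : Space N) 1) * m) := by ring
          _ = _ := by rw [this, one_mul]

/-- The simple function with prescribed values on finitely many cells, as an element of `L¹`. -/
noncomputable def stepLp {ρ : ℝ} (hρ : 0 < ρ) (B : Finset (Idx N)) (c : Idx N → ℝ) :
    Lp ℝ 1 (volume : Measure (Space N)) :=
  ∑ β ∈ B, c β • indicatorConstLp 1 (measurableSet_cell hρ β) (volume_cell_ne_top hρ β) (1 : ℝ)

theorem continuous_stepLp {ρ : ℝ} (hρ : 0 < ρ) (B : Finset (Idx N)) :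
    Continuous (stepLp hρ B) := by
  unfold stepLp
  fun_prop

theorem coeFn_stepLp {ρ : ℝ} (hρ : 0 < ρ) (B : Finset (Idx N)) (c : Idx N → ℝ) :
    stepLp hρ B c =ᵐ[volume] fun x => (B : Set (Idx N)).indicator c (idx ρ x) := by
  have h1 : ∀ᵐ x, ∀ β ∈ B, (c β • indicatorConstLp 1 (measurableSet_cell hρ β)
      (volume_cell_ne_top hρ β) (1 : ℝ) : Lp ℝ 1 (volume : Measure (Space N))) x =
      c β * (cell ρ β).indicator (fun _ => 1) x := by
    rw [Filter.eventually_all_finset]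
    intro β _
    filter_upwards [Lp.coeFn_smul (c β) (indicatorConstLp 1 (measurableSet_cell hρ β)
      (volume_cell_ne_top hρ β) (1 : ℝ)), indicatorConstLp_coeFn (p := 1)
      (hs := measurableSet_cell hρ β) (hμs := volume_cell_ne_top hρ β) (c := (1 : ℝ))] with x e1 e2
    rw [e1, Pi.smul_apply, e2, smul_eq_mul]
  refine (Lp.coeFn_fun_finsetSum B _).trans ?_
  filter_upwards [h1] with x hx
  rw [Finset.sum_congr rfl hx]
  by_cases hB : idx ρ x ∈ B
  · rw [Finset.sum_eq_single_of_mem _ hB, indicator_of_mem ((mem_cell_iff hρ).2 rfl), mul_one,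
      indicator_of_mem (Finset.mem_coe.2 hB)]
    intro β _ hne
    rw [indicator_of_notMem, mul_zero]
    rw [mem_cell_iff hρ]
    exact hne.symm
  · rw [indicator_of_notMem (by simpa using hB), Finset.sum_eq_zero]
    intro β hβ
    rw [indicator_of_notMem, mul_zero]
    rw [mem_cell_iff hρ]
    rintro rfl
    exact hB hβ

theorem exists_finset_idx_mem {ρ : ℝ} (hρ : 0 < ρ) (R : ℝ) :
    ∃ B : Finset (Idx N), ∀ x : Space N, ‖x‖ < R → idx ρ x ∈ B := by
  set n : ℤ := ⌈R / ρ + 1⌉ with hn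
  refine ⟨Fintype.piFinset fun _ => Finset.Icc (-n) n, fun x hx => ?_⟩
  rw [Fintype.mem_piFinset]
  intro i
  have h1 : |x i| ≤ ‖x‖ := PiLp.norm_apply_le x i
  have h2 : |x i / ρ| ≤ R / ρ := by
    rw [abs_div, abs_of_pos hρ]
    gcongr
    linarith
  have h3 := abs_le.1 h2
  have h4 : R / ρ + 1 ≤ n := Int.le_ceil _
  rw [Finset.mem_Icc, idx]
  constructor
  · rw [Int.le_ceil_iff]
    push_cast
    linarith
  · rw [Int.ceil_le]
    linarith

theorem totallyBounded_of_forall_exists_dist_le {E : Type*} [PseudoMetricSpace E] {s : Set E}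
    (h : ∀ ε > 0, ∃ A : Set E, TotallyBounded A ∧ ∀ v ∈ s, ∃ w ∈ A, dist v w ≤ ε) :
    TotallyBounded s := by
  rw [Metric.totallyBounded_iff]
  intro ε hε
  obtain ⟨A, hA, hsA⟩ := h (ε / 2) (by positivity)
  obtain ⟨t, ht, htA⟩ := Metric.totallyBounded_iff.1 hA (ε / 2) (by positivity)
  refine ⟨t, ht, fun v hv => ?_⟩
  obtain ⟨w, hw, hd⟩ := hsA v hv
  obtain ⟨y, hy, hwy⟩ := mem_iUnion₂.1 (htA hw)
  refine mem_iUnion₂.2 ⟨y, hy, ?_⟩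
  rw [Metric.mem_ball] at hwy ⊢
  linarith [dist_triangle v w y]

/-- A Kolmogorov–Riesz criterion for families of piecewise constant functions on grids whose
size tends to zero. -/
theorem totallyBounded_range_of_grid {ι : Type*} {η : ℕ → ℝ} (hη : ∀ k, 0 < η k)
    (hη₀ : Tendsto η atTop (𝓝 0)) {V : ℕ → ι → Idx N → ℝ}
    (hVs : ∀ k i, Summable fun β => |V k i β|) {M : ℝ} (hVM : ∀ k i β, |V k i β| ≤ M)
    (hshift : ∀ ε > 0, ∃ δ > 0, ∀ k i (γ : Idx N), ‖gridPoint (η k) γ‖ < δ →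
      η k ^ N * ∑' β, |V k i (β + γ) - V k i β| ≤ ε)
    (htail : ∀ ε > 0, ∃ R : ℝ, ∀ k i,
      ∫⁻ x in {x : Space N | R ≤ ‖x‖}, ‖V k i (idx (η k) x)‖ₑ ≤ ENNReal.ofReal ε)
    {v : ℕ → ι → Lp ℝ 1 (volume : Measure (Space N))}
    (hv : ∀ k i, v k i =ᵐ[volume] fun x => V k i (idx (η k) x))
    (hcpt : ∀ k, TotallyBounded (range (v k))) :
    TotallyBounded (range fun p : ℕ × ι => v p.1 p.2) := by
  refine totallyBounded_of_forall_exists_dist_le fun ε hε => ?_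
  set A : ℝ≥0∞ := ENNReal.ofReal (N ^ N) * volume (Metric.ball (0 : Space N) 1) * 2 ^ N with hA
  have hAt : A ≠ ∞ := ENNReal.mul_ne_top (ENNReal.mul_ne_top ENNReal.ofReal_ne_top
    measure_ball_lt_top.ne) (by simp)
  set m : ℝ := ε / 2 / (A.toReal + 1) with hm
  have hA0 : 0 ≤ A.toReal := ENNReal.toReal_nonneg
  have hm0 : 0 < m := by positivity
  have hAm : A * ENNReal.ofReal m ≤ ENNReal.ofReal (ε / 2) := by
    rw [← ENNReal.ofReal_toReal hAt, ← ENNReal.ofReal_mul hA0]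
    refine ENNReal.ofReal_le_ofReal ?_
    rw [hm, mul_div_assoc', div_le_iff₀ (by positivity)]
    nlinarith
  obtain ⟨δ, hδ, hδs⟩ := hshift m hm0
  obtain ⟨R, hR⟩ := htail (ε / 2) (by positivity)
  -- Once `η k < ρ`, the grid shifts that occur have norm at most `N (N ρ + ρ)`, which is below `4
  -- (N² + 1) ρ = δ`.
  set ρ : ℝ := δ / (4 * ((N : ℝ) ^ 2 + 1)) with hρd
  have hρ : 0 < ρ := by positivity
  have hδρ : δ = 4 * ((N : ℝ) ^ 2 + 1) * ρ := by rw [hρd]; field_simp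
  obtain ⟨B, hB⟩ := exists_finset_idx_mem (N := N) hρ R
  obtain ⟨k₀, hk₀⟩ := eventually_atTop.1 (hη₀.eventually_lt_const hρ)
  -- The finitely many coarse grids are covered by assumption. On finer grids a function is close to
  -- its averages over fixed cells of size `ρ` near the origin, and these averages form a bounded
  -- finite-dimensional set.
  refine ⟨(⋃ k ∈ Finset.range k₀, range (v k)) ∪
    stepLp hρ B '' (univ.pi fun _ => Icc (-M) M), ?_, ?_⟩
  · refine TotallyBounded.union ?_ ?_
    · exact (totallyBounded_biUnion (Finset.range k₀).finite_toSet).2 fun k _ => hcpt k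
    · exact ((isCompact_univ_pi fun _ => isCompact_Icc).image
        (continuous_stepLp hρ B)).totallyBounded
  rintro _ ⟨⟨k, i⟩, rfl⟩
  rcases lt_or_ge k k₀ with hk | hk
  · exact ⟨v k i, Or.inl (mem_iUnion₂.2 ⟨k, Finset.mem_range.2 hk, mem_range_self i⟩),
      by simpa using hε.le⟩
  have hh := hη k
  set f : Space N → ℝ := fun x => V k i (idx (η k) x) with hf
  have hfm : Measurable f := (measurable_of_countable (V k i)).comp (measurable_idx _)
  have hfi : Integrable f := integrable_comp_idx hh (hVs k i)
  refine ⟨stepLp hρ B (initialAverage ρ f), Or.inr (mem_image_of_mem _ ?_), ?_⟩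
  · intro β _
    exact abs_le.1 (abs_initialAverage_le hρ (Eventually.of_forall fun x => hVM k i _) β)
  have hedist : edist (v k i) (stepLp hρ B (initialAverage ρ f)) ≤ ENNReal.ofReal ε := by
    rw [Lp.edist_def, eLpNorm_one_eq_lintegral_enorm]
    calc _ ≤ ∫⁻ x, (‖f x - initialAverage ρ f (idx ρ x)‖ₑ +
          {x : Space N | R ≤ ‖x‖}.indicator (fun x => ‖f x‖ₑ) x) := by
          refine lintegral_mono_ae ?_
          filter_upwards [hv k i, coeFn_stepLp hρ B (initialAverage ρ f)] with x h1 h2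
          rw [Pi.sub_apply, h1, h2]
          by_cases hx : idx ρ x ∈ B
          · rw [indicator_of_mem (Finset.mem_coe.2 hx)]
            exact le_self_add
          · have hx' : R ≤ ‖x‖ := by
              by_contra! hc
              exact hx (hB x hc)
            rw [indicator_of_notMem (by simpa using hx), sub_zero,
              indicator_of_mem (show x ∈ {x : Space N | R ≤ ‖x‖} from hx')]
            exact le_add_self
      _ = (∫⁻ x, ‖f x - initialAverage ρ f (idx ρ x)‖ₑ) +
          ∫⁻ x in {x : Space N | R ≤ ‖x‖}, ‖f x‖ₑ := by
          have hms : MeasurableSet {x : Space N | R ≤ ‖x‖} :=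
            measurableSet_le measurable_const measurable_norm
          rw [lintegral_add_right _ (hfm.enorm.indicator hms), lintegral_indicator hms]
      _ ≤ ENNReal.ofReal (ε / 2) + ENNReal.ofReal (ε / 2) := by
          gcongr
          · refine (lintegral_sub_initialAverage_le hρ hfm hfi
              (m := 2 ^ N * ENNReal.ofReal m) fun ξ hξ => ?_).trans ?_
            · refine lintegral_translate_sub_comp_idx_le hh (hVs k i) fun γ hγ => hδs k i γ ?_
              refine hγ.trans_lt ?_
              have h1 := hk₀ k hk
              have hN0 : (0 : ℝ) ≤ N := Nat.cast_nonneg N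
              rw [hδρ]
              have h2 : (N : ℝ) * (‖ξ‖ + η k) ≤ N * (N * ρ + ρ) := by gcongr
              nlinarith [sq_nonneg ((N : ℝ) - 1), mul_pos hρ hρ]
            · rw [← mul_assoc]; exact hAm
          · exact hR k i
      _ = ENNReal.ofReal ε := by
          rw [← ENNReal.ofReal_add (by positivity) (by positivity), add_halves]
  rw [edist_dist] at hedist
  exact (ENNReal.ofReal_le_ofReal_iff hε.le).1 hedist

/-! ### The interpolants as curves in `L^r`, and their pairing with test functions. -/

open Classical in
/-- The piecewise constant interpolant of a grid function as an element of `L^r`. -/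
noncomputable def gridLp (r : ℝ≥0∞) (h : ℝ) (V : Idx N → ℝ) :
    Lp ℝ r (volume : Measure (Space N)) :=
  if hV : MemLp (fun x : Space N => V (idx h x)) r volume then hV.toLp _ else 0

theorem coeFn_gridLp {r : ℝ≥0∞} (hr1 : 1 ≤ r) (hr : r ≠ ∞) {h : ℝ} (hh : 0 < h) {V : Idx N → ℝ}
    (hV : Summable fun β => |V β|) : gridLp r h V =ᵐ[volume] fun x => V (idx h x) := by
  have hm := memLp_comp_idx hh hV hr1 hr
  rw [gridLp, dif_pos hm]
  exact hm.coeFn_toLp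

theorem coeFn_interp_gridLp {r : ℝ≥0∞} (hr1 : 1 ≤ r) (hr : r ≠ ∞) {h : ℝ} (hh : 0 < h)
    (hT : 0 < T) (τ : TimeGrid T) {U : ℕ → Idx N → ℝ}
    (hU : ∀ j ≤ τ.J, Summable fun β => |U j β|) {t : ℝ} (ht : t ∈ Icc 0 T) :
    (τ.interp (fun j => gridLp r h (U j)) t : Lp ℝ r (volume : Measure (Space N))) =ᵐ[volume]
      fun x => τ.interp (fun j => U j (idx h x)) t := by
  -- The same `m` and `c` represent the `L^r`-valued and the pointwise interpolation, which gives
  -- the identification almost everywhere.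
  obtain ⟨m, hm, c, _, hi⟩ := τ.exists_interp_eq hT ht
  simp only [hi]
  refine (Lp.coeFn_add _ _).trans ?_
  filter_upwards [Lp.coeFn_smul (1 - c) (gridLp r h (U m)), Lp.coeFn_smul c (gridLp r h (U (m + 1))),
    coeFn_gridLp hr1 hr hh (hU m hm.le), coeFn_gridLp hr1 hr hh (hU (m + 1) hm)] with x e1 e2 e3 e4
  rw [Pi.add_apply, e1, e2, Pi.smul_apply, Pi.smul_apply, e3, e4]

theorem summable_interp (hT : 0 < T) (τ : TimeGrid T) {A : ℕ → Idx N → ℝ}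
    (hA : ∀ j ≤ τ.J, Summable fun β => |A j β|) {t : ℝ} (ht : t ∈ Icc 0 T) :
    Summable fun β => |τ.interp (fun j => A j β) t| := by
  obtain ⟨m, hm, c, _, hi⟩ := τ.exists_interp_eq hT ht
  simp only [hi, smul_eq_mul]
  exact (((hA m hm.le).of_abs.mul_left _).add ((hA (m + 1) hm).of_abs.mul_left _)).abs

theorem abs_interp_le (hT : 0 < T) (τ : TimeGrid T) {a : ℕ → ℝ} {M : ℝ}
    (ha : ∀ j ≤ τ.J, |a j| ≤ M) {t : ℝ} (ht : t ∈ Icc 0 T) : |τ.interp a t| ≤ M := by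
  obtain ⟨m, hm, c, hc, hi⟩ := τ.exists_interp_eq hT ht
  rw [hi, smul_eq_mul, smul_eq_mul]
  refine (abs_add_le _ _).trans ?_
  rw [abs_mul, abs_mul, abs_of_nonneg hc.1, abs_of_nonneg (sub_nonneg.2 hc.2)]
  nlinarith [ha m hm.le, ha (m + 1) hm, hc.1, hc.2]

theorem tsum_abs_interp_le (hT : 0 < T) (τ : TimeGrid T) {A : ℕ → Idx N → ℝ}
    (hA : ∀ j ≤ τ.J, Summable fun β => |A j β|) {q m : ℝ} (hq : 0 ≤ q)
    (hm : ∀ j ≤ τ.J, q * ∑' β, |A j β| ≤ m) {t : ℝ} (ht : t ∈ Icc 0 T) :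
    q * ∑' β, |τ.interp (fun j => A j β) t| ≤ m := by
  have hs := summable_interp hT τ hA ht
  obtain ⟨i, hi, c, hc, he⟩ := τ.exists_interp_eq hT ht
  simp only [he, smul_eq_mul] at hs ⊢
  have h1 := ((hA i hi.le).mul_left (1 - c)).add ((hA (i + 1) hi).mul_left c)
  have h2 := hs.tsum_le_tsum (fun β => by
    refine (abs_add_le _ _).trans (le_of_eq ?_)
    rw [abs_mul, abs_mul, abs_of_nonneg hc.1, abs_of_nonneg (sub_nonneg.2 hc.2)]) h1
  rw [((hA i hi.le).mul_left (1 - c)).tsum_add ((hA (i + 1) hi).mul_left c), tsum_mul_left,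
    tsum_mul_left] at h2
  have h3 := mul_le_mul_of_nonneg_left h2 hq
  have h4 := mul_le_mul_of_nonneg_left (hm i hi.le) (sub_nonneg.2 hc.2)
  have h5 := mul_le_mul_of_nonneg_left (hm (i + 1) hi) hc.1
  linarith

theorem lintegral_interp_le (hT : 0 < T) (τ : TimeGrid T) {f : ℕ → Space N → ℝ}
    (hf : ∀ j, Measurable (f j)) (μ : Measure (Space N)) {m : ℝ≥0∞}
    (hm : ∀ j ≤ τ.J, ∫⁻ x, ‖f j x‖ₑ ∂μ ≤ m) {t : ℝ} (ht : t ∈ Icc 0 T) :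
    ∫⁻ x, ‖τ.interp (fun j => f j x) t‖ₑ ∂μ ≤ m := by
  obtain ⟨i, hi, c, hc, he⟩ := τ.exists_interp_eq hT ht
  simp only [he]
  calc _ ≤ ∫⁻ x, (‖1 - c‖ₑ * ‖f i x‖ₑ + ‖c‖ₑ * ‖f (i + 1) x‖ₑ) ∂μ :=
        lintegral_mono fun x => (enorm_add_le _ _).trans (by rw [enorm_smul, enorm_smul])
    _ = ‖1 - c‖ₑ * ∫⁻ x, ‖f i x‖ₑ ∂μ + ‖c‖ₑ * ∫⁻ x, ‖f (i + 1) x‖ₑ ∂μ := by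
        rw [lintegral_add_left ((hf i).enorm.const_mul _), lintegral_const_mul _ (hf i).enorm,
          lintegral_const_mul _ (hf (i + 1)).enorm]
    _ ≤ ‖1 - c‖ₑ * m + ‖c‖ₑ * m := by
        gcongr
        · exact hm i hi.le
        · exact hm (i + 1) hi
    _ = m := by
        rw [← add_mul, Real.enorm_of_nonneg hc.1, Real.enorm_of_nonneg (sub_nonneg.2 hc.2),
          ← ENNReal.ofReal_add (sub_nonneg.2 hc.2) hc.1, sub_add_cancel, ENNReal.ofReal_one,
          one_mul]

/-- Integration against a bounded continuous function, as a functional on `L¹`. -/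
noncomputable def pairing (θ : Space N → ℝ) (hθ : Continuous θ) {B : ℝ} (hB : ∀ x, ‖θ x‖ ≤ B) :
    Lp ℝ 1 (volume : Measure (Space N)) →L[ℝ] ℝ :=
  have hint : ∀ f : Lp ℝ 1 (volume : Measure (Space N)), Integrable (fun x => θ x * f x) :=
    fun f => (L1.integrable_coeFn f).bdd_mul hθ.aestronglyMeasurable (Eventually.of_forall hB)
  LinearMap.mkContinuous
    { toFun := fun f => ∫ x, θ x * f x
      map_add' := fun f g => by
        rw [← integral_add (hint f) (hint g)]
        refine integral_congr_ae ?_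
        filter_upwards [Lp.coeFn_add f g] with x hx
        rw [hx, Pi.add_apply, mul_add]
      map_smul' := fun c f => by
        rw [RingHom.id_apply, smul_eq_mul, ← integral_const_mul]
        refine integral_congr_ae ?_
        filter_upwards [Lp.coeFn_smul c f] with x hx
        rw [hx, Pi.smul_apply, smul_eq_mul]
        ring } B fun f => by
    rw [L1.norm_eq_integral_norm, ← integral_const_mul]
    refine (norm_integral_le_integral_norm _).trans
      (integral_mono (hint f).norm ((L1.integrable_coeFn f).norm.const_mul B) fun x => ?_)
    simp only [norm_mul]
    exact mul_le_mul_of_nonneg_right (hB x) (norm_nonneg _)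

theorem pairing_apply (θ : Space N → ℝ) (hθ : Continuous θ) {B : ℝ} (hB : ∀ x, ‖θ x‖ ≤ B)
    (f : Lp ℝ 1 (volume : Measure (Space N))) : pairing θ hθ hB f = ∫ x, θ x * f x := rfl

/-! ### From uniform estimates to compactness in `C([0,T]; L^r)`. -/

/-- The estimates, uniform along a sequence of grids, which yield compactness. -/
structure UniformEstimates (η : ℕ → ℝ) (τ : ℕ → TimeGrid T) (U : ℕ → ℕ → Idx N → ℝ) (M : ℝ) :
    Prop where
  pos : ∀ k, 0 < η k
  tendsto_zero : Tendsto η atTop (𝓝 0)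
  summable : ∀ k, ∀ j ≤ (τ k).J, Summable fun β => |U k j β|
  sup : ∀ k, ∀ j ≤ (τ k).J, ∀ β, |U k j β| ≤ M
  shift : ∀ ε > 0, ∃ δ > 0, ∀ k, ∀ j ≤ (τ k).J, ∀ γ : Idx N, ‖gridPoint (η k) γ‖ < δ →
    η k ^ N * ∑' β, |U k j (β + γ) - U k j β| ≤ ε
  tail : ∀ ε > 0, ∃ R : ℝ, ∀ k, ∀ j ≤ (τ k).J,
    ∫⁻ x in {x : Space N | R ≤ ‖x‖}, ‖U k j (idx (η k) x)‖ₑ ≤ ENNReal.ofReal ε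
  weak : ∀ θ : Space N → ℝ, ContDiff ℝ ((⊤ : ℕ∞) : WithTop ℕ∞) θ → HasCompactSupport θ → ∀ ε > 0, ∃ K : ℝ, 0 ≤ K ∧
    ∀ k, ∃ e : ℕ → ℝ, (∀ j < (τ k).J, 0 ≤ e j) ∧ ∑ j ∈ Finset.range (τ k).J, e j ≤ ε ∧
      ∀ j < (τ k).J, |(∫ x, θ x * U k (j + 1) (idx (η k) x)) - ∫ x, θ x * U k j (idx (η k) x)| ≤
        (τ k).step j * K + e j

namespace UniformEstimates

variable {η : ℕ → ℝ} {τ : ℕ → TimeGrid T} {U : ℕ → ℕ → Idx N → ℝ} {M : ℝ}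

/-- The interpolants as functions of time with values in `L^r`. -/
noncomputable def curve (η : ℕ → ℝ) (τ : ℕ → TimeGrid T) (U : ℕ → ℕ → Idx N → ℝ) (r : ℝ≥0∞)
    [Fact (1 ≤ r)] (k : ℕ) : C(Icc (0 : ℝ) T, Lp ℝ r (volume : Measure (Space N))) where
  toFun t := (τ k).interp (fun j => gridLp r (η k) (U k j)) t
  continuous_toFun := ((τ k).continuous_interp _).comp continuous_subtype_val

theorem coeFn_curve (H : UniformEstimates η τ U M) (hT : 0 < T) (r : ℝ≥0∞) [hr1 : Fact (1 ≤ r)]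
    (hr : r ≠ ∞) (k : ℕ) (t : Icc (0 : ℝ) T) : curve η τ U r k t =ᵐ[volume]
      fun x => (τ k).interp (fun j => U k j (idx (η k) x)) t :=
  coeFn_interp_gridLp hr1.out hr (H.pos k) hT (τ k) (H.summable k) t.2

/-- The bounds at grid times pass to convex combinations, so the criterion applies to all times at
once. Each single curve has compact range by continuity, which covers the coarse grids. -/
theorem totallyBounded_range_curve (H : UniformEstimates η τ U M) (hT : 0 < T) :
    TotallyBounded (range fun p : ℕ × Icc (0 : ℝ) T => curve η τ U 1 p.1 p.2) := by
  refine totallyBounded_range_of_grid (η := η) H.pos H.tendsto_zero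
    (V := fun k (t : Icc (0 : ℝ) T) β => (τ k).interp (fun j => U k j β) t) (M := M)
    (fun k t => summable_interp hT (τ k) (H.summable k) t.2)
    (fun k t β => abs_interp_le hT (τ k) (fun j hj => H.sup k j hj β) t.2)
    (fun ε hε => ?_) (fun ε hε => ?_) (v := fun k t => curve η τ U 1 k t)
    (fun k t => H.coeFn_curve hT 1 ENNReal.one_ne_top k t)
    (fun k => (isCompact_range (curve η τ U 1 k).continuous).totallyBounded)
  · obtain ⟨δ, hδ, h⟩ := H.shift ε hε
    refine ⟨δ, hδ, fun k t γ hγ => ?_⟩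
    have h1 := tsum_abs_interp_le hT (τ k) (A := fun j β => U k j (β + γ) - U k j β)
      (fun j hj => (((Equiv.addRight γ).summable_iff.2 (H.summable k j hj).of_abs).sub
        (H.summable k j hj).of_abs).abs) (pow_pos (H.pos k) N).le
      (fun j hj => h k j hj γ hγ) t.2
    refine le_trans (le_of_eq ?_) h1
    congr 1
    refine tsum_congr fun β => ?_
    obtain ⟨m, hm, c, hc, he⟩ := (τ k).exists_interp_eq hT t.2
    simp only [he, smul_eq_mul]
    congr 1
    ring
  · obtain ⟨R, h⟩ := H.tail ε hε
    exact ⟨R, fun k t => lintegral_interp_le hT (τ k)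
      (fun j => (measurable_of_countable (U k j)).comp (measurable_idx _)) _ (h k) t.2⟩

/-- The pairing is linear and so commutes with interpolation in time; what remains is a real
sequence with controlled increments. -/
theorem abs_pairing_curve_sub_le (H : UniformEstimates η τ U M)
    {θ : Space N → ℝ} (hθ : ContDiff ℝ ((⊤ : ℕ∞) : WithTop ℕ∞) θ) (hc : HasCompactSupport θ) {B : ℝ}
    (hB : ∀ x, ‖θ x‖ ≤ B) {ε : ℝ} (hε : 0 < ε) :
    ∃ K : ℝ, 0 ≤ K ∧ ∀ k (s t : Icc (0 : ℝ) T),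
      |pairing θ hθ.continuous hB (curve η τ U 1 k t) -
        pairing θ hθ.continuous hB (curve η τ U 1 k s)| ≤ |(t : ℝ) - s| * K + ε := by
  obtain ⟨K, hK, h⟩ := H.weak θ hθ hc ε hε
  refine ⟨K, hK, fun k => ?_⟩
  obtain ⟨e, he0, he, hinc⟩ := h k
  set P := pairing θ hθ.continuous hB with hP
  set F : ℕ → ℝ := fun j => P (gridLp 1 (η k) (U k j)) with hF
  have hPF : ∀ t : Icc (0 : ℝ) T, P (curve η τ U 1 k t) = (τ k).interp F t := fun t => by
    show P ((τ k).interp _ _) = _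
    simp only [TimeGrid.interp, map_add, map_sum, map_smul, map_sub, hF]
  have hFj : ∀ j ≤ (τ k).J, F j = ∫ x, θ x * U k j (idx (η k) x) := fun j hj => by
    simp only [hF, hP, pairing_apply]
    refine integral_congr_ae ?_
    filter_upwards [coeFn_gridLp le_rfl ENNReal.one_ne_top (H.pos k) (H.summable k j hj)] with x hx
    rw [hx]
  have hFinc : ∀ j < (τ k).J, ‖F (j + 1) - F j‖ ≤ (τ k).step j * K + e j := fun j hj => by
    rw [hFj j hj.le, hFj (j + 1) hj]
    exact hinc j hj
  have main : ∀ s t : Icc (0 : ℝ) T, (s : ℝ) ≤ t →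
      |P (curve η τ U 1 k t) - P (curve η τ U 1 k s)| ≤ |(t : ℝ) - s| * K + ε :=
    fun s t hst => by
      rw [hPF, hPF, abs_of_nonneg (sub_nonneg.2 hst)]
      exact (τ k).norm_interp_sub_le hFinc he0 he hst s.2 t.2
  intro s t
  rcases le_total (s : ℝ) t with hst | hst
  · exact main s t hst
  · rw [abs_sub_comm, abs_sub_comm (t : ℝ)]
    exact main t s hst

/-- Compactness turns weak equicontinuity into strong. If it failed, there would be `t n → t₀` and
indices `k n` whose values at `t n` and `t₀` stay `ε` apart; along a subsequence both converge in
`L¹`. The limits have equal pairings with all test functions, hence coincide, a contradiction. -/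
theorem equicontinuous_curve (H : UniformEstimates η τ U M) (hT : 0 < T) (t₀ : Icc (0 : ℝ) T)
    {ε : ℝ} (hε : 0 < ε) : ∃ δ > 0, ∀ t, dist t t₀ < δ → ∀ k,
      dist (curve η τ U 1 k t) (curve η τ U 1 k t₀) < ε := by
  by_contra! hcon
  have hpos : ∀ n : ℕ, (0 : ℝ) < 1 / (n + 1) := fun n => Nat.one_div_pos_of_nat
  choose t ht k hk using fun n : ℕ => hcon (1 / (n + 1)) (hpos n)
  have hcomp : IsCompact (closure (range fun p : ℕ × Icc (0 : ℝ) T => curve η τ U 1 p.1 p.2)) :=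
    (H.totallyBounded_range_curve hT).closure.isCompact_of_isClosed isClosed_closure
  set 𝒦 := closure (range fun p : ℕ × Icc (0 : ℝ) T => curve η τ U 1 p.1 p.2)
  have hmem : ∀ n, (curve η τ U 1 (k n) (t n), curve η τ U 1 (k n) t₀) ∈ 𝒦 ×ˢ 𝒦 := fun n =>
    ⟨subset_closure ⟨(k n, t n), rfl⟩, subset_closure ⟨(k n, t₀), rfl⟩⟩
  obtain ⟨⟨a, b⟩, _, σ, hσ, hlim⟩ := (hcomp.prod hcomp).tendsto_subseq hmem
  have hla : Tendsto (fun n => curve η τ U 1 (k (σ n)) (t (σ n))) atTop (𝓝 a) :=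
    (continuous_fst.tendsto _).comp hlim
  have hlb : Tendsto (fun n => curve η τ U 1 (k (σ n)) t₀) atTop (𝓝 b) :=
    (continuous_snd.tendsto _).comp hlim
  have hdist : ε ≤ dist a b := ge_of_tendsto (hla.dist hlb) (Eventually.of_forall fun n => hk _)
  have htime : Tendsto (fun n => |((t (σ n) : Icc (0 : ℝ) T) : ℝ) - t₀|) atTop (𝓝 0) := by
    refine squeeze_zero (fun n => abs_nonneg _) (fun n => (ht (σ n)).le)
      (tendsto_one_div_add_atTop_nhds_zero_nat.comp hσ.tendsto_atTop)
  have hab : a = b := by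
    refine Lp.ext ?_
    refine ae_eq_of_integral_contDiff_smul_eq (L1.integrable_coeFn a).locallyIntegrable
      (L1.integrable_coeFn b).locallyIntegrable fun θ hθ hc => ?_
    obtain ⟨B, hB⟩ := hθ.continuous.bounded_above_of_compact_support hc
    set P := pairing θ hθ.continuous hB with hP
    show P a = P b
    have h1 : Tendsto (fun n => |P (curve η τ U 1 (k (σ n)) (t (σ n))) -
        P (curve η τ U 1 (k (σ n)) t₀)|) atTop (𝓝 |P a - P b|) :=
      (((P.continuous.tendsto a).comp hla).sub ((P.continuous.tendsto b).comp hlb)).abs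
    have h2 : |P a - P b| ≤ 0 := by
      refine le_of_forall_pos_le_add fun ε' hε' => ?_
      obtain ⟨K, _, hK⟩ := H.abs_pairing_curve_sub_le hθ hc hB hε'
      have h3 := (htime.mul_const K).add_const ε'
      rw [zero_mul] at h3
      exact le_of_tendsto_of_tendsto' h1 h3 fun n => hK _ _ _
    exact sub_eq_zero.1 (abs_eq_zero.1 (le_antisymm h2 (abs_nonneg _)))
  rw [hab, dist_self] at hdist
  linarith

/-- Arzelà–Ascoli, with values in one compact subset of `L¹` common to all times and all grids. -/
theorem exists_subseq_cauchy (H : UniformEstimates η τ U M) (hT : 0 < T) :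
    ∃ σ : ℕ → ℕ, StrictMono σ ∧ ∀ ε > 0, ∃ n₀, ∀ n ≥ n₀, ∀ m ≥ n₀, ∀ t,
      dist (curve η τ U 1 (σ n) t) (curve η τ U 1 (σ m) t) < ε := by
  have hcomp : IsCompact (closure (range fun p : ℕ × Icc (0 : ℝ) T => curve η τ U 1 p.1 p.2)) :=
    (H.totallyBounded_range_curve hT).closure.isCompact_of_isClosed isClosed_closure
  set f : ℕ → BoundedContinuousFunction (Icc (0 : ℝ) T) (Lp ℝ 1 (volume : Measure (Space N))) :=
    fun k => BoundedContinuousFunction.mkOfCompact (curve η τ U 1 k) with hf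
  have hA : IsCompact (closure (range f)) := by
    refine BoundedContinuousFunction.arzela_ascoli _ hcomp _ ?_ ?_
    · rintro _ t ⟨k, rfl⟩
      exact subset_closure ⟨(k, t), rfl⟩
    · intro t₀
      rw [Metric.equicontinuousAt_iff]
      intro ε hε
      obtain ⟨δ, hδ, h⟩ := H.equicontinuous_curve hT t₀ hε
      refine ⟨δ, hδ, fun t ht => ?_⟩
      rintro ⟨_, k, rfl⟩
      rw [dist_comm]
      exact h t ht k
  obtain ⟨_, _, σ, hσ, hlim⟩ := hA.tendsto_subseq fun k => subset_closure (mem_range_self k)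
  refine ⟨σ, hσ, fun ε hε => ?_⟩
  obtain ⟨n₀, hn₀⟩ := Metric.cauchySeq_iff.1 hlim.cauchySeq ε hε
  exact ⟨n₀, fun n hn m hm t =>
    (BoundedContinuousFunction.dist_coe_le_dist t).trans_lt (hn₀ n hn m hm)⟩

/-- Two interpolants differ by at most `2 M`, so their `L^r` distance is a power of their `L¹`
distance up to a constant. Hence compactness is needed only in `L¹`. -/
theorem dist_curve_le (H : UniformEstimates η τ U M) (hT : 0 < T) {r : ℝ≥0∞} [hr1 : Fact (1 ≤ r)]
    (hr : r ≠ ∞) (k m : ℕ) (t : Icc (0 : ℝ) T) :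
    dist (curve η τ U r k t) (curve η τ U r m t) ≤ (2 * M) ^ ((r.toReal - 1) / r.toReal) *
      dist (curve η τ U 1 k t) (curve η τ U 1 m t) ^ (1 / r.toReal) := by
  set f : Space N → ℝ := fun x => (τ k).interp (fun j => U k j (idx (η k) x)) t -
    (τ m).interp (fun j => U m j (idx (η m) x)) t with hf
  have hM : ∀ x, |f x| ≤ 2 * M := fun x => by
    have h1 := abs_interp_le hT (τ k) (fun j hj => H.sup k j hj (idx (η k) x)) t.2
    have h2 := abs_interp_le hT (τ m) (fun j hj => H.sup m j hj (idx (η m) x)) t.2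
    exact (abs_sub _ _).trans (by linarith)
  have hM0 : 0 ≤ 2 * M := (abs_nonneg _).trans (hM 0)
  have e : ∀ (q : ℝ≥0∞) [Fact (1 ≤ q)], q ≠ ∞ →
      edist (curve η τ U q k t) (curve η τ U q m t) = eLpNorm f q volume := fun q _ hq => by
    rw [Lp.edist_def]
    refine eLpNorm_congr_ae ?_
    filter_upwards [H.coeFn_curve hT q hq k t, H.coeFn_curve hT q hq m t] with x h1 h2
    rw [Pi.sub_apply, h1, h2]
  have h := eLpNorm_le_of_bound (μ := volume) (Eventually.of_forall hM) hr1.out hr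
  rw [← e r hr, ← e 1 ENNReal.one_ne_top, edist_dist, edist_dist] at h
  have hr' : 1 ≤ r.toReal := by
    rw [← ENNReal.toReal_one]; exact ENNReal.toReal_mono hr hr1.out
  rw [ENNReal.ofReal_rpow_of_nonneg hM0 (div_nonneg (by linarith) (by linarith)),
    ENNReal.ofReal_rpow_of_nonneg dist_nonneg (by positivity),
    ← ENNReal.ofReal_mul (by positivity)] at h
  exact (ENNReal.ofReal_le_ofReal_iff (by positivity)).1 h

/-- Compactness in `C([0,T]; L^r)` from the uniform estimates. -/
theorem exists_subseq_tendsto (H : UniformEstimates η τ U M) (hT : 0 < T) {r : ℝ≥0∞}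
    [hr1 : Fact (1 ≤ r)] (hr : r ≠ ∞) : ∃ σ : ℕ → ℕ, StrictMono σ ∧
      ∃ u, Tendsto (fun n => curve η τ U r (σ n)) atTop (𝓝 u) := by
  obtain ⟨σ, hσ, h⟩ := H.exists_subseq_cauchy hT
  refine ⟨σ, hσ, cauchySeq_tendsto_of_complete (Metric.cauchySeq_iff.2 fun ε hε => ?_)⟩
  have hr' : 1 ≤ r.toReal := by
    rw [← ENNReal.toReal_one]; exact ENNReal.toReal_mono hr hr1.out
  have hM0 : 0 ≤ M := (abs_nonneg _).trans (H.sup 0 0 (Nat.zero_le _) 0)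
  set C : ℝ := (2 * M) ^ ((r.toReal - 1) / r.toReal) with hC
  have hC0 : 0 ≤ C := by positivity
  have hε' : 0 < ε / (C + 1) := by positivity
  -- The `L¹` tolerance whose `r`-th root, multiplied by `C`, is at most `ε / 2`.
  obtain ⟨n₀, hn₀⟩ := h ((ε / 2 / (C + 1)) ^ r.toReal) (by positivity)
  refine ⟨n₀, fun n hn m hm => ?_⟩
  refine lt_of_le_of_lt ((ContinuousMap.dist_le (by positivity : 0 ≤ ε / 2)).2 fun t => ?_)
    (half_lt_self hε)
  refine (H.dist_curve_le hT hr _ _ t).trans ?_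
  have h1 : dist (curve η τ U 1 (σ n) t) (curve η τ U 1 (σ m) t) ^ (1 / r.toReal) ≤
      ε / 2 / (C + 1) := by
    calc _ ≤ ((ε / 2 / (C + 1)) ^ r.toReal) ^ (1 / r.toReal) :=
          Real.rpow_le_rpow dist_nonneg (hn₀ n hn m hm t).le (by positivity)
      _ = _ := by
          rw [← Real.rpow_mul (by positivity), mul_one_div_cancel (by linarith), Real.rpow_one]
  calc _ ≤ C * (ε / 2 / (C + 1)) := mul_le_mul_of_nonneg_left h1 hC0
    _ ≤ ε / 2 := by
        rw [mul_div_assoc', div_le_iff₀ (by positivity)]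
        nlinarith

end UniformEstimates

/-! ### Verification of the uniform estimates for the scheme. -/

namespace AssumptionPhi

variable {a : ℝ≥0} {φ : ℝ → ℝ}

theorem continuous (hφ : AssumptionPhi a φ) : Continuous φ := by
  rw [continuous_iff_continuousAt]
  intro x
  obtain ⟨C, hC⟩ := hφ.holder (Icc (x - 1) (x + 1)) isCompact_Icc
  exact (hC.continuousOn hφ.exp_pos).continuousAt (Icc_mem_nhds (by linarith) (by linarith))

theorem exists_abs_sub_le (hφ : AssumptionPhi a φ) (M : ℝ) :
    ∃ H : ℝ, 0 ≤ H ∧ ∀ u, |u| ≤ M → |φ u - φ 0| ≤ H * |u| ^ (a : ℝ) := by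
  obtain ⟨C, hC⟩ := hφ.holder (Icc (-M) M) isCompact_Icc
  refine ⟨C, C.coe_nonneg, fun u hu => ?_⟩
  have hM : 0 ≤ M := (abs_nonneg _).trans hu
  have h := hC.dist_le (x := u) (y := 0) (abs_le.1 hu) ⟨by linarith, hM⟩
  rwa [Real.dist_eq, Real.dist_eq, sub_zero] at h

end AssumptionPhi

/-- Integrable functions are bounded up to a small excess. -/
theorem exists_integral_excess_le (hT : 0 ≤ T) {b : ℝ → ℝ} (hb : IntervalIntegrable b volume 0 T)
    (hb0 : ∀ t, 0 ≤ b t) {ε : ℝ} (hε : 0 < ε) :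
    ∃ K : ℝ, 0 ≤ K ∧ ∫ t in 0..T, max (b t - K) 0 ≤ ε := by
  have hbi : Integrable b (volume.restrict (Ioc 0 T)) :=
    (intervalIntegrable_iff_integrableOn_Ioc_of_le hT).1 hb
  have hlim : Tendsto (fun K : ℝ => ∫ t in Ioc 0 T, max (b t - K) 0) atTop
      (𝓝 (∫ _t in Ioc 0 T, (0 : ℝ))) := by
    refine tendsto_integral_filter_of_dominated_convergence b
      (Eventually.of_forall fun K => ?_) ?_ hbi (Eventually.of_forall fun t => ?_)
    · exact (hbi.aestronglyMeasurable.sub aestronglyMeasurable_const).sup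
        aestronglyMeasurable_const
    · filter_upwards [eventually_ge_atTop (0 : ℝ)] with K hK
      refine Eventually.of_forall fun t => ?_
      rw [Real.norm_of_nonneg (le_max_right _ _)]
      exact max_le (by linarith) (hb0 t)
    · refine tendsto_const_nhds.congr' ?_
      filter_upwards [eventually_ge_atTop (b t)] with K hK
      exact (max_eq_right (by linarith)).symm
  rw [integral_zero] at hlim
  obtain ⟨K, hK, hK0⟩ := ((hlim.eventually_le_const hε).and (eventually_ge_atTop 0)).exists
  exact ⟨K, hK0, by rwa [intervalIntegral.integral_of_le hT]⟩

theorem integral_mul_comp_idx {h : ℝ} (hh : 0 < h) {θ : Space N → ℝ} (hθ : Continuous θ) {B : ℝ}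
    (hB : ∀ x, ‖θ x‖ ≤ B) {V : Idx N → ℝ} (hV : Summable fun β => |V β|) :
    Summable (fun β => V β * initialAverage h θ β) ∧
      ∫ x, θ x * V (idx h x) = h ^ N * ∑' β, V β * initialAverage h θ β := by
  have hp := pow_pos hh N
  have hi : Integrable (fun x => θ x * V (idx h x)) :=
    (integrable_comp_idx hh hV).bdd_mul hθ.aestronglyMeasurable (Eventually.of_forall hB)
  have hs := hasSum_setIntegral_cell hh hi
  have e : ∀ β, ∫ x in cell h β, θ x * V (idx h x) = h ^ N * (V β * initialAverage h θ β) :=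
    fun β => by
      rw [setIntegral_congr_fun (measurableSet_cell hh β) (g := fun x => θ x * V β)
        fun x hx => by simp only [(mem_cell_iff hh).1 hx], integral_mul_const,
        ← pow_mul_initialAverage hh]
      ring
  simp_rw [e] at hs
  refine ⟨(summable_mul_left_iff hp.ne').1 hs.summable, ?_⟩
  rw [← hs.tsum_eq, tsum_mul_left]

namespace IsSchemeSolution

variable {φ : ℝ → ℝ} {u₀ : Space N → ℝ} {g : Space N → ℝ → ℝ} {S : Stencil N} {h : ℝ}
  {τ : TimeGrid T} {U : ℕ → Idx N → ℝ}

/-- The increments of a solution tested against a smooth function. -/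
theorem abs_integral_increment_le (hU : IsSchemeSolution φ u₀ g S h τ U) (hh : 0 < h)
    (hS : S.IsSymm) (hg : IntegrableST T g)
    {θ : Space N → ℝ} (hθ : Continuous θ) (hc : HasCompactSupport θ) {B Φ L : ℝ}
    (hB : ∀ x, ‖θ x‖ ≤ B) {j : ℕ} (hj : j < τ.J) (hΦ : ∀ β, |φ (U (j + 1) β) - φ 0| ≤ Φ)
    (hLs : Summable fun β => |S.op (initialAverage h θ) β|)
    (hL : h ^ N * ∑' β, |S.op (initialAverage h θ) β| ≤ L) :
    |(∫ x, θ x * U (j + 1) (idx h x)) - ∫ x, θ x * U j (idx h x)| ≤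
      τ.step j * (Φ * L) + B * ∫ t in τ.time j..τ.time (j + 1), spaceNorm g t := by
  have hp := pow_pos hh N
  have hst := (τ.time_lt j hj).le
  have hstep := τ.step_pos hj
  have hB0 : 0 ≤ B := (norm_nonneg _).trans (hB 0)
  have hΦ0 : 0 ≤ Φ := (abs_nonneg _).trans (hΦ 0)
  have hθi : Integrable θ := hθ.integrable_of_hasCompactSupport hc
  set p := initialAverage h θ with hpdef
  have hpB : ∀ β, |p β| ≤ B := abs_initialAverage_le hh (Eventually.of_forall hB)
  have hps : Summable p := (summable_abs_initialAverage hh hθi).of_abs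
  have hint : Integrable (stepSource τ g j) :=
    hg.integrable_intervalIntegral (τ.time_nonneg hj.le) hst (τ.time_le hj)
  have hsa := summable_abs_initialAverage hh hint
  set w : Idx N → ℝ := fun β => φ (U (j + 1) β) - φ 0 with hw
  -- The operator moves from the bounded function `φ(U) - φ(0)` to the summable averages of `θ`,
  -- where its `ℓ¹` norm is controlled.
  obtain ⟨hdual_s, hdual⟩ := Stencil.summable_op_mul_and_tsum_eq hS hps hΦ
  obtain ⟨s1, e1⟩ := integral_mul_comp_idx hh hθ hB (hU.summable (j + 1) hj)
  obtain ⟨s0, e0⟩ := integral_mul_comp_idx hh hθ hB (hU.summable j hj.le)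
  have s2 : Summable (fun β => |initialAverage h (stepSource τ g j) β| * B) := hsa.mul_right B
  have hle2 : ∀ β, ‖initialAverage h (stepSource τ g j) β * p β‖ ≤
      |initialAverage h (stepSource τ g j) β| * B := fun β => by
    rw [norm_mul]
    exact mul_le_mul_of_nonneg_left (hpB β) (abs_nonneg _)
  have s3 : Summable (fun β => initialAverage h (stepSource τ g j) β * p β) :=
    Summable.of_norm_bounded s2 hle2
  have heq : ∀ β, τ.step j * (p β * S.op w β) = U (j + 1) β * p β - U j β * p β -
      initialAverage h (stepSource τ g j) β * p β := fun β => by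
    rw [hw, Stencil.op_sub_const, hU.scheme j hj β, step_mul_sourceAverage hg h τ hj β]
    ring
  have hsum : ∑' β, U (j + 1) β * p β - ∑' β, U j β * p β =
      τ.step j * ∑' β, S.op p β * w β + ∑' β, initialAverage h (stepSource τ g j) β * p β := by
    rw [hdual, ← tsum_mul_left, tsum_congr heq, (s1.sub s0).tsum_sub s3, s1.tsum_sub s0]
    ring
  have hle1 : ∀ β, ‖S.op p β * w β‖ ≤ |S.op p β| * Φ := fun β => by
    rw [norm_mul]
    exact mul_le_mul_of_nonneg_left (hΦ β) (abs_nonneg _)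
  have h1 : |∑' β, S.op p β * w β| ≤ (∑' β, |S.op p β|) * Φ := by
    rw [← tsum_mul_right]
    exact tsum_of_norm_bounded (hLs.mul_right Φ).hasSum hle1
  have h2 : |∑' β, initialAverage h (stepSource τ g j) β * p β| ≤
      (∑' β, |initialAverage h (stepSource τ g j) β|) * B := by
    rw [← tsum_mul_right]
    exact tsum_of_norm_bounded s2.hasSum hle2
  have h3 : h ^ N * ∑' β, |initialAverage h (stepSource τ g j) β| ≤
      ∫ t in τ.time j..τ.time (j + 1), spaceNorm g t :=
    (tsum_abs_initialAverage_le hh hint).trans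
      (hg.integral_abs_intervalIntegral_le (τ.time_nonneg hj.le) hst (τ.time_le hj))
  rw [e1, e0, ← mul_sub, hsum, abs_mul, abs_of_pos hp]
  calc _ ≤ h ^ N * (τ.step j * ((∑' β, |S.op p β|) * Φ) +
        (∑' β, |initialAverage h (stepSource τ g j) β|) * B) := by
        refine mul_le_mul_of_nonneg_left ((abs_add_le _ _).trans (add_le_add ?_ h2)) hp.le
        rw [abs_mul, abs_of_pos hstep]
        exact mul_le_mul_of_nonneg_left h1 hstep.le
    _ = τ.step j * (Φ * (h ^ N * ∑' β, |S.op p β|)) +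
        B * (h ^ N * ∑' β, |initialAverage h (stepSource τ g j) β|) := by ring
    _ ≤ _ := by gcongr

end IsSchemeSolution

/-- The three alternatives for the operator enter only through the decay rate of
`OperatorCondition.exists_decay`. -/
theorem uniformEstimates (hN : 1 ≤ N) (hT : 0 < T) {a : ℝ≥0} {φ : ℝ → ℝ} (hφ : AssumptionPhi a φ)
    {g : Space N → ℝ → ℝ} (hg : AssumptionG T g) {u₀ : Space N → ℝ} (hu₀ : AssumptionU0 u₀)
    {S : ℝ → Stencil N} (hS : OperatorCondition N a S) {τ : ℝ → TimeGrid T}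
    {U : ℝ → ℕ → Idx N → ℝ}
    (hU : ∀ h ∈ Ioo (0 : ℝ) 1, IsSchemeSolution φ u₀ g (S h) h (τ h) (U h))
    {η : ℕ → ℝ} (hη : ∀ k, η k ∈ Ioo (0 : ℝ) 1) (hη₀ : Tendsto η atTop (𝓝 0)) :
    UniformEstimates η (fun k => τ (η k)) (fun k => U (η k))
      (IsSchemeSolution.supBound T u₀ g) := by
  obtain ⟨α, Q, hα, hNα, hQ0, hdec⟩ := hS.exists_decay hN
  have hφc := hφ.continuous
  have hu₀i : Integrable u₀ := memLp_one_iff_integrable.1 hu₀.memLp_one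
  have hgi := hg.integrableST
  set M := IsSchemeSolution.supBound T u₀ g with hM
  obtain ⟨H, hH0, hH⟩ := hφ.exists_abs_sub_le M
  have ha0 : (0 : ℝ) < a := hφ.exp_pos
  have ha1 : (a : ℝ) ≤ 1 := hφ.exp_le_one
  have hsup : ∀ k, ∀ j ≤ (τ (η k)).J, ∀ β, |U (η k) j β| ≤ M := fun k j hj β =>
    (hU _ (hη k)).abs_le_supBound (hη k).1 (hdec _ (hη k)).1 hφ.mono hu₀ hg hj β
  refine ⟨fun k => (hη k).1, hη₀, fun k => (hU _ (hη k)).summable, hsup, fun ε hε => ?_,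
    fun ε hε => ?_, fun θ hθ hc ε hε => ?_⟩
  · have h1 := (tendsto_integral_abs_translate_sub volume hu₀i).add
      (tendsto_spaceNorm_translate_sub hT.le hgi)
    rw [add_zero] at h1
    obtain ⟨δ, hδ, hball⟩ := Metric.eventually_nhds_iff.1 (h1.eventually_le_const hε)
    refine ⟨δ, hδ, fun k j hj γ hγ => ?_⟩
    exact ((hU _ (hη k)).tsum_abs_translate_sub_le (hη k).1 (hdec _ (hη k)).1 hT.le hφ.mono hφc
      hu₀i hgi γ hj).trans (hball (by rwa [dist_zero_right]))
  · have hcs : ContDiff ℝ 2 (cutoff N : Space N → ℝ) := (cutoff N).contDiff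
    obtain ⟨C, hC0, hC1, hC2⟩ := exists_second_difference_bound hcs (cutoff N).hasCompactSupport
    have h1 := (tendsto_setIntegral_norm_ge hu₀i N).add (tendsto_spaceNorm_norm_ge hT.le hgi N)
    have h2 : Tendsto (fun R : ℝ => T * (H * C * Q * ((∫ x, |u₀ x|) +
        (∫ t in 0..T, spaceNorm g t) + 1) * R ^ ((N : ℝ) * (1 - a) - α))) atTop (𝓝 0) := by
      -- The exponent is negative exactly because `N (1 - a) < α`.
      have h3 : Tendsto (fun R : ℝ => R ^ (-(α - (N : ℝ) * (1 - a)))) atTop (𝓝 0) :=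
        tendsto_rpow_neg_atTop (by linarith)
      rw [neg_sub] at h3
      simpa using (h3.const_mul _).const_mul T
    have h4 := h1.add h2
    rw [add_zero, add_zero] at h4
    obtain ⟨R, hRε, hR1⟩ := ((h4.eventually_le_const hε).and (eventually_gt_atTop 1)).exists
    have hR0 : 0 < R := by linarith
    -- Beyond this radius the tail weight equals `1`, so the weighted sum dominates the tail.
    refine ⟨2 * R + N, fun k j hj => ?_⟩
    have hs := (hU _ (hη k)).summable j hj
    have htail := ((hU _ (hη k)).tail_le (hη k) (hdec _ (hη k)).1 hT.le hφ.mono hφc hu₀ hg ha0 ha1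
      hH0 hH hC0 hC1 hC2 ((hdec _ (hη k)).2 R hR1) hR1 hj).trans hRε
    set V : Idx N → ℝ := fun β => U (η k) j β * tailWeight (η k) R β with hV
    have hVa : ∀ β, |V β| = |U (η k) j β| * tailWeight (η k) R β := fun β => by
      rw [hV, abs_mul, abs_of_nonneg (tailWeight_mem (hη k).1 R β).1]
    have hVs : Summable (fun β => |V β|) := Summable.of_nonneg_of_le (fun β => abs_nonneg _)
      (fun β => by
        rw [hVa]
        exact mul_le_of_le_one_right (abs_nonneg _) (tailWeight_mem (hη k).1 R β).2) hs
    calc _ = ∫⁻ x in {x : Space N | 2 * R + N ≤ ‖x‖}, ‖V (idx (η k) x)‖ₑ := by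
          refine setLIntegral_congr_fun (measurableSet_le measurable_const measurable_norm)
            fun x hx => ?_
          simp only [hV]
          rw [tailWeight_eq_one (hη k) hR0 ((mem_cell_iff (hη k).1).2 rfl) hx, mul_one]
      _ ≤ ∫⁻ x, ‖V (idx (η k) x)‖ₑ := setLIntegral_le_lintegral _ _
      _ = ENNReal.ofReal (η k ^ N * ∑' β, |V β|) := lintegral_enorm_comp_idx (hη k).1 hVs
      _ ≤ ENNReal.ofReal ε := by
          refine ENNReal.ofReal_le_ofReal ?_
          simpa only [hVa] using htail
  · obtain ⟨B, hB⟩ := hθ.continuous.bounded_above_of_compact_support hc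
    have hB0 : 0 ≤ B := (norm_nonneg _).trans (hB 0)
    -- The decay of the truncated moments is known only for `R > 1`. Writing `θ` as the dilation by
    -- `2` of another test function makes it available at `R = 2`.
    set ϑ : Space N → ℝ := fun x => θ ((2 : ℝ) • x) with hϑ
    have hϑd : ContDiff ℝ 2 ϑ :=
      (contDiff_infty.1 hθ 2).comp (contDiff_const_smul (2 : ℝ))
    have hϑc : HasCompactSupport ϑ := hc.comp_smul two_ne_zero
    obtain ⟨C, hC0, hC1, hC2⟩ := exists_second_difference_bound hϑd hϑc
    have hθϑ : (fun x => ϑ ((2 : ℝ)⁻¹ • x)) = θ := by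
      funext x
      simp [hϑ, smul_smul]
    have hb := hgi.intervalIntegrable_spaceNorm hT.le
    -- The spatial norm of `g` is merely integrable in time. Its part below `K` gives a Lipschitz
    -- contribution, and the excess over `K` goes into the errors `e j`, whose total is at most `B ε
    -- / (B + 1) ≤ ε`.
    obtain ⟨K, hK0, hK⟩ := exists_integral_excess_le hT.le hb (spaceNorm_nonneg g)
      (ε := ε / (B + 1)) (by positivity)
    have hM0 : 0 ≤ M := (abs_nonneg _).trans (hsup 0 0 (Nat.zero_le _) 0)
    set Φ : ℝ := H * M ^ (a : ℝ) with hΦ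
    set L : ℝ := C * 2 ^ N * (Q * 2 ^ (-α)) with hL
    refine ⟨Φ * L + B * K, by positivity, fun k => ?_⟩
    have hbs : ∀ {c : ℝ → ℝ}, IntervalIntegrable c volume 0 T → ∀ j < (τ (η k)).J,
        IntervalIntegrable c volume ((τ (η k)).time j) ((τ (η k)).time (j + 1)) :=
      fun hc j hj => by
        refine hc.mono_set ?_
        rw [uIcc_of_le ((τ (η k)).time_lt j hj).le, uIcc_of_le hT.le]
        exact Icc_subset_Icc ((τ (η k)).time_nonneg hj.le) ((τ (η k)).time_le hj)
    have hex : IntervalIntegrable (fun t => max (spaceNorm g t - K) 0) volume 0 T := by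
      rw [intervalIntegrable_iff_integrableOn_Ioc_of_le hT.le] at hb ⊢
      exact (Integrable.sub hb (integrable_const K)).pos_part
    refine ⟨fun j => B * ∫ t in (τ (η k)).time j..(τ (η k)).time (j + 1),
      max (spaceNorm g t - K) 0, fun j hj => ?_, ?_, fun j hj => ?_⟩
    · exact mul_nonneg hB0 (intervalIntegral.integral_nonneg ((τ (η k)).time_lt j hj).le
        fun t _ => le_max_right _ _)
    · rw [← Finset.mul_sum, intervalIntegral.sum_integral_adjacent_intervals (hbs hex),
        (τ (η k)).time_zero, (τ (η k)).time_last]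
      calc _ ≤ B * (ε / (B + 1)) := mul_le_mul_of_nonneg_left hK hB0
        _ ≤ ε := by
            rw [mul_div_assoc', div_le_iff₀ (by positivity)]
            nlinarith
    · obtain ⟨_, b2, b3⟩ := op_initialAverage_dilation_bound hϑd.continuous hϑc hC1 hC2 hC0
        (hdec _ (hη k)).1 (hη k).1 two_pos
      rw [hθϑ] at b2 b3
      have hQ2 := (hdec _ (hη k)).2 2 one_lt_two
      have hinc := (hU _ (hη k)).abs_integral_increment_le (hη k).1 (hdec _ (hη k)).1 hgi
        hθ.continuous hc hB hj (Φ := Φ) (fun β => (hH _ (hsup k (j + 1) hj β)).trans (by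
          rw [hΦ]
          gcongr
          exact hsup k (j + 1) hj β)) b2 (L := L) (b3.trans (mul_le_mul_of_nonneg_left hQ2 (by positivity)))
      refine hinc.trans ?_
      have hst := ((τ (η k)).time_lt j hj).le
      have h5 : ∫ t in (τ (η k)).time j..(τ (η k)).time (j + 1), spaceNorm g t ≤
          ∫ t in (τ (η k)).time j..(τ (η k)).time (j + 1), (K + max (spaceNorm g t - K) 0) := by
        refine intervalIntegral.integral_mono_on hst (hbs hb j hj)
          (intervalIntegrable_const.add (hbs hex j hj)) fun t _ => ?_
        linarith [le_max_left (spaceNorm g t - K) 0]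
      rw [intervalIntegral.integral_add intervalIntegrable_const (hbs hex j hj),
        intervalIntegral.integral_const, smul_eq_mul] at h5
      have h6 := mul_le_mul_of_nonneg_left h5 hB0
      rw [TimeGrid.step]
      linarith

end GPME

theorem theorem3p6 {N : ℕ} (hN : 1 ≤ N) {T : ℝ} (hT : 0 < T)
    (r : ℝ≥0∞) [Fact (1 ≤ r)] (hr : r ≠ ∞)
    (a : ℝ≥0) (φ : ℝ → ℝ) (hφ : GPME.AssumptionPhi a φ)
    (g : GPME.Space N → ℝ → ℝ) (hg : GPME.AssumptionG T g)
    (u₀ : GPME.Space N → ℝ) (hu₀ : GPME.AssumptionU0 u₀)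
    (c : ℝ) (hc : GPME.AssumptionSigma c)
    (μ : Measure (GPME.Space N)) (hμ : GPME.AssumptionMu μ)
    (S : ℝ → GPME.Stencil N) (hS : GPME.OperatorCondition N a S)
    (τ : ℝ → GPME.TimeGrid T) (U : ℝ → ℕ → GPME.Idx N → ℝ)
    (hU : ∀ h ∈ Ioo (0 : ℝ) 1, GPME.IsSchemeSolution φ u₀ g (S h) h (τ h) (U h))
    (η : ℕ → ℝ) (hη : ∀ k, η k ∈ Ioo (0 : ℝ) 1) (hη₀ : Tendsto η atTop (𝓝 0)) :
    ∃ k : ℕ → ℕ, StrictMono k ∧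
      ∃ (v : ℕ → C(Icc (0 : ℝ) T, Lp ℝ r (volume : Measure (GPME.Space N))))
        (u : C(Icc (0 : ℝ) T, Lp ℝ r (volume : Measure (GPME.Space N)))),
        (∀ n (t : Icc (0 : ℝ) T),
          v n t =ᵐ[volume] fun x =>
            GPME.spaceTimeInterp (η (k n)) (τ (η (k n))) (U (η (k n))) x t) ∧
        Tendsto v atTop (𝓝 u) := by
  have H := GPME.uniformEstimates hN hT hφ hg hu₀ hS hU hη hη₀
  obtain ⟨k, hk, u, hu⟩ := H.exists_subseq_tendsto hT hr
  refine ⟨k, hk, fun n => GPME.UniformEstimates.curve η _ _ r (k n), u, fun n t => ?_, hu⟩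
  -- On `[0, T]` the interpolant agrees pointwise with its ramp form, which represents the
  -- `L^r`-valued curve almost everywhere.
  simp only [(τ (η (k n))).spaceTimeInterp_eq (hη (k n)).1 (U (η (k n))) t.2]
  exact H.coeFn_curve hT r hr (k n) t
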